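/- **Setting.** Let $\{P_{\theta,\eta}:(\theta,\eta)\in\Theta\times\mathcal H\}$, $\Theta\subset\mathbb R^d$, be a semiparametric model with densities $\mathrm{lik}(\theta,\eta)$ with respect to a dominating measure, where $\mathcal H$ is a subset of a (semi)normed space. Let $X_1,X_2,\dots$ be i.i.d. from $P=P_{\theta_0,\eta_0}$, $\mathrm{lik}_n(\theta,\eta)=\prod_{i\le n}\mathrm{lik}(\theta,\eta)(X_i)$, $pl_n(\theta)=\sup_{\eta\in\mathcal H}\mathrm{lik}_n(\theta,\eta)$, let $\hat\eta_\theta=\hat\eta_{\theta,n}\in\mathcal H$ maximize $\mathrm{lik}_n(\theta,\cdot)$ for $\theta\in\Theta$, and let $\hat\theta_n\in\Theta$ maximize $pl_n$. Write $\mathbb P_n$ for the empirical measure, $\mathbb G_n=\sqrt n(\mathbb P_n-P)$, and $M_n(r)=n^{-1/2}+n^{-2r+1/2}$, where $r>1/4$ is fixed. All probabilities are outer probabilities and "random sequence" means an arbitrary sequence of maps on the underlying probability space. The efficient score $\tilde\ell_0$ for $\theta$ at $(\theta_0,\eta_0)$ is the score $\partial_\theta\log\mathrm{lik}(\theta,\eta_0)|_{\theta=\theta_0}$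 (assumed to be in $L_2(P)$) minus its projection in $L_2(P)$ on the closed linear span of the nuisance scores, i.e. of the derivatives at $s=0$ of $\log\mathrm{lik}(\theta_0,\eta_s)$ in $L_2^0(P)$, along a given family of paths $s\mapsto\eta_s\in\mathcal H$ approaching $\eta_0$ as $s\to0$. The efficient information matrix is $\tilde I_0=P\tilde\ell_0\tilde\ell_0^T$. There is a map $(t,\theta,\eta)\mapsto\eta_t(\theta,\eta)$, with values in $\mathcal H$ near $(\theta_0,\theta_0,\eta_0)$; put $\ell(t,\theta,\eta)=\log\mathrm{lik}(t,\eta_t(\theta,\eta))$, and let $\dot\ell,\ddot\ell,\ell^{(3)}$ be its first three derivatives in $t$ and $\ell_{t,\theta}$ the derivative of $\dot\ell$ in $\theta$. This submodel is least favorable: $\dot\ell_0:=\dot\ell(\theta_0,\theta_0,\eta_0)=\tilde\ell_0$ $P$-a.s. It is regular: for $(t,\theta)$ near $(\theta_0,\theta_0)$ the densities $\mathrm{lik}(t,\eta_t(\theta,\eta_0))$ are twice continuously differentiable in $(t,\theta)$ with first and second derivatives dominated by a function integrable with respect to the dominating measure, and vanish almost everywhere where $\mathrm{lik}(\theta_0,\eta_0)$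 does. **Assumptions.** - (Rate) $\|\hat\eta_{\tilde\theta_n}-\eta_0\|=O_P(\|\tilde\theta_n-\theta_0\|+n^{-r})$ for every random sequence $\tilde\theta_n\in\Theta$ with $\tilde\theta_n\to\theta_0$ in probability. - (A1) $\Theta$ is compact and $\theta_0$ is an interior point of $\Theta$. (A2) $\eta_\theta(\theta,\eta)=\eta$ for all $(\theta,\eta)\in\Theta\times\mathcal H$. (A3) $\tilde I_0$ is positive definite. - (B1) In some neighborhood of $(\theta_0,\theta_0,\eta_0)$ the derivatives $\frac{\partial^{l+m}}{\partial t^l\partial\theta^m}\ell(t,\theta,\eta)$, $(l,m)=(0,0),(1,0),(2,0),(3,0),(1,1),(1,2),(2,1)$, exist (as continuous derivatives in the variable last differentiated) and have an envelope in $L_1(P)$. - (B2) For every random sequence $\tilde\theta_n\in\Theta$ with $\tilde\theta_n\to\theta_0$ in probability, $\mathbb G_n(\dot\ell(\theta_0,\theta_0,\hat\eta_{\tilde\theta_n})-\dot\ell_0)=O_P(M_n(r)+(n^{1/2-r}\vee1)\|\tilde\theta_n-\theta_0\|)$; and for all $\eta\in\mathcal H$ in some neighborhood of $\eta_0$, $P\ddot\ell(\theta_0,\theta_0,\eta)-P\ddot\ell(\theta_0,\theta_0,\eta_0)=O(\|\eta-\eta_0\|)$,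 $P\ell_{t,\theta}(\theta_0,\theta_0,\eta)-P\ell_{t,\theta}(\theta_0,\theta_0,\eta_0)=O(\|\eta-\eta_0\|)$, $P\dot\ell(\theta_0,\theta_0,\eta)=O(\|\eta-\eta_0\|^2)$. - (C1) For some neighborhood $V$ of $(\theta_0,\theta_0,\eta_0)$ and all $i,j,k$, the classes $\{\ddot\ell_{i,j}(t,\theta,\eta):(t,\theta,\eta)\in V\}$ and $\{(\ell_{t,\theta})_{i,j}(t,\theta,\eta):(t,\theta,\eta)\in V\}$ are $P$-Donsker and $\{\ell^{(3)}_{i,j,k}(t,\theta,\eta):(t,\theta,\eta)\in V\}$ is $P$-Glivenko–Cantelli. - (Identifiability) With $\Delta_n(\theta)=n^{-1}\{\log pl_n(\theta)-\log pl_n(\hat\theta_n)\}$: for any random sequence $\tilde\theta_n\in\Theta$, $\Delta_n(\tilde\theta_n)=o_P(1)$ implies $\tilde\theta_n=\theta_0+o_P(1)$. - (Prior) $\rho$ is a proper prior density on $\Theta$, $\rho(\theta_0)>0$, and $\rho$ is continuously differentiable in a neighborhood of $\theta_0$. Almost surely, $pl_n$ is Lebesgue measurable on $\Theta$ for every $n$.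 **Conclusion.** Let the posterior profile distribution of $\theta$ be the probability on $\Theta$ with Lebesgue density proportional to $\rho\,pl_n$, and let $f_n$ be the resulting density of $\sqrt n\,\tilde I_0^{1/2}(\theta-\hat\theta_n)$, that is, $$f_n(\xi)=\frac{(\rho\,pl_n 1_\Theta)\bigl(\hat\theta_n+n^{-1/2}\tilde I_0^{-1/2}\xi\bigr)}{n^{d/2}\det(\tilde I_0)^{1/2}\int_\Theta\rho(\theta)\,pl_n(\theta)\,d\theta}.$$ Then for every $\xi\in\mathbb R^d$, $$f_n(\xi)=\phi_d(\xi)+O_P(M_n(r)),$$ where $\phi_d$ is the density of the $d$-dimensional standard normal distribution. -/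

import Mathlib

open MeasureTheory Filter Set Metric
open scoped Topology NNReal ENNReal MatrixOrder

noncomputable section

namespace ProfileSampler

/-- `ℝ^d` with the Euclidean norm and Lebesgue measure. -/
abbrev Vec (d : ℕ) : Type := EuclideanSpace ℝ (Fin d)

/-- The `i`-th unit vector of `ℝ^d`. -/
abbrev unitVec {d : ℕ} (i : Fin d) : Vec d := EuclideanSpace.single i (1 : ℝ)

/-! ### Stochastic orders

`μ s` is the outer measure of `s` when `s` is not measurable, so all the probabilities below are
outer probabilities, and no measurability of the random quantities is needed. -/

section Stochastic

variable {Ω : Type*} [MeasurableSpace Ω]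

/-- `Y n = O_P(Z n)`: the ratio `|Y n| / Z n` is bounded in (outer) probability. -/
def IsBigOP (Pr : Measure Ω) (Y Z : ℕ → Ω → ℝ) : Prop :=
  ∀ ε : ℝ≥0∞, 0 < ε → ∃ C : ℝ, 0 < C ∧
    ∀ᶠ n in atTop, Pr {ω | C * Z n ω < |Y n ω|} ≤ ε

/-- `Y n = o_P(1)` for extended real random quantities. -/
def IsLittleOPOne (Pr : Measure Ω) (Y : ℕ → Ω → EReal) : Prop :=
  ∀ ε : ℝ, 0 < ε →
    Tendsto (fun n => Pr {ω | ¬ (((-ε : ℝ) : EReal) ≤ Y n ω ∧ Y n ω ≤ ((ε : ℝ) : EReal))})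
      atTop (𝓝 0)

/-- Outer expectation of a nonnegative function. -/
def outerExp (Pr : Measure Ω) (T : Ω → ℝ≥0∞) : ℝ≥0∞ :=
  ⨅ (U : Ω → ℝ≥0∞) (_ : Measurable U) (_ : T ≤ U), ∫⁻ ω, U ω ∂Pr

end Stochastic

/-! ### Empirical processes -/

section Empirical

variable {Ω 𝒳 : Type*} [MeasurableSpace Ω] [MeasurableSpace 𝒳]

/-- The empirical measure of `X 0, …, X (n-1)` applied to `f`. -/
def empMean (X : ℕ → Ω → 𝒳) (n : ℕ) (f : 𝒳 → ℝ) (ω : Ω) : ℝ :=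
  (∑ i ∈ Finset.range n, f (X i ω)) / n

/-- The empirical process `√n (ℙ_n - P) f`. -/
def empProc (X : ℕ → Ω → 𝒳) (P : Measure 𝒳) (n : ℕ) (f : 𝒳 → ℝ) (ω : Ω) : ℝ :=
  √(n : ℝ) * (empMean X n f ω - ∫ x, f x ∂P)

/-- The Banach space `ℓ^∞(𝓕)` of bounded real functions on the class `𝓕`. -/
abbrev EllInfty (𝓕 : Set (𝒳 → ℝ)) : Type _ := lp (fun _ : 𝓕 => ℝ) ∞

/-- `𝓕` is `P`-Donsker: the empirical processes, as maps into `ℓ^∞(𝓕)`, converge weakly (in the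
sense of outer expectations of bounded continuous functions) to a tight Borel law. -/
def IsDonsker (Pr : Measure Ω) (X : ℕ → Ω → 𝒳) (P : Measure 𝒳) (𝓕 : Set (𝒳 → ℝ)) : Prop :=
  (∀ f ∈ 𝓕, MemLp f 2 P) ∧
  ∃ G : ℕ → Ω → EllInfty 𝓕,
    (∀ n, ∀ᵐ ω ∂Pr, ∀ f : 𝓕, G n ω f = empProc X P n f ω) ∧
    ∃ L : @Measure (EllInfty 𝓕) (borel _),
      L univ = 1 ∧
      (∀ ε : ℝ≥0∞, 0 < ε → ∃ K : Set (EllInfty 𝓕), IsCompact K ∧ L Kᶜ ≤ ε) ∧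
      ∀ h : EllInfty 𝓕 → ℝ≥0, Continuous h → (∃ C, ∀ z, h z ≤ C) →
        Tendsto (fun n => outerExp Pr (fun ω => (h (G n ω) : ℝ≥0∞))) atTop
          (𝓝 (@lintegral (EllInfty 𝓕) (borel _) L (fun z => (h z : ℝ≥0∞))))

/-- `𝓕` is `P`-Glivenko–Cantelli: the law of large numbers holds uniformly over `𝓕`,
in outer probability. -/
def IsGlivenkoCantelli (Pr : Measure Ω) (X : ℕ → Ω → 𝒳) (P : Measure 𝒳)
    (𝓕 : Set (𝒳 → ℝ)) : Prop :=
  (∀ f ∈ 𝓕, Integrable f P) ∧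
  ∀ ε : ℝ, 0 < ε →
    Tendsto (fun n => Pr {ω | ∃ f ∈ 𝓕, ε < |empMean X n f ω - ∫ x, f x ∂P|}) atTop (𝓝 0)

end Empirical

/-- The partial derivative `∂^{l+m} f(t, θ) / ∂t^l ∂θ^m`: an `m`-linear map (in the increments
of `θ`) whose values are `l`-linear maps (in the increments of `t`). -/
def partialD {d : ℕ} (l m : ℕ) (f : Vec d → Vec d → ℝ) (t θ : Vec d) :
    ContinuousMultilinearMap ℝ (fun _ : Fin m => Vec d)
      (ContinuousMultilinearMap ℝ (fun _ : Fin l => Vec d) ℝ) :=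
  iteratedFDeriv ℝ m (fun θ' => iteratedFDeriv ℝ l (fun t' => f t' θ') t) θ

/-- The rate `M_n(r) = n^{-1/2} + n^{-2r+1/2}`. -/
def rateM (r : ℝ) (n : ℕ) : ℝ := (n : ℝ) ^ (-(1 / 2) : ℝ) + (n : ℝ) ^ (-2 * r + 1 / 2)

/-- The density of the standard normal distribution on `ℝ^d`. -/
def stdNormalDensity (d : ℕ) (ξ : Vec d) : ℝ :=
  (2 * Real.pi) ^ (-(d : ℝ) / 2) * Real.exp (-‖ξ‖ ^ 2 / 2)

/-! ### The statistical experiment -/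

/-- A dominated semiparametric model `{P_{θ,η} : θ ∈ Θ, η ∈ H}`, `Θ ⊆ ℝ^d`, with a true
parameter, an i.i.d. sample from the true distribution, and the maximum likelihood estimators. -/
structure Experiment (d : ℕ) (𝒳 B Ω : Type*) [MeasurableSpace 𝒳] [SeminormedAddCommGroup B]
    [MeasurableSpace Ω] where
  /-- the Euclidean parameter set -/
  Θ : Set (Vec d)
  /-- the nuisance parameter set -/
  H : Set B
  /-- the dominating measure -/
  dom : Measure 𝒳
  /-- the likelihood of one observation: `p θ η` is the density of `P_{θ,η}` -/
  p : Vec d → B → 𝒳 → ℝ≥0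
  measurable_p : ∀ θ ∈ Θ, ∀ η ∈ H, Measurable (p θ η)
  lintegral_p : ∀ θ ∈ Θ, ∀ η ∈ H, ∫⁻ x, (p θ η x : ℝ≥0∞) ∂dom = 1
  /-- the true parameters -/
  θ₀ : Vec d
  η₀ : B
  θ₀_mem : θ₀ ∈ Θ
  η₀_mem : η₀ ∈ H
  /-- the one-dimensional paths `s ↦ η_s` through `η₀` along which the nuisance scores at the
  truth are computed -/
  paths : Set (ℝ → B)
  /-- the map `(t, θ, η) ↦ η_t(θ, η)` which defines the least favorable submodel -/
  sub : Vec d → Vec d → B → B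
  /-- the probability on the space on which the data are defined -/
  prob : Measure Ω
  isProb : IsProbabilityMeasure prob
  /-- the observations -/
  X : ℕ → Ω → 𝒳
  measurable_X : ∀ i, Measurable (X i)
  indep : ProbabilityTheory.iIndepFun X prob
  law_X : ∀ i, prob.map (X i) = dom.withDensity (fun x => (p θ₀ η₀ x : ℝ≥0∞))
  /-- `ηhat n θ` maximizes the likelihood of `n` observations over `η`, for fixed `θ` -/
  ηhat : ℕ → Vec d → Ω → B
  ηhat_mem : ∀ n, ∀ θ ∈ Θ, ∀ ω, ηhat n θ ω ∈ H
  ηhat_max : ∀ᵐ ω ∂prob, ∀ n, ∀ θ ∈ Θ, ∀ η ∈ H,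
    ∏ i ∈ Finset.range n, p θ η (X i ω) ≤ ∏ i ∈ Finset.range n, p θ (ηhat n θ ω) (X i ω)
  /-- `(θhat n, ηhat n (θhat n))` maximizes the likelihood of `n` observations -/
  θhat : ℕ → Ω → Vec d
  θhat_mem : ∀ n ω, θhat n ω ∈ Θ
  θhat_max : ∀ᵐ ω ∂prob, ∀ n, ∀ θ ∈ Θ, ∀ η ∈ H,
    ∏ i ∈ Finset.range n, p θ η (X i ω) ≤
      ∏ i ∈ Finset.range n, p (θhat n ω) (ηhat n (θhat n ω) ω) (X i ω)

namespace Experiment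

variable {d : ℕ} {𝒳 B Ω : Type*} [MeasurableSpace 𝒳] [SeminormedAddCommGroup B]
  [MeasurableSpace Ω] (S : Experiment d 𝒳 B Ω)

/-- The true distribution of one observation. -/
def P₀ : Measure 𝒳 := S.dom.withDensity (fun x => (S.p S.θ₀ S.η₀ x : ℝ≥0∞))

/-! #### Scores and efficient information -/

/-- The `i`-th component of the score function for `θ` at the truth. -/
def score (i : Fin d) (x : 𝒳) : ℝ :=
  fderiv ℝ (fun θ => Real.log (S.p θ S.η₀ x : ℝ)) S.θ₀ (unitVec i)

open Classical in
/-- The score for `θ` as an element of `L₂(P₀)`. -/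
def scoreLp (i : Fin d) : Lp ℝ 2 S.P₀ :=
  if h : MemLp (S.score i) 2 S.P₀ then h.toLp (S.score i) else 0

/-- The nuisance scores at the truth: the derivatives at `s = 0` of `log p_{θ₀, η_s}` in
`L₂⁰(P₀)`, along the paths `η_s` in `H` which approach `η₀` as `s → 0`. -/
def nuisanceScores : Set (Lp ℝ 2 S.P₀) :=
  {g | ∃ γ ∈ S.paths, γ 0 = S.η₀ ∧ (∀ᶠ s in 𝓝 0, γ s ∈ S.H) ∧ Tendsto γ (𝓝 0) (𝓝 S.η₀) ∧
    (∀ᵐ x ∂S.P₀, (∀ᶠ s in 𝓝 0, 0 < S.p S.θ₀ (γ s) x) ∧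
      HasDerivAt (fun s => Real.log (S.p S.θ₀ (γ s) x : ℝ)) (g x) 0) ∧
    ∫ x, g x ∂S.P₀ = 0}

/-- The closed linear span of the nuisance scores. -/
abbrev nuisanceTangent : Submodule ℝ (Lp ℝ 2 S.P₀) :=
  (Submodule.span ℝ S.nuisanceScores).topologicalClosure

/-- The efficient score for `θ` at the truth: the score for `θ` minus its orthogonal projection
on the closed linear span of the nuisance scores. -/
def effScore (i : Fin d) : Lp ℝ 2 S.P₀ :=
  S.scoreLp i - S.nuisanceTangent.starProjection (S.scoreLp i)

/-- The efficient information matrix at the truth. -/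
def effInfo : Matrix (Fin d) (Fin d) ℝ :=
  Matrix.of fun i j => ∫ x, S.effScore i x * S.effScore j x ∂S.P₀

/-- The positive square root of the efficient information matrix. -/
def sqrtInfo : Matrix (Fin d) (Fin d) ℝ := CFC.sqrt S.effInfo

/-! #### The least favorable submodel -/

/-- `ℓ(t, θ, η)(x) = log lik(t, η_t(θ, η))(x)`. -/
def ell (t θ : Vec d) (η : B) (x : 𝒳) : ℝ := Real.log (S.p t (S.sub t θ η) x : ℝ)

/-- The `i`-th component of the first derivative of `ℓ` in `t`. -/
def ellT (i : Fin d) (t θ : Vec d) (η : B) (x : 𝒳) : ℝ :=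
  partialD 1 0 (fun t' θ' => S.ell t' θ' η x) t θ ![] ![unitVec i]

/-- The `(i, j)`-th component of the second derivative of `ℓ` in `t`. -/
def ellTT (i j : Fin d) (t θ : Vec d) (η : B) (x : 𝒳) : ℝ :=
  partialD 2 0 (fun t' θ' => S.ell t' θ' η x) t θ ![] ![unitVec i, unitVec j]

/-- The `(i, j, k)`-th component of the third derivative of `ℓ` in `t`. -/
def ellTTT (i j k : Fin d) (t θ : Vec d) (η : B) (x : 𝒳) : ℝ :=
  partialD 3 0 (fun t' θ' => S.ell t' θ' η x) t θ ![] ![unitVec i, unitVec j, unitVec k]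

/-- The mixed derivative of `ℓ`, in `t_i` and `θ_j`. -/
def ellTθ (i j : Fin d) (t θ : Vec d) (η : B) (x : 𝒳) : ℝ :=
  partialD 1 1 (fun t' θ' => S.ell t' θ' η x) t θ ![unitVec j] ![unitVec i]

/-- The submodel is least favorable at the truth: the score for `θ` is square integrable,
`η_t(θ, η)` is in the nuisance parameter set near the truth, and the derivative of
`ℓ(t, θ₀, η₀)` in `t` at `t = θ₀` is the efficient score. -/
structure IsLeastFavorable : Prop where
  memLp_score : ∀ i, MemLp (S.score i) 2 S.P₀
  sub_mem : ∃ δ : ℝ, 0 < δ ∧ ∀ t ∈ ball S.θ₀ δ, ∀ θ ∈ ball S.θ₀ δ, ∀ η ∈ S.H ∩ ball S.η₀ δ,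
    S.sub t θ η ∈ S.H
  score_eq : ∀ i, S.ellT i S.θ₀ S.θ₀ S.η₀ =ᵐ[S.P₀] S.effScore i

/-- Integrals of the densities `lik(t, η_t(θ, η₀))` of the submodel through the truth may be
differentiated twice under the integral sign near `(θ₀, θ₀)`, and these densities vanish
(almost everywhere) where the true density does. -/
def IsRegularSubmodel : Prop :=
  ∃ δ : ℝ, 0 < δ ∧
    (∃ K : 𝒳 → ℝ, Integrable K S.dom ∧ ∀ᵐ x ∂S.dom,
      ContDiffOn ℝ 2 (fun s : Vec d × Vec d => (S.p s.1 (S.sub s.1 s.2 S.η₀) x : ℝ))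
        (ball (S.θ₀, S.θ₀) δ) ∧
      ∀ s ∈ ball (S.θ₀, S.θ₀) δ, ∀ k ∈ ({1, 2} : Finset ℕ),
        ‖iteratedFDeriv ℝ k
          (fun s : Vec d × Vec d => (S.p s.1 (S.sub s.1 s.2 S.η₀) x : ℝ)) s‖ ≤ K x) ∧
    ∀ s ∈ ball (S.θ₀, S.θ₀) δ, ∀ᵐ x ∂S.dom,
      S.p S.θ₀ S.η₀ x = 0 → S.p s.1 (S.sub s.1 s.2 S.η₀) x = 0

/-! #### Smoothness and empirical process assumptions -/

/-- The partial derivatives of `ℓ(t, θ, η)` of the listed orders exist in a neighborhood of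
`(θ₀, θ₀, η₀)` and have there an integrable envelope. -/
def SmoothEnvelope : Prop :=
  ∃ δ : ℝ, 0 < δ ∧ ∃ F : 𝒳 → ℝ, Integrable F S.P₀ ∧ ∀ᵐ x ∂S.P₀,
    ∀ t ∈ ball S.θ₀ δ, ∀ θ ∈ ball S.θ₀ δ, ∀ η ∈ S.H ∩ ball S.η₀ δ,
      0 < S.p t (S.sub t θ η) x ∧
      ContDiffAt ℝ 3 (fun t' => S.ell t' θ η x) t ∧
      ContDiffAt ℝ 2 (fun θ' => iteratedFDeriv ℝ 1 (fun t' => S.ell t' θ' η x) t) θ ∧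
      ContDiffAt ℝ 1 (fun θ' => iteratedFDeriv ℝ 2 (fun t' => S.ell t' θ' η x) t) θ ∧
      ∀ lm ∈ ({(0, 0), (1, 0), (2, 0), (3, 0), (1, 1), (1, 2), (2, 1)} : Finset (ℕ × ℕ)),
        ‖partialD lm.1 lm.2 (fun t' θ' => S.ell t' θ' η x) t θ‖ ≤ F x

/-- `θt` is a random sequence in `Θ` that converges to `θ₀` in (outer) probability. -/
def IsConsistent (θt : ℕ → Ω → Vec d) : Prop :=
  (∀ n ω, θt n ω ∈ S.Θ) ∧ TendstoInMeasure S.prob θt atTop (fun _ => S.θ₀)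

/-- The nuisance parameter has convergence rate (at least) `r`. -/
def NuisanceRate (r : ℝ) : Prop :=
  ∀ θt : ℕ → Ω → Vec d, S.IsConsistent θt →
    IsBigOP S.prob (fun n ω => ‖S.ηhat n (θt n ω) ω - S.η₀‖)
      (fun n ω => ‖θt n ω - S.θ₀‖ + (n : ℝ) ^ (-r))

/-- The smoothness assumptions in the nuisance parameter. -/
structure NuisanceSmooth (r : ℝ) : Prop where
  modulus : ∀ θt : ℕ → Ω → Vec d, S.IsConsistent θt → ∀ i,
    IsBigOP S.prob
      (fun n ω => empProc S.X S.P₀ n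
        (fun x => S.ellT i S.θ₀ S.θ₀ (S.ηhat n (θt n ω) ω) x - S.ellT i S.θ₀ S.θ₀ S.η₀ x) ω)
      (fun n ω => rateM r n + max ((n : ℝ) ^ (1 / 2 - r)) 1 * ‖θt n ω - S.θ₀‖)
  lipTT : ∃ C δ : ℝ, 0 < δ ∧ ∀ η ∈ S.H ∩ ball S.η₀ δ, ∀ i j,
    |∫ x, S.ellTT i j S.θ₀ S.θ₀ η x ∂S.P₀ - ∫ x, S.ellTT i j S.θ₀ S.θ₀ S.η₀ x ∂S.P₀|
      ≤ C * ‖η - S.η₀‖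
  lipTθ : ∃ C δ : ℝ, 0 < δ ∧ ∀ η ∈ S.H ∩ ball S.η₀ δ, ∀ i j,
    |∫ x, S.ellTθ i j S.θ₀ S.θ₀ η x ∂S.P₀ - ∫ x, S.ellTθ i j S.θ₀ S.θ₀ S.η₀ x ∂S.P₀|
      ≤ C * ‖η - S.η₀‖
  noBias : ∃ C δ : ℝ, 0 < δ ∧ ∀ η ∈ S.H ∩ ball S.η₀ δ, ∀ i,
    |∫ x, S.ellT i S.θ₀ S.θ₀ η x ∂S.P₀| ≤ C * ‖η - S.η₀‖ ^ 2

/-- The class of the functions `g(t, θ, η)`, for `(t, θ, η)` in the `δ`-neighborhood of the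
truth. -/
def localClass (g : Vec d → Vec d → B → 𝒳 → ℝ) (δ : ℝ) : Set (𝒳 → ℝ) :=
  {f | ∃ t ∈ ball S.θ₀ δ, ∃ θ ∈ ball S.θ₀ δ, ∃ η ∈ S.H ∩ ball S.η₀ δ, f = g t θ η}

/-- The empirical process assumptions. -/
def EmpiricalClasses : Prop :=
  ∃ δ : ℝ, 0 < δ ∧ ∀ i j k : Fin d,
    IsDonsker S.prob S.X S.P₀ (S.localClass (S.ellTT i j) δ) ∧
    IsDonsker S.prob S.X S.P₀ (S.localClass (S.ellTθ i j) δ) ∧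
    IsGlivenkoCantelli S.prob S.X S.P₀ (S.localClass (S.ellTTT i j k) δ)

/-! #### Profile likelihood and posterior profile distribution -/

/-- The profile likelihood `pl_n(θ) = sup_η lik_n(θ, η)`. -/
def profLik (n : ℕ) (ω : Ω) (θ : Vec d) : ℝ≥0∞ :=
  ⨆ η ∈ S.H, ((∏ i ∈ Finset.range n, S.p θ η (S.X i ω) : ℝ≥0) : ℝ≥0∞)

/-- `Δ_n(θ) = n⁻¹ (log pl_n(θ) - log pl_n(θhat_n))`, with `log 0 = -∞`. -/
def profDelta (n : ℕ) (ω : Ω) (θ : Vec d) : EReal :=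
  (((n : ℝ)⁻¹ : ℝ) : EReal) *
    (ENNReal.log (S.profLik n ω θ) - ENNReal.log (S.profLik n ω (S.θhat n ω)))

/-- Parameters with almost maximal profile likelihood are consistent. -/
def Identifiable : Prop :=
  ∀ θt : ℕ → Ω → Vec d, (∀ n ω, θt n ω ∈ S.Θ) →
    IsLittleOPOne S.prob (fun n ω => S.profDelta n ω (θt n ω)) →
    TendstoInMeasure S.prob θt atTop (fun _ => S.θ₀)

/-- `ρ` is the density of a proper prior on `Θ`, positive at `θ₀`, with a continuous derivative in
a neighborhood of `θ₀`. -/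
structure IsPrior (ρ : Vec d → ℝ) : Prop where
  nonneg : ∀ θ ∈ S.Θ, 0 ≤ ρ θ
  integral_eq_one : ∫ θ in S.Θ, ρ θ = 1
  pos : 0 < ρ S.θ₀
  smooth : ContDiffAt ℝ 1 ρ S.θ₀

/-- The unnormalized posterior profile density: prior density times profile likelihood, on `Θ`. -/
def postWeight (ρ : Vec d → ℝ) (n : ℕ) (ω : Ω) (θ : Vec d) : ℝ≥0∞ :=
  S.Θ.indicator (fun θ => ENNReal.ofReal (ρ θ) * S.profLik n ω θ) θ

/-- The posterior profile distribution of `θ` given the data, for the prior density `ρ`. -/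
def posterior (ρ : Vec d → ℝ) (n : ℕ) (ω : Ω) : Measure (Vec d) :=
  (∫⁻ θ, S.postWeight ρ n ω θ)⁻¹ • volume.withDensity (S.postWeight ρ n ω)

/-- The standardization `θ ↦ √n Ĩ₀^{1/2} (θ - θhat_n)`. -/
def standardize (n : ℕ) (ω : Ω) (θ : Vec d) : Vec d :=
  √(n : ℝ) • Matrix.toEuclideanLin S.sqrtInfo (θ - S.θhat n ω)

/-- The parameter whose standardization is `ξ`. -/
def unstandardize (n : ℕ) (ω : Ω) (ξ : Vec d) : Vec d :=
  S.θhat n ω + (√(n : ℝ))⁻¹ • Matrix.toEuclideanLin S.sqrtInfo⁻¹ ξ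

/-- The Lebesgue density of `√n Ĩ₀^{1/2} (θ - θhat_n)` under the posterior profile distribution,
as an extended nonnegative real. -/
def stdPostDensity (ρ : Vec d → ℝ) (n : ℕ) (ω : Ω) (ξ : Vec d) : ℝ≥0∞ :=
  (∫⁻ θ, S.postWeight ρ n ω θ)⁻¹ *
    (ENNReal.ofReal |(√(n : ℝ) ^ d * S.sqrtInfo.det)⁻¹| *
      S.postWeight ρ n ω (S.unstandardize n ω ξ))

/-- The posterior profile density `f_n(ξ)` of `√n Ĩ₀^{1/2} (θ - θhat_n)`. -/
def postDensity (ρ : Vec d → ℝ) (n : ℕ) (ω : Ω) (ξ : Vec d) : ℝ :=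
  (S.stdPostDensity ρ n ω ξ).toReal

/-- `stdPostDensity` is a Lebesgue density of the law of `√n Ĩ₀^{1/2} (θ - θhat_n)` under the
posterior profile distribution. -/
theorem map_standardize_posterior (ρ : Vec d → ℝ) {n : ℕ} (hn : n ≠ 0) (ω : Ω)
    (hI : S.effInfo.PosDef) (hZ : ∫⁻ θ, S.postWeight ρ n ω θ ≠ 0) :
    (S.posterior ρ n ω).map (S.standardize n ω) =
      volume.withDensity (S.stdPostDensity ρ n ω) := by
  have hn0 : (√(n : ℝ)) ≠ 0 := by positivity
  have hdet : S.sqrtInfo.det ≠ 0 := by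
    have h := CFC.sqrt_mul_sqrt_self S.effInfo hI.posSemidef.nonneg
    intro h0
    have h1 : S.effInfo.det = 0 := by
      rw [← h, Matrix.det_mul]
      change S.sqrtInfo.det * _ = 0
      rw [h0, zero_mul]
    exact hI.det_pos.ne' h1
  have hU : IsUnit S.sqrtInfo.det := isUnit_iff_ne_zero.mpr hdet
  have hAB : ∀ v, Matrix.toEuclideanLin S.sqrtInfo (Matrix.toEuclideanLin S.sqrtInfo⁻¹ v) = v := by
    intro v
    simp [Matrix.toLpLin_apply, Matrix.mulVec_mulVec, Matrix.mul_nonsing_inv _ hU]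
  have hBA : ∀ v, Matrix.toEuclideanLin S.sqrtInfo⁻¹ (Matrix.toEuclideanLin S.sqrtInfo v) = v := by
    intro v
    simp [Matrix.toLpLin_apply, Matrix.mulVec_mulVec, Matrix.nonsing_inv_mul _ hU]
  have hm1 : Measurable (S.standardize n ω) := by
    unfold standardize
    have hc := LinearMap.continuous_of_finiteDimensional (Matrix.toEuclideanLin S.sqrtInfo)
    exact Continuous.measurable (by fun_prop)
  have hm2 : Measurable (S.unstandardize n ω) := by
    unfold unstandardize
    have hc := LinearMap.continuous_of_finiteDimensional (Matrix.toEuclideanLin S.sqrtInfo⁻¹)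
    exact Continuous.measurable (by fun_prop)
  let e : Vec d ≃ᵐ Vec d :=
    { toFun := S.standardize n ω
      invFun := S.unstandardize n ω
      left_inv := by
        intro θ
        simp only [standardize, unstandardize, map_smul, hBA, smul_smul]
        rw [inv_mul_cancel₀ hn0]
        simp
      right_inv := by
        intro ξ
        simp only [standardize, unstandardize, add_sub_cancel_left, map_smul, hAB, smul_smul]
        rw [mul_inv_cancel₀ hn0]
        simp
      measurable_toFun := hm1
      measurable_invFun := hm2 }
  have hvol : (volume : Measure (Vec d)).map (S.standardize n ω) =
      ENNReal.ofReal |(√(n : ℝ) ^ d * S.sqrtInfo.det)⁻¹| • volume := by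
    have hc : S.standardize n ω =
        (⇑(√(n : ℝ) • Matrix.toEuclideanLin S.sqrtInfo)) ∘ (fun θ => θ - S.θhat n ω) := by
      ext1 θ
      simp [standardize]
    have hd : LinearMap.det (√(n : ℝ) • Matrix.toEuclideanLin S.sqrtInfo) =
        √(n : ℝ) ^ d * S.sqrtInfo.det := by
      rw [LinearMap.det_smul]
      simp [Matrix.toEuclideanLin_eq_toLin_orthonormal]
    have hmL : Measurable (⇑(√(n : ℝ) • Matrix.toEuclideanLin S.sqrtInfo)) :=
      (LinearMap.continuous_of_finiteDimensional _).measurable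
    rw [hc, ← Measure.map_map hmL (by fun_prop),
      (measurePreserving_sub_right volume (S.θhat n ω)).map_eq,
      Measure.map_linearMap_addHaar_eq_smul_addHaar volume
        (by rw [hd]; exact mul_ne_zero (pow_ne_zero _ hn0) hdet), hd]
  unfold posterior
  rw [Measure.map_smul]
  ext s hs
  have hpre : MeasurableSet (S.standardize n ω ⁻¹' s) := hm1 hs
  rw [Measure.smul_apply, Measure.map_apply hm1 hs, withDensity_apply _ hpre,
    withDensity_apply _ hs]
  have he : ∀ θ, S.unstandardize n ω (S.standardize n ω θ) = θ := e.left_inv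
  have hw : ∫⁻ θ in S.standardize n ω ⁻¹' s, S.postWeight ρ n ω θ =
      ∫⁻ ξ in s, S.postWeight ρ n ω (S.unstandardize n ω ξ)
        ∂((volume : Measure (Vec d)).map (S.standardize n ω)) := by
    have h1 := e.measurableEmbedding.restrict_map volume s
    have h2 := e.measurableEmbedding.lintegral_map (μ := volume.restrict (e ⁻¹' s))
      (fun ξ => S.postWeight ρ n ω (S.unstandardize n ω ξ))
    rw [← h1] at h2
    refine Eq.trans ?_ h2.symm
    refine lintegral_congr fun θ => ?_
    exact congrArg _ (he θ).symm
  rw [hw, hvol, Measure.restrict_smul, lintegral_smul_measure, smul_eq_mul, smul_eq_mul,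
    ← lintegral_const_mul' _ _ ENNReal.ofReal_ne_top,
    ← lintegral_const_mul' _ _ (ENNReal.inv_ne_top.mpr hZ)]
  rfl

end Experiment

end ProfileSampler

end

noncomputable section

namespace ProfileSampler

/-! ### Uniformity in the parameter, Donsker classes, empirical means. -/

section Stochastic

variable {Ω 𝒳 : Type*} [MeasurableSpace Ω] [MeasurableSpace 𝒳]

/-! The log profile likelihood is squeezed between log likelihoods of least favorable submodels. For
every `ψ` near `θ₀`, the curve `t ↦ n ℙ_n ℓ(t, ψ, ηhat_ψ)` lies below `log pl_n(t)` and touches it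
at `t = ψ`. Taking `ψ = θhat` bounds `log pl_n(θ) - log pl_n(θhat)` from below by an increment of a
smooth finite-dimensional function; taking `ψ = θ` bounds it from above
(`LocalModel.exists_expansion`).

Each increment is expanded in `t` at `θhat`. Write `e = n^{-min(r, 1/2)}`. Under regularity of the
submodel, the mean of the second `t`-derivative at the truth is `-Ĩ₀`. The mean of the mixed
derivative there is `0`, because the efficient score is orthogonal to the nuisance scores
(`integral_ellTT`, `integral_ellTθ`). Together with the quadratic bias bound, the modulus of the
empirical process, the Donsker property and the rate of `ηhat`, this gives the mean score at `(t, ψ,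
ηhat_ψ)` as `ℙ_n ℓ̃₀ - Ĩ₀(t - θ₀)`, up to a multiple of `(e + |t - θ₀| + |ψ - θ₀|)²`
(`LocalBounds.empMean_ellT`). The score vanishes at `t = ψ = θhat`, so `θhat` is `√n`-consistent,
and subtracting the two expansions removes `ℙ_n ℓ̃₀`. With `h = θ - θhat` the log profile likelihood
ratio is therefore `-n hᵀĨ₀h / 2` up to a multiple of `n |h| (e + |h|)²`.

On the scale `h = n^{-1/2} Ĩ₀^{-1/2} u` this error is at most a multiple of `√n e² |u| (1 + |u|)²`,
and `√n e² ≤ M_n(r)`. In a small ball around `θ₀` the error is also at most linear plus a small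
quadratic in `|u|`, so Gaussian decay makes the approximation integrable (`exp_perturbation_le`).
Outside the ball, identifiability makes the likelihood ratio at most `exp(-nc)`, which beats the
Jacobian of the rescaling. The prior is Lipschitz near `θ₀` and costs only `n^{-1/2}`. Integrating
gives the normalizing constant to the same order, and a quotient estimate finishes
(`LocalModel.exists_posterior_bound`).

The assumptions speak of consistent random sequences; a diagonal choice makes them uniform over a
neighborhood (`exists_uniform_of_consistent`). After this the argument is deterministic, on an event
of high probability. -/

theorem tendstoInMeasure_const_of_eventually_dist_lt {d : ℕ} {Pr : Measure Ω} {θ₀ : Vec d}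
    {θt : ℕ → Ω → Vec d}
    (h : ∀ δ : ℝ, 0 < δ → ∀ᶠ n in atTop, ∀ ω, dist (θt n ω) θ₀ < δ) :
    TendstoInMeasure Pr θt atTop (fun _ => θ₀) := by
  rw [tendstoInMeasure_iff_dist]
  intro δ hδ
  refine tendsto_const_nhds.congr' ?_
  filter_upwards [h δ hδ] with n hn
  have : {ω | δ ≤ dist (θt n ω) θ₀} = ∅ := by
    ext ω
    simpa using hn ω
  rw [this, measure_empty]

/-- A property which holds with high probability along every consistent sequence of parameters
holds with high probability uniformly over a neighborhood of the true parameter. -/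
theorem exists_uniform_of_consistent {d : ℕ} (Pr : Measure Ω) (Θ : Set (Vec d)) {θ₀ : Vec d}
    (hθ₀ : θ₀ ∈ Θ) (A : ℕ → ℕ → Ω → Vec d → Prop)
    (hA : ∀ k l, k ≤ l → ∀ n ω θ, A l n ω θ → A k n ω θ)
    (h : ∀ θt : ℕ → Ω → Vec d, (∀ n ω, θt n ω ∈ Θ) →
      TendstoInMeasure Pr θt atTop (fun _ => θ₀) →
      ∀ ε : ℝ≥0∞, 0 < ε → ∃ k, ∀ᶠ n in atTop, Pr {ω | A k n ω (θt n ω)} ≤ ε)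
    (ε : ℝ≥0∞) (hε : 0 < ε) :
    ∃ k : ℕ, ∀ᶠ n in atTop,
      Pr {ω | ∃ θ ∈ Θ, dist θ θ₀ < 1 / ((k : ℝ) + 1) ∧ A k n ω θ} ≤ ε := by
  classical
  by_contra hcon
  push Not at hcon
  -- If uniformity fails at every level `k`, pick increasing sample sizes `φ k` at which the level
  -- `k` bad event is likely. A sequence that selects a bad parameter at size `φ k`, and `θ₀`
  -- otherwise, is consistent because the radii `1 / (k + 1)` shrink.
  obtain ⟨φ, hφ, hP⟩ := extraction_forall_of_frequently
    (P := fun k n => ε < Pr {ω | ∃ θ ∈ Θ, dist θ θ₀ < 1 / ((k : ℝ) + 1) ∧ A k n ω θ}) hcon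
  have key : ∀ n ω, ∃ θ ∈ Θ, (∀ k, φ k = n → dist θ θ₀ < 1 / ((k : ℝ) + 1)) ∧
      ((∀ k, φ k ≠ n) → θ = θ₀) ∧
      ∀ k, φ k = n → (∃ θ ∈ Θ, dist θ θ₀ < 1 / ((k : ℝ) + 1) ∧ A k n ω θ) → A k n ω θ := by
    intro n ω
    by_cases hn : ∃ k, φ k = n
    · obtain ⟨k, hk⟩ := hn
      have huniq : ∀ k', φ k' = n → k' = k := fun k' hk' => hφ.injective (hk'.trans hk.symm)
      by_cases hbad : ∃ θ ∈ Θ, dist θ θ₀ < 1 / ((k : ℝ) + 1) ∧ A k n ω θ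
      · obtain ⟨θ, hθ, hd, hAθ⟩ := hbad
        refine ⟨θ, hθ, ?_, fun h' => absurd hk (h' k), ?_⟩
        · intro k' hk'
          rw [huniq k' hk']
          exact hd
        · intro k' hk' _
          rw [huniq k' hk']
          exact hAθ
      · refine ⟨θ₀, hθ₀, ?_, fun _ => rfl, ?_⟩
        · intro k' _
          rw [dist_self]
          positivity
        · intro k' hk' hb
          rw [huniq k' hk'] at hb
          exact absurd hb hbad
    · push Not at hn
      exact ⟨θ₀, hθ₀, fun k hk => absurd hk (hn k), fun _ => rfl, fun k hk => absurd hk (hn k)⟩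
  choose θt hmem hdist heq hbad using key
  have hcons : TendstoInMeasure Pr θt atTop (fun _ => θ₀) := by
    apply tendstoInMeasure_const_of_eventually_dist_lt
    intro δ hδ
    obtain ⟨K, hK⟩ := exists_nat_one_div_lt hδ
    filter_upwards [eventually_ge_atTop (φ K)] with n hn ω
    by_cases hk : ∃ k, φ k = n
    · obtain ⟨k, hk⟩ := hk
      have hKk : K ≤ k := hφ.le_iff_le.mp (hk ▸ hn)
      refine (hdist n ω k hk).trans_le (le_trans ?_ hK.le)
      gcongr
    · push Not at hk
      rw [heq n ω hk, dist_self]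
      exact hδ
  obtain ⟨k₀, hk₀⟩ := h θt hmem hcons ε hε
  obtain ⟨N, hN⟩ := eventually_atTop.mp hk₀
  -- Failure at level `max k₀ N` entails failure at level `k₀`, and `φ` of this index is at least
  -- `N`.
  have h1 := hN (φ (max k₀ N)) ((le_max_right k₀ N).trans (hφ.id_le _))
  refine absurd (hP (max k₀ N)) (not_lt.mpr (le_trans (measure_mono ?_) h1))
  intro ω hω
  exact hA _ _ (le_max_left k₀ N) _ _ _ (hbad _ ω _ rfl hω)

/-- The empirical process indexed by a Donsker class is bounded in probability, uniformly over
the class. -/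
theorem IsDonsker.exists_bound {Pr : Measure Ω} {X : ℕ → Ω → 𝒳} {P : Measure 𝒳}
    {𝓕 : Set (𝒳 → ℝ)} (h : IsDonsker Pr X P 𝓕) (ε : ℝ≥0∞) (hε : 0 < ε) :
    ∃ C : ℝ, ∀ᶠ n in atTop, Pr {ω | ∃ f ∈ 𝓕, C < |empProc X P n f ω|} ≤ ε := by
  obtain ⟨-, G, hG, L, hL1, htight, hconv⟩ := h
  by_cases hεtop : ε = ⊤
  · exact ⟨0, by simp [hεtop]⟩
  obtain ⟨K, hK, hLK⟩ := htight (ε / 2) (ENNReal.half_pos hε.ne')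
  obtain ⟨R, hR⟩ := hK.isBounded.exists_norm_le
  -- A continuous bounded test function that vanishes on the compact set `K` and equals one once the
  -- norm reaches `R + 1`. Its limiting expectation is at most the mass of the complement of `K`.
  let g : EllInfty 𝓕 → ℝ≥0 := fun z => min 1 (‖z‖ - R).toNNReal
  have hgc : Continuous g := by fun_prop
  have hg0 : ∀ z ∈ K, g z = 0 := fun z hz => by
    simp only [g]
    rw [Real.toNNReal_of_nonpos (by linarith [hR z hz])]
    simp
  have hlim := hconv g hgc ⟨1, fun z => min_le_left _ _⟩
  have hint : @lintegral (EllInfty 𝓕) (borel _) L (fun z => (g z : ℝ≥0∞)) ≤ ε / 2 := by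
    let _ : MeasurableSpace (EllInfty 𝓕) := borel _
    have : BorelSpace (EllInfty 𝓕) := ⟨rfl⟩
    refine le_trans ?_ hLK
    rw [← lintegral_indicator_one hK.isClosed.measurableSet.compl]
    refine lintegral_mono fun z => ?_
    by_cases hz : z ∈ K
    · simp [hg0 z hz]
    · rw [indicator_of_mem (by simpa using hz)]
      simp [g]
  have hlt : @lintegral (EllInfty 𝓕) (borel _) L (fun z => (g z : ℝ≥0∞)) < ε :=
    hint.trans_lt (ENNReal.half_lt_self hε.ne' hεtop)
  refine ⟨R + 1, ?_⟩
  filter_upwards [hlim.eventually_lt_const hlt] with n hn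
  refine le_trans ?_ hn.le
  -- Markov's inequality is applied to each measurable majorant `U` in the outer expectation, since
  -- the composition `g ∘ G n` need not be measurable.
  refine le_iInf fun U => le_iInf fun hU => le_iInf fun hle => ?_
  calc Pr {ω | ∃ f ∈ 𝓕, R + 1 < |empProc X P n f ω|}
      ≤ Pr {ω | 1 ≤ U ω} := by
        refine measure_mono_ae ?_
        filter_upwards [hG n] with ω hω hbad
        obtain ⟨f, hf, hbad⟩ := hbad
        have h1 := lp.norm_apply_le_norm (by simp) (G n ω) ⟨f, hf⟩
        have h2 := hω ⟨f, hf⟩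
        simp only at h2
        rw [h2, Real.norm_eq_abs] at h1
        have h3 : g (G n ω) = 1 := by
          simp only [g, min_eq_left_iff]
          rw [Real.one_le_toNNReal]
          linarith
        have h4 := hle ω
        simp only [h3] at h4
        change 1 ≤ U ω
        simpa using h4
    _ = 1 * Pr {ω | 1 ≤ U ω} := (one_mul _).symm
    _ ≤ ∫⁻ ω, U ω ∂Pr := mul_meas_ge_le_lintegral₀ hU.aemeasurable 1

variable {Pr : Measure Ω} {X : ℕ → Ω → 𝒳} {P : Measure 𝒳}

/-- Empirical means of an integrable function are bounded in probability. -/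
theorem exists_bound_empMean (hX : ∀ i, Measurable (X i)) (hP : ∀ i, Pr.map (X i) = P)
    {F : 𝒳 → ℝ} (hF : Integrable F P) (ε : ℝ≥0∞) (hε : 0 < ε) :
    ∃ C : ℝ, ∀ n, Pr {ω | C < empMean X n F ω} ≤ ε := by
  by_cases hεtop : ε = ⊤
  · exact ⟨0, by simp [hεtop]⟩
  set I : ℝ≥0∞ := ∫⁻ x, ‖F x‖ₑ ∂P with hI
  have hItop : I ≠ ⊤ := hF.2.ne
  -- The level comes from Markov's inequality; the added `1` keeps `c` nonzero, so that it can be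
  -- cancelled at the end.
  set c : ℝ≥0∞ := I / ε + 1 with hc
  have hctop : c ≠ ⊤ := by
    simp [hc, ENNReal.div_eq_top, hε.ne', hItop, hεtop]
  have hFm : ∀ i, AEMeasurable (fun ω => ‖F (X i ω)‖ₑ) Pr := fun i => by
    have h1 : AEMeasurable (fun x => ‖F x‖ₑ) (Pr.map (X i)) := by
      rw [hP i]
      exact hF.1.enorm
    exact h1.comp_measurable (hX i)
  have hFi : ∀ i, ∫⁻ ω, ‖F (X i ω)‖ₑ ∂Pr = I := fun i => by
    have h1 : AEMeasurable (fun x => ‖F x‖ₑ) (Pr.map (X i)) := by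
      rw [hP i]
      exact hF.1.enorm
    rw [hI, ← hP i, lintegral_map' h1 (hX i).aemeasurable]
  refine ⟨c.toReal, fun n => ?_⟩
  rcases Nat.eq_zero_or_pos n with rfl | hn
  · have : {ω | c.toReal < empMean X 0 F ω} = ∅ := by
      ext ω
      simp [empMean]
    rw [this, measure_empty]
    exact zero_le
  have hn0 : (n : ℝ≥0∞) ≠ 0 := by exact_mod_cast hn.ne'
  have hsub : Pr {ω | c.toReal < empMean X n F ω} ≤
      Pr {ω | (n : ℝ≥0∞) * c ≤ ∑ i ∈ Finset.range n, ‖F (X i ω)‖ₑ} := by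
    refine measure_mono fun ω hω => ?_
    change (n : ℝ≥0∞) * c ≤ ∑ i ∈ Finset.range n, ‖F (X i ω)‖ₑ
    change c.toReal < (∑ i ∈ Finset.range n, F (X i ω)) / n at hω
    rw [lt_div_iff₀ (by exact_mod_cast hn)] at hω
    have h1 : c.toReal * n ≤ ∑ i ∈ Finset.range n, ‖F (X i ω)‖ :=
      hω.le.trans (Finset.sum_le_sum fun i _ => Real.le_norm_self _)
    have h2 := ENNReal.ofReal_le_ofReal h1
    rw [ENNReal.ofReal_mul ENNReal.toReal_nonneg, ENNReal.ofReal_toReal hctop,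
      ENNReal.ofReal_natCast, ENNReal.ofReal_sum_of_nonneg (fun _ _ => norm_nonneg _)] at h2
    simpa only [mul_comm, ofReal_norm] using h2
  refine hsub.trans ?_
  have hmarkov := mul_meas_ge_le_lintegral₀ (μ := Pr)
    (f := fun ω => ∑ i ∈ Finset.range n, ‖F (X i ω)‖ₑ)
    (Finset.aemeasurable_fun_sum _ fun i _ => hFm i) ((n : ℝ≥0∞) * c)
  rw [lintegral_finsetSum' _ fun i _ => hFm i] at hmarkov
  simp only [hFi, Finset.sum_const, Finset.card_range, nsmul_eq_mul] at hmarkov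
  rw [mul_assoc, ENNReal.mul_le_mul_iff_right hn0 (ENNReal.natCast_ne_top n)] at hmarkov
  have hcpos : c ≠ 0 := by simp [hc]
  have h3 : I ≤ c * ε := by
    rw [hc, add_mul, ENNReal.div_mul_cancel hε.ne' hεtop]
    exact le_self_add
  exact (ENNReal.mul_le_mul_iff_right hcpos hctop).mp (hmarkov.trans h3)

/-- Empirical means of a centered square integrable function are of the order `n^{-1/2}` in
probability. -/
theorem exists_bound_empMean_of_integral_eq_zero [IsProbabilityMeasure Pr]
    (hX : ∀ i, Measurable (X i)) (hP : ∀ i, Pr.map (X i) = P)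
    (hind : ProbabilityTheory.iIndepFun X Pr)
    {F : 𝒳 → ℝ} (hF : MemLp F 2 P) (hF0 : ∫ x, F x ∂P = 0) (ε : ℝ≥0∞) (hε : 0 < ε) :
    ∃ C : ℝ, ∀ n : ℕ, 0 < n → Pr {ω | C * (√(n : ℝ))⁻¹ < |empMean X n F ω|} ≤ ε := by
  by_cases hεtop : ε = ⊤
  · exact ⟨0, by simp [hεtop]⟩
  -- `F` is only a.e. measurable; independence of the compositions with the `X i` is inherited
  -- through a measurable version.
  obtain ⟨F', hF'm, hFF'⟩ := hF.1
  have hF'2 : MemLp F' 2 P := hF.ae_eq hFF'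
  have hF'0 : ∫ x, F' x ∂P = 0 := by rw [← hF0]; exact (integral_congr_ae hFF').symm
  have hm2 : ∀ i, MemLp (fun ω => F' (X i ω)) 2 Pr := fun i => by
    have h1 : MemLp F' 2 (Pr.map (X i)) := by rw [hP i]; exact hF'2
    exact h1.comp_of_map (hX i).aemeasurable
  have hm0 : ∀ i, ∫ ω, F' (X i ω) ∂Pr = 0 := fun i => by
    rw [← hF'0, ← hP i, integral_map (hX i).aemeasurable]
    exact hF'm.aestronglyMeasurable
  set v : ℝ := ∫ x, F' x ^ 2 ∂P with hv
  have hv0 : 0 ≤ v := integral_nonneg fun x => sq_nonneg _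
  have hvar : ∀ i, ProbabilityTheory.variance (fun ω => F' (X i ω)) Pr = v := fun i => by
    rw [ProbabilityTheory.variance_of_integral_eq_zero (hm2 i).1.aemeasurable (hm0 i), hv, ← hP i,
      integral_map (hX i).aemeasurable]
    exact (hF'm.measurable.pow_const 2).aestronglyMeasurable
  have hεr : 0 < ε.toReal := ENNReal.toReal_pos hε.ne' hεtop
  -- Chebyshev's inequality leaves `v / C²`, which is at most `ε` because `v ≤ ε C` and `C ≥ 1`.
  set C : ℝ := v / ε.toReal + 1 with hC
  have hC1 : 1 ≤ C := by
    have : 0 ≤ v / ε.toReal := by positivity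
    linarith
  refine ⟨C, fun n hn => ?_⟩
  have hnr : (0 : ℝ) < n := by exact_mod_cast hn
  have hs0 : 0 < √(n : ℝ) := Real.sqrt_pos.mpr hnr
  set Y : Ω → ℝ := ∑ i ∈ Finset.range n, fun ω => F' (X i ω) with hY
  have hYapp : ∀ ω, Y ω = ∑ i ∈ Finset.range n, F' (X i ω) := fun ω => by
    rw [hY, Finset.sum_apply]
  have hYm : MemLp Y 2 Pr := memLp_finsetSum' _ fun i _ => hm2 i
  have hY0 : ∫ ω, Y ω ∂Pr = 0 := by
    simp_rw [hYapp]
    rw [integral_finsetSum _ fun i _ => (hm2 i).integrable (by norm_num)]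
    simp [hm0]
  have hYv : ProbabilityTheory.variance Y Pr = n * v := by
    rw [hY, ProbabilityTheory.IndepFun.variance_sum (fun i _ => hm2 i)]
    · simp [hvar]
    · intro i _ j _ hij
      exact (hind.indepFun hij).comp hF'm.measurable hF'm.measurable
  have hch := ProbabilityTheory.meas_ge_le_variance_div_sq hYm (c := C * √(n : ℝ)) (by positivity)
  rw [hY0, hYv] at hch
  refine le_trans (measure_mono_ae ?_) (hch.trans ?_)
  · have hae : ∀ i, ∀ᵐ ω ∂Pr, F (X i ω) = F' (X i ω) := fun i => by
      refine ae_of_ae_map (p := fun x => F x = F' x) (hX i).aemeasurable ?_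
      rw [hP i]
      exact hFF'
    filter_upwards [ae_all_iff.mpr hae] with ω hω hbad
    change C * √(n : ℝ) ≤ |Y ω - 0|
    have hbad' : C * (√(n : ℝ))⁻¹ < |empMean X n F ω| := hbad
    have h1 : empMean X n F ω = Y ω / n := by
      rw [empMean, hYapp]
      simp [hω]
    rw [h1, abs_div, abs_of_pos hnr, lt_div_iff₀ hnr] at hbad'
    have h2 : C * (√(n : ℝ))⁻¹ * n = C * √(n : ℝ) := by
      have := Real.mul_self_sqrt hnr.le
      field_simp
      rw [sq, this]
    rw [h2] at hbad'
    simpa using hbad'.le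
  · rw [ENNReal.ofReal_le_iff_le_toReal hεtop, mul_pow, Real.sq_sqrt hnr.le,
      div_le_iff₀ (by positivity)]
    have h1 : v ≤ ε.toReal * C := by
      rw [hC, mul_add, mul_div_cancel₀ _ hεr.ne']
      linarith
    have h2 : ε.toReal * C ≤ ε.toReal * C ^ 2 := by
      have : C ≤ C ^ 2 := by nlinarith
      gcongr
    nlinarith [mul_le_mul_of_nonneg_left (h1.trans h2) hnr.le]

end Stochastic

/-! ### Good samples and the consequence of identifiability. -/

namespace Experiment

variable {d : ℕ} {𝒳 B Ω : Type*} [MeasurableSpace 𝒳] [SeminormedAddCommGroup B]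
  [MeasurableSpace Ω] (S : Experiment d 𝒳 B Ω)

theorem ae_forall_sample {Q : 𝒳 → Prop} (h : ∀ᵐ x ∂S.P₀, Q x) :
    ∀ᵐ ω ∂S.prob, ∀ i, Q (S.X i ω) := by
  refine ae_all_iff.mpr fun i => ae_of_ae_map (S.measurable_X i).aemeasurable ?_
  rw [S.law_X i]
  exact h

theorem ae_pos_density : ∀ᵐ x ∂S.P₀, 0 < S.p S.θ₀ S.η₀ x := by
  have hm := S.measurable_p _ S.θ₀_mem _ S.η₀_mem
  rw [P₀, ae_withDensity_iff (by fun_prop)]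
  refine ae_of_all _ fun x hx => ?_
  simpa [pos_iff_ne_zero] using hx

/-- The likelihood of the first `n` observations at `(θ, ηhat_θ)`. -/
def plHat (n : ℕ) (ω : Ω) (θ : Vec d) : ℝ≥0 :=
  ∏ i ∈ Finset.range n, S.p θ (S.ηhat n θ ω) (S.X i ω)

/-- The almost sure properties of the maximum likelihood estimators. -/
structure IsGoodSample (ω : Ω) : Prop where
  eta_max : ∀ n, ∀ θ ∈ S.Θ, ∀ η ∈ S.H,
    ∏ i ∈ Finset.range n, S.p θ η (S.X i ω) ≤ S.plHat n ω θ
  theta_max : ∀ n, ∀ θ ∈ S.Θ, S.plHat n ω θ ≤ S.plHat n ω (S.θhat n ω)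
  pos : ∀ n, 0 < S.plHat n ω (S.θhat n ω)

theorem ae_isGoodSample : ∀ᵐ ω ∂S.prob, S.IsGoodSample ω := by
  filter_upwards [S.ηhat_max, S.θhat_max, S.ae_forall_sample S.ae_pos_density] with ω h1 h2 h3
  refine ⟨h1, fun n θ hθ => h2 n θ hθ _ (S.ηhat_mem n θ hθ ω), fun n => ?_⟩
  exact (Finset.prod_pos fun i _ => h3 i).trans_le (h2 n S.θ₀ S.θ₀_mem S.η₀ S.η₀_mem)

variable {S}

theorem IsGoodSample.profLik_eq {ω : Ω} (h : S.IsGoodSample ω) (n : ℕ) {θ : Vec d}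
    (hθ : θ ∈ S.Θ) : S.profLik n ω θ = (S.plHat n ω θ : ℝ≥0∞) := by
  refine le_antisymm (iSup₂_le fun η hη => ?_) ?_
  · exact_mod_cast h.eta_max n θ hθ η hη
  · exact le_iSup₂ (f := fun η (_ : η ∈ S.H) =>
      ((∏ i ∈ Finset.range n, S.p θ η (S.X i ω) : ℝ≥0) : ℝ≥0∞)) _ (S.ηhat_mem n θ hθ ω)

theorem IsGoodSample.profDelta_nonpos {ω : Ω} (h : S.IsGoodSample ω) (n : ℕ) {θ : Vec d}
    (hθ : θ ∈ S.Θ) : S.profDelta n ω θ ≤ 0 := by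
  refine mul_nonpos_of_nonneg_of_nonpos (by exact_mod_cast (by positivity)) ?_
  rw [EReal.sub_nonpos, ENNReal.log_le_log_iff, h.profLik_eq n hθ,
    h.profLik_eq n (S.θhat_mem n ω)]
  exact_mod_cast h.theta_max n θ hθ

theorem IsGoodSample.profDelta_thetaHat {ω : Ω} (h : S.IsGoodSample ω) (n : ℕ) :
    S.profDelta n ω (S.θhat n ω) = 0 := by
  have h1 := h.pos n
  rw [profDelta, h.profLik_eq n (S.θhat_mem n ω), EReal.sub_self, mul_zero]
  · simp
  · simpa using h1.ne'

/-- Outside of a neighborhood of the true parameter the profile likelihood is exponentially small,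
with high probability. -/
theorem Identifiable.exists_uniform (hId : S.Identifiable) {δ : ℝ} (hδ : 0 < δ) (ε : ℝ≥0∞)
    (hε : 0 < ε) :
    ∃ c : ℝ, 0 < c ∧ ∀ᶠ n in atTop,
      S.prob {ω | ∃ θ ∈ S.Θ, δ ≤ dist θ S.θ₀ ∧ ((-c : ℝ) : EReal) < S.profDelta n ω θ} ≤ ε := by
  classical
  by_contra hcon
  push Not at hcon
  have hcon' : ∀ k : ℕ, ∃ᶠ n in atTop, ε < S.prob {ω | ∃ θ ∈ S.Θ, δ ≤ dist θ S.θ₀ ∧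
      ((-(1 / ((k : ℝ) + 1)) : ℝ) : EReal) < S.profDelta n ω θ} := fun k => hcon _ (by positivity)
  obtain ⟨φ, hφ, hP⟩ := extraction_forall_of_frequently hcon'
  -- At sample size `φ k` take a distant parameter with `Δ_n > -1 / (k + 1)` if there is one, and
  -- `θhat`, where `Δ_n = 0`, in all other cases. Since `Δ_n ≤ 0` on good samples, `Δ_n` tends to
  -- zero along this sequence, so identifiability forces consistency, against the probability above
  -- `ε` of a distant choice.
  have key : ∀ n ω, ∃ θ ∈ S.Θ,
      (S.IsGoodSample ω → ∀ k, (∀ j, j < k → φ j ≠ n) →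
        ((-(1 / ((k : ℝ) + 1)) : ℝ) : EReal) ≤ S.profDelta n ω θ) ∧
      ∀ k, φ k = n → (∃ θ ∈ S.Θ, δ ≤ dist θ S.θ₀ ∧
        ((-(1 / ((k : ℝ) + 1)) : ℝ) : EReal) < S.profDelta n ω θ) → δ ≤ dist θ S.θ₀ := by
    intro n ω
    by_cases hn : ∃ k, φ k = n ∧ ∃ θ ∈ S.Θ, δ ≤ dist θ S.θ₀ ∧
        ((-(1 / ((k : ℝ) + 1)) : ℝ) : EReal) < S.profDelta n ω θ
    · obtain ⟨k, hk, θ, hθ, hd, hlt⟩ := hn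
      refine ⟨θ, hθ, fun _ l hl => ?_, fun _ _ _ => hd⟩
      have hkl : l ≤ k := by
        by_contra hlk
        exact hl k (not_le.mp hlk) hk
      refine le_trans ?_ hlt.le
      rw [EReal.coe_le_coe_iff, neg_le_neg_iff]
      gcongr
    · refine ⟨S.θhat n ω, S.θhat_mem n ω, fun hgood k _ => ?_, fun k hk hex => ?_⟩
      · rw [hgood.profDelta_thetaHat]
        rw [← EReal.coe_zero, EReal.coe_le_coe_iff]
        have : (0 : ℝ) < 1 / ((k : ℝ) + 1) := by positivity
        linarith
      · exact absurd ⟨k, hk, hex⟩ hn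
  choose θt hmem hge hfar using key
  have hcons := hId θt hmem (by
    intro η hη
    refine tendsto_const_nhds.congr' ?_
    obtain ⟨K, hK⟩ := exists_nat_one_div_lt hη
    filter_upwards [eventually_gt_atTop (φ K)] with n hn
    symm
    rw [measure_eq_zero_iff_ae_notMem]
    filter_upwards [S.ae_isGoodSample] with ω hω
    refine not_not.mpr ⟨le_trans ?_ (hge n ω hω K fun j hj hjn => ?_), ?_⟩
    · rw [EReal.coe_le_coe_iff]
      linarith
    · have := hφ hj
      omega
    · exact (hω.profDelta_nonpos n (hmem n ω)).trans (by exact_mod_cast hη.le))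
  rw [tendstoInMeasure_iff_dist] at hcons
  have hlt := (hcons δ hδ).eventually_lt_const hε
  obtain ⟨N, hN⟩ := eventually_atTop.mp hlt
  have h1 := hN (φ N) (hφ.id_le _)
  refine absurd (hP N) (not_lt.mpr (le_trans (measure_mono ?_) h1.le))
  intro ω hω
  exact hfar _ ω N rfl hω

end Experiment

/-! ### Partial derivatives as iterated Fréchet derivatives -/

section PartialD

variable {d : ℕ}

theorem iteratedFDeriv_one_eq_comp {E F : Type*} [NormedAddCommGroup E] [NormedSpace ℝ E]
    [NormedAddCommGroup F] [NormedSpace ℝ F] (f : E → F) (t : E) :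
    iteratedFDeriv ℝ 1 f t =
      (continuousMultilinearCurryFin1 ℝ E F).symm (fderiv ℝ f t) := by
  ext m
  simp [iteratedFDeriv_one_apply]

theorem partialD_one_zero_apply (f : Vec d → Vec d → ℝ) (t θ v : Vec d) :
    partialD 1 0 f t θ ![] ![v] = fderiv ℝ (fun t' => f t' θ) t v := by
  simp [partialD, iteratedFDeriv_one_apply]

theorem partialD_two_zero_apply (f : Vec d → Vec d → ℝ) (t θ v w : Vec d) :
    partialD 2 0 f t θ ![] ![v, w] = fderiv ℝ (fderiv ℝ (fun t' => f t' θ)) t v w := by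
  simp [partialD, iteratedFDeriv_two_apply]

theorem partialD_one_one_apply (f : Vec d → Vec d → ℝ) (t θ v w : Vec d) :
    partialD 1 1 f t θ ![w] ![v] =
      fderiv ℝ (fun θ' => fderiv ℝ (fun t' => f t' θ') t) θ w v := by
  rw [partialD, iteratedFDeriv_one_apply]
  have : (fun θ' => iteratedFDeriv ℝ 1 (fun t' => f t' θ') t) =
      (continuousMultilinearCurryFin1 ℝ (Vec d) ℝ).symm ∘
        (fun θ' => fderiv ℝ (fun t' => f t' θ') t) := by
    ext1 θ'
    exact iteratedFDeriv_one_eq_comp _ _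
  rw [this, LinearIsometryEquiv.comp_fderiv]
  simp

end PartialD

/-! ### Derivatives of the logarithm of a smooth positive function of two variables -/

section LogDeriv

variable {d : ℕ} {Q : Vec d × Vec d → ℝ} {θ₀ : Vec d}

theorem eventually_contDiffAt_pos (hQ : ContDiffAt ℝ 2 Q (θ₀, θ₀)) (hpos : 0 < Q (θ₀, θ₀)) :
    ∀ᶠ s in 𝓝 (θ₀, θ₀), ContDiffAt ℝ 2 Q s ∧ 0 < Q s :=
  (hQ.eventually (by simp)).and (hQ.continuousAt.eventually_const_lt hpos)

theorem hasFDerivAt_log_left {s : Vec d × Vec d} (hQ : ContDiffAt ℝ 2 Q s) (hpos : 0 < Q s) :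
    HasFDerivAt (fun t => Real.log (Q (t, s.2)))
      ((Q s)⁻¹ • (fderiv ℝ Q s).comp (ContinuousLinearMap.inl ℝ (Vec d) (Vec d))) s.1 := by
  have h1 : HasFDerivAt Q (fderiv ℝ Q s) (s.1, s.2) :=
    (hQ.differentiableAt (by norm_num)).hasFDerivAt
  exact (h1.comp s.1 (hasFDerivAt_prodMk_left s.1 s.2)).log hpos.ne'

theorem fderiv_log_left (hQ : ContDiffAt ℝ 2 Q (θ₀, θ₀)) (hpos : 0 < Q (θ₀, θ₀)) (v : Vec d) :
    fderiv ℝ (fun t => Real.log (Q (t, θ₀))) θ₀ v =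
      fderiv ℝ Q (θ₀, θ₀) (v, 0) / Q (θ₀, θ₀) := by
  rw [(hasFDerivAt_log_left hQ hpos).fderiv]
  simp [div_eq_inv_mul]

/-- On the diagonal the submodel is the original model with `η₀` fixed, so this is the ordinary
score for `θ`; the chain rule puts the same increment in both variables. -/
theorem fderiv_log_diag (hQ : ContDiffAt ℝ 2 Q (θ₀, θ₀)) (hpos : 0 < Q (θ₀, θ₀)) (v : Vec d) :
    fderiv ℝ (fun θ => Real.log (Q (θ, θ))) θ₀ v =
      fderiv ℝ Q (θ₀, θ₀) (v, v) / Q (θ₀, θ₀) := by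
  have h1 : HasFDerivAt Q (fderiv ℝ Q (θ₀, θ₀)) (θ₀, θ₀) :=
    (hQ.differentiableAt (by norm_num)).hasFDerivAt
  have h2 : HasFDerivAt (fun θ : Vec d => (θ, θ))
      ((ContinuousLinearMap.id ℝ (Vec d)).prod (ContinuousLinearMap.id ℝ (Vec d))) θ₀ :=
    (hasFDerivAt_id θ₀).prodMk (hasFDerivAt_id θ₀)
  have h3 := (HasFDerivAt.comp (f := fun θ : Vec d => (θ, θ)) θ₀ h1 h2).log hpos.ne'
  have h4 : fderiv ℝ (fun θ => Real.log (Q (θ, θ))) θ₀ = _ := h3.fderiv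
  rw [h4]
  simp [div_eq_inv_mul]

/-- The gradient in the first variable is differentiated jointly in both variables. The directions
`u = (w, 0)` and `u = (0, w)` then yield the pure and the mixed second derivatives from one
computation. -/
theorem hasFDerivAt_logGradient (hQ : ContDiffAt ℝ 2 Q (θ₀, θ₀)) (hpos : 0 < Q (θ₀, θ₀)) :
    ∃ G' : Vec d × Vec d →L[ℝ] Vec d →L[ℝ] ℝ,
      HasFDerivAt (fun s => (Q s)⁻¹ •
        (fderiv ℝ Q s).comp (ContinuousLinearMap.inl ℝ (Vec d) (Vec d))) G' (θ₀, θ₀) ∧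
      ∀ u v, G' u v = fderiv ℝ (fderiv ℝ Q) (θ₀, θ₀) u (v, 0) / Q (θ₀, θ₀) -
        fderiv ℝ Q (θ₀, θ₀) (v, 0) / Q (θ₀, θ₀) * (fderiv ℝ Q (θ₀, θ₀) u / Q (θ₀, θ₀)) := by
  have h1 : HasFDerivAt Q (fderiv ℝ Q (θ₀, θ₀)) (θ₀, θ₀) :=
    (hQ.differentiableAt (by norm_num)).hasFDerivAt
  have h2 : HasFDerivAt (fderiv ℝ Q) (fderiv ℝ (fderiv ℝ Q) (θ₀, θ₀)) (θ₀, θ₀) :=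
    ((hQ.fderiv_right (m := 1) (by norm_num)).differentiableAt (by norm_num)).hasFDerivAt
  have h3 := ((hasDerivAt_inv hpos.ne').comp_hasFDerivAt _ h1).smul
    (h2.clm_comp (hasFDerivAt_const (ContinuousLinearMap.inl ℝ (Vec d) (Vec d)) (θ₀, θ₀)))
  refine ⟨_, h3, fun u v => ?_⟩
  simp
  field_simp
  ring

theorem fderiv_fderiv_log_left (hQ : ContDiffAt ℝ 2 Q (θ₀, θ₀)) (hpos : 0 < Q (θ₀, θ₀))
    (v w : Vec d) :
    fderiv ℝ (fderiv ℝ (fun t => Real.log (Q (t, θ₀)))) θ₀ w v =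
      fderiv ℝ (fderiv ℝ Q) (θ₀, θ₀) (w, 0) (v, 0) / Q (θ₀, θ₀) -
        fderiv ℝ Q (θ₀, θ₀) (v, 0) / Q (θ₀, θ₀) *
          (fderiv ℝ Q (θ₀, θ₀) (w, 0) / Q (θ₀, θ₀)) := by
  obtain ⟨G', hG', hG⟩ := hasFDerivAt_logGradient hQ hpos
  have h1 := HasFDerivAt.comp (f := fun t : Vec d => (t, θ₀)) θ₀ hG' (hasFDerivAt_prodMk_left θ₀ θ₀)
  have hev : ∀ᶠ t in 𝓝 θ₀, ContDiffAt ℝ 2 Q (t, θ₀) ∧ 0 < Q (t, θ₀) :=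
    (Continuous.prodMk_left θ₀).continuousAt.eventually (eventually_contDiffAt_pos hQ hpos)
  have h2 : fderiv ℝ (fun t => Real.log (Q (t, θ₀))) =ᶠ[𝓝 θ₀] fun t => (Q (t, θ₀))⁻¹ •
      (fderiv ℝ Q (t, θ₀)).comp (ContinuousLinearMap.inl ℝ (Vec d) (Vec d)) := by
    filter_upwards [hev] with t ht
    exact (hasFDerivAt_log_left ht.1 ht.2).fderiv
  rw [h2.fderiv_eq]
  have h3 : fderiv ℝ (fun t => (Q (t, θ₀))⁻¹ •
      (fderiv ℝ Q (t, θ₀)).comp (ContinuousLinearMap.inl ℝ (Vec d) (Vec d))) θ₀ = _ := h1.fderiv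
  rw [h3, ← hG]
  rfl

theorem fderiv_right_fderiv_log_left (hQ : ContDiffAt ℝ 2 Q (θ₀, θ₀)) (hpos : 0 < Q (θ₀, θ₀))
    (v w : Vec d) :
    fderiv ℝ (fun θ => fderiv ℝ (fun t => Real.log (Q (t, θ))) θ₀) θ₀ w v =
      fderiv ℝ (fderiv ℝ Q) (θ₀, θ₀) (0, w) (v, 0) / Q (θ₀, θ₀) -
        fderiv ℝ Q (θ₀, θ₀) (v, 0) / Q (θ₀, θ₀) *
          (fderiv ℝ Q (θ₀, θ₀) (0, w) / Q (θ₀, θ₀)) := by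
  obtain ⟨G', hG', hG⟩ := hasFDerivAt_logGradient hQ hpos
  have h1 := HasFDerivAt.comp θ₀ hG' (hasFDerivAt_prodMk_right θ₀ θ₀)
  have hev : ∀ᶠ θ in 𝓝 θ₀, ContDiffAt ℝ 2 Q (θ₀, θ) ∧ 0 < Q (θ₀, θ) :=
    (Continuous.prodMk_right θ₀).continuousAt.eventually (eventually_contDiffAt_pos hQ hpos)
  have h2 : (fun θ => fderiv ℝ (fun t => Real.log (Q (t, θ))) θ₀) =ᶠ[𝓝 θ₀]
      fun θ => (Q (θ₀, θ))⁻¹ •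
        (fderiv ℝ Q (θ₀, θ)).comp (ContinuousLinearMap.inl ℝ (Vec d) (Vec d)) := by
    filter_upwards [hev] with θ hθ
    exact (hasFDerivAt_log_left hθ.1 hθ.2).fderiv
  rw [h2.fderiv_eq]
  have h3 : fderiv ℝ (fun θ => (Q (θ₀, θ))⁻¹ •
      (fderiv ℝ Q (θ₀, θ)).comp (ContinuousLinearMap.inl ℝ (Vec d) (Vec d))) θ₀ = _ := h1.fderiv
  rw [h3, ← hG]
  rfl

end LogDeriv

/-! ### Differentiation under the integral sign -/

/-- If `h ↦ ∫ f h` is constant and may be differentiated under the integral sign, the derivative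
of the integrand integrates to zero, and vanishes where the integrands do. -/
theorem integral_deriv_eq_zero {𝒳 : Type*} [MeasurableSpace 𝒳] {μ : Measure 𝒳}
    {f f' : ℝ → 𝒳 → ℝ} {K : 𝒳 → ℝ} {ε c : ℝ} {Z : 𝒳 → Prop} (hε : 0 < ε)
    (hf : ∀ h, |h| < ε → Integrable (f h) μ ∧ ∫ x, f h x ∂μ = c ∧ ∀ᵐ x ∂μ, Z x → f h x = 0)
    (hK : Integrable K μ)
    (hf' : ∀ᵐ x ∂μ, ∀ h, |h| < ε → HasDerivAt (fun h => f h x) (f' h x) h ∧ |f' h x| ≤ K x) :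
    Integrable (f' 0) μ ∧ ∫ x, f' 0 x ∂μ = 0 ∧ ∀ᵐ x ∂μ, Z x → f' 0 x = 0 := by
  have h0 : |(0 : ℝ)| < ε := by simpa using hε
  -- The derivative is a limit of difference quotients along a sequence. Only countably many null
  -- sets are discarded, which gives both its measurability and its vanishing on `Z`.
  obtain ⟨h, -, hmem, hlim0'⟩ := exists_seq_strictAnti_tendsto' hε
  have hpos : ∀ k, 0 < h k := fun k => (hmem k).1
  have hlt : ∀ k, |h k| < ε := fun k => by
    rw [abs_of_pos (hpos k)]
    exact (hmem k).2
  have hlim0 : Tendsto h atTop (𝓝[≠] 0) :=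
    tendsto_nhdsWithin_iff.mpr ⟨hlim0', Eventually.of_forall fun k => (hpos k).ne'⟩
  have hlim : ∀ᵐ x ∂μ, Tendsto (fun k => (h k)⁻¹ • (f (h k) x - f 0 x)) atTop (𝓝 (f' 0 x)) := by
    filter_upwards [hf'] with x hx
    have := (hasDerivAt_iff_tendsto_slope_zero.mp (hx 0 h0).1).comp hlim0
    simpa [Function.comp_def] using this
  have hdiff : ∀ k, AEStronglyMeasurable (fun x => (h k)⁻¹ • (f (h k) x - f 0 x)) μ := fun k =>
    AEStronglyMeasurable.const_smul ((hf _ (hlt k)).1.1.sub (hf 0 h0).1.1) (h k)⁻¹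
  have hmeas : AEStronglyMeasurable (f' 0) μ :=
    aestronglyMeasurable_of_tendsto_ae atTop hdiff hlim
  obtain ⟨hint, hder⟩ := hasDerivAt_integral_of_dominated_loc_of_deriv_le (μ := μ) (𝕜 := ℝ)
    (F := f) (F' := f') (bound := K) (x₀ := 0) (ball_mem_nhds (0 : ℝ) hε)
    (by
      filter_upwards [ball_mem_nhds (0 : ℝ) hε] with t ht
      exact (hf t (by simpa using ht)).1.1)
    (hf 0 h0).1 hmeas
    (by
      filter_upwards [hf'] with x hx t ht
      exact (hx t (by simpa using ht)).2)
    hK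
    (by
      filter_upwards [hf'] with x hx t ht
      exact (hx t (by simpa using ht)).1)
  refine ⟨hint, ?_, ?_⟩
  · have hconst : (fun t => ∫ x, f t x ∂μ) =ᶠ[𝓝 0] fun _ => c := by
      filter_upwards [ball_mem_nhds (0 : ℝ) hε] with t ht
      exact (hf t (by simpa using ht)).2.1
    exact hder.unique ((hasDerivAt_const (0 : ℝ) c).congr_of_eventuallyEq hconst)
  · filter_upwards [hlim, (hf 0 h0).2.2, ae_all_iff.mpr fun k => (hf _ (hlt k)).2.2]
      with x hx hx0 hxk hZ
    refine tendsto_nhds_unique hx ?_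
    simp [hx0 hZ, hxk _ hZ]

namespace Experiment

variable {d : ℕ} {𝒳 B Ω : Type*} [MeasurableSpace 𝒳] [SeminormedAddCommGroup B]
  [MeasurableSpace Ω] {S : Experiment d 𝒳 B Ω}

/-- The density cancels wherever it is positive; where it vanishes the quotient is `0` by
convention, and so is `g` by hypothesis. -/
theorem integral_div_density {g : 𝒳 → ℝ} (hg : Integrable g S.dom)
    (hg0 : ∀ᵐ x ∂S.dom, S.p S.θ₀ S.η₀ x = 0 → g x = 0) :
    Integrable (fun x => g x / S.p S.θ₀ S.η₀ x) S.P₀ ∧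
      ∫ x, g x / S.p S.θ₀ S.η₀ x ∂S.P₀ = ∫ x, g x ∂S.dom := by
  have hm := S.measurable_p _ S.θ₀_mem _ S.η₀_mem
  have hae : (fun x => S.p S.θ₀ S.η₀ x • (g x / S.p S.θ₀ S.η₀ x)) =ᵐ[S.dom] g := by
    filter_upwards [hg0] with x hx
    by_cases h : S.p S.θ₀ S.η₀ x = 0
    · simp [h, hx h]
    · rw [NNReal.smul_def, smul_eq_mul]
      have : (S.p S.θ₀ S.η₀ x : ℝ) ≠ 0 := by exact_mod_cast h
      field_simp
  constructor
  · rw [P₀, integrable_withDensity_iff_integrable_smul hm]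
    exact hg.congr hae.symm
  · rw [P₀, integral_withDensity_eq_integral_smul hm]
    exact integral_congr_ae hae

/-- The density of the submodel through the true nuisance parameter. -/
def subDensity (S : Experiment d 𝒳 B Ω) (x : 𝒳) (s : Vec d × Vec d) : ℝ :=
  S.p s.1 (S.sub s.1 s.2 S.η₀) x

/-- The densities of the submodel through the truth integrate to one. The second derivatives
therefore integrate to zero. -/
theorem integral_fderiv_fderiv_subDensity (hLF : S.IsLeastFavorable) (hReg : S.IsRegularSubmodel)
    (hint : S.θ₀ ∈ interior S.Θ) :
    (∀ᵐ x ∂S.dom, ContDiffAt ℝ 2 (S.subDensity x) (S.θ₀, S.θ₀)) ∧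
    ∀ v w : Vec d × Vec d,
      Integrable (fun x => fderiv ℝ (fderiv ℝ (S.subDensity x)) (S.θ₀, S.θ₀) w v) S.dom ∧
      ∫ x, fderiv ℝ (fderiv ℝ (S.subDensity x)) (S.θ₀, S.θ₀) w v ∂S.dom = 0 ∧
      ∀ᵐ x ∂S.dom, S.p S.θ₀ S.η₀ x = 0 →
        fderiv ℝ (fderiv ℝ (S.subDensity x)) (S.θ₀, S.θ₀) w v = 0 := by
  obtain ⟨δ₁, hδ₁, ⟨K, hK, hKae⟩, hvan⟩ := hReg
  obtain ⟨δ₂, hδ₂, hsub⟩ := hLF.sub_mem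
  obtain ⟨δ₃, hδ₃, hball⟩ := Metric.isOpen_iff.mp isOpen_interior _ hint
  obtain ⟨δ, hδ, hδle⟩ : ∃ δ : ℝ, 0 < δ ∧ δ ≤ δ₁ ∧ δ ≤ δ₂ ∧ δ ≤ δ₃ :=
    ⟨min δ₁ (min δ₂ δ₃), by positivity, min_le_left _ _,
      (min_le_right _ _).trans (min_le_left _ _), (min_le_right _ _).trans (min_le_right _ _)⟩
  have hq : ∀ s ∈ ball (S.θ₀, S.θ₀) δ, Integrable (fun x => S.subDensity x s) S.dom ∧
      ∫ x, S.subDensity x s ∂S.dom = 1 ∧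
      ∀ᵐ x ∂S.dom, S.p S.θ₀ S.η₀ x = 0 → S.subDensity x s = 0 := by
    intro s hs
    have hs' : s.1 ∈ ball S.θ₀ δ ∧ s.2 ∈ ball S.θ₀ δ := by
      rw [← ball_prod_same] at hs
      exact hs
    have hΘ : s.1 ∈ S.Θ := interior_subset (hball (ball_subset_ball hδle.2.2 hs'.1))
    have hH : S.sub s.1 s.2 S.η₀ ∈ S.H :=
      hsub _ (ball_subset_ball hδle.2.1 hs'.1) _ (ball_subset_ball hδle.2.1 hs'.2) _
        ⟨S.η₀_mem, mem_ball_self hδ₂⟩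
    have hm := S.measurable_p _ hΘ _ hH
    have h1 := S.lintegral_p _ hΘ _ hH
    refine ⟨⟨by unfold subDensity; fun_prop, ?_⟩, ?_, ?_⟩
    · simp only [HasFiniteIntegral, subDensity]
      simp [h1]
    · unfold subDensity
      rw [integral_eq_lintegral_of_nonneg_ae (ae_of_all _ fun x => by simp) (by fun_prop)]
      simp [h1]
    · filter_upwards [hvan s (ball_subset_ball hδle.1 hs)] with x hx hx0
      simp [subDensity, hx hx0]
  have hK0 : ∀ᵐ x ∂S.dom, ∀ s ∈ ball (S.θ₀, S.θ₀) δ, ContDiffAt ℝ 2 (S.subDensity x) s ∧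
      ∀ v w, |fderiv ℝ (S.subDensity x) s v| ≤ K x * ‖v‖ ∧
        |fderiv ℝ (fderiv ℝ (S.subDensity x)) s w v| ≤ K x * ‖w‖ * ‖v‖ := by
    filter_upwards [hKae] with x hx s hs
    have hs1 := ball_subset_ball hδle.1 hs
    refine ⟨(hx.1 s hs1).contDiffAt (isOpen_ball.mem_nhds hs1), fun v w => ⟨?_, ?_⟩⟩
    · have h1 := hx.2 s hs1 1 (by simp)
      have h2 := ContinuousMultilinearMap.le_opNorm
        (iteratedFDeriv ℝ 1 (S.subDensity x) s) ![v]
      rw [iteratedFDeriv_one_apply] at h2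
      simp only [Real.norm_eq_abs, Matrix.cons_val_zero, Finset.univ_unique, Finset.prod_singleton,
        Fin.default_eq_zero] at h2
      exact h2.trans (by gcongr; exact h1)
    · have h1 := hx.2 s hs1 2 (by simp)
      have h2 := ContinuousMultilinearMap.le_opNorm
        (iteratedFDeriv ℝ 2 (S.subDensity x) s) ![w, v]
      rw [iteratedFDeriv_two_apply] at h2
      simp only [Real.norm_eq_abs, Matrix.cons_val_zero, Matrix.cons_val_one,
        Fin.prod_univ_two, ← mul_assoc] at h2
      exact h2.trans (by gcongr; exact h1)
  refine ⟨hK0.mono fun x hx => (hx _ (mem_ball_self hδ)).1, fun v w => ?_⟩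
  have hline : ∀ (s v : Vec d × Vec d), s ∈ ball (S.θ₀, S.θ₀) (δ / 2) → ∀ h : ℝ,
      |h| < δ / 2 / (‖v‖ + 1) → s + h • v ∈ ball (S.θ₀, S.θ₀) δ := by
    intro s v hs h hh
    rw [mem_ball, dist_eq_norm] at hs ⊢
    have h1 : ‖h • v‖ ≤ δ / 2 := by
      rw [norm_smul, Real.norm_eq_abs]
      rw [lt_div_iff₀ (by positivity)] at hh
      nlinarith [abs_nonneg h, norm_nonneg v]
    calc ‖s + h • v - (S.θ₀, S.θ₀)‖ = ‖(s - (S.θ₀, S.θ₀)) + h • v‖ := by congr 1; abel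
      _ ≤ ‖s - (S.θ₀, S.θ₀)‖ + ‖h • v‖ := norm_add_le _ _
      _ < δ := by linarith
  have hlineDeriv : ∀ (s v : Vec d × Vec d) (h : ℝ),
      HasDerivAt (fun h : ℝ => s + h • v) v h := fun s v h => by
    simpa using ((hasDerivAt_id h).smul_const v).const_add s
  -- The first derivatives must integrate to zero at all nearby points, not only at the truth: the
  -- second differentiation uses this as its constancy hypothesis, with `c = 0`.
  have hfirst : ∀ s ∈ ball (S.θ₀, S.θ₀) (δ / 2), ∀ v,
      Integrable (fun x => fderiv ℝ (S.subDensity x) s v) S.dom ∧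
      ∫ x, fderiv ℝ (S.subDensity x) s v ∂S.dom = 0 ∧
      ∀ᵐ x ∂S.dom, S.p S.θ₀ S.η₀ x = 0 → fderiv ℝ (S.subDensity x) s v = 0 := by
    intro s hs v
    have := integral_deriv_eq_zero (μ := S.dom) (f := fun h x => S.subDensity x (s + h • v))
      (f' := fun h x => fderiv ℝ (S.subDensity x) (s + h • v) v) (K := fun x => K x * ‖v‖)
      (ε := δ / 2 / (‖v‖ + 1)) (c := 1) (Z := fun x => S.p S.θ₀ S.η₀ x = 0) (by positivity)
      (fun h hh => hq _ (hline s v hs h hh)) (hK.mul_const _)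
      (by
        filter_upwards [hK0] with x hx h hh
        obtain ⟨hx1, hx2⟩ := hx _ (hline s v hs h hh)
        refine ⟨?_, (hx2 v 0).1⟩
        exact (hx1.differentiableAt (by norm_num)).hasFDerivAt.comp_hasDerivAt h
          (hlineDeriv s v h))
    simpa using this
  have h0 : (S.θ₀, S.θ₀) ∈ ball (S.θ₀, S.θ₀) (δ / 2) := mem_ball_self (by positivity)
  have hline' : ∀ h : ℝ, |h| < δ / 2 / 2 / (‖w‖ + 1) →
      (S.θ₀, S.θ₀) + h • w ∈ ball (S.θ₀, S.θ₀) (δ / 2) := by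
    intro h hh
    rw [mem_ball, dist_eq_norm, add_sub_cancel_left, norm_smul, Real.norm_eq_abs]
    rw [lt_div_iff₀ (by positivity)] at hh
    nlinarith [abs_nonneg h, norm_nonneg w]
  have := integral_deriv_eq_zero (μ := S.dom)
    (f := fun h x => fderiv ℝ (S.subDensity x) ((S.θ₀, S.θ₀) + h • w) v)
    (f' := fun h x => fderiv ℝ (fderiv ℝ (S.subDensity x)) ((S.θ₀, S.θ₀) + h • w) w v)
    (K := fun x => K x * ‖w‖ * ‖v‖)
    (ε := δ / 2 / 2 / (‖w‖ + 1)) (c := 0) (Z := fun x => S.p S.θ₀ S.η₀ x = 0) (by positivity)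
    (fun h hh => hfirst _ (hline' h hh) v) ((hK.mul_const _).mul_const _)
    (by
      filter_upwards [hK0] with x hx h hh
      obtain ⟨hx1, hx2⟩ := hx _ (ball_subset_ball (by linarith) (hline' h hh))
      refine ⟨?_, (hx2 v w).2⟩
      have h2 := ((hx1.fderiv_right (m := 1) (by norm_num)).differentiableAt
        (by norm_num)).hasFDerivAt.comp_hasDerivAt h (hlineDeriv (S.θ₀, S.θ₀) w h)
      exact (ContinuousLinearMap.apply ℝ ℝ v).hasFDerivAt.comp_hasDerivAt h h2)
  simpa using this

end Experiment

/-! ### Information identities for the least favorable submodel. -/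

namespace Experiment

variable {d : ℕ} {𝒳 B Ω : Type*} [MeasurableSpace 𝒳] [SeminormedAddCommGroup B]
  [MeasurableSpace Ω] {S : Experiment d 𝒳 B Ω}

theorem ellT_eq_fderiv (i : Fin d) (t θ : Vec d) (η : B) (x : 𝒳) :
    S.ellT i t θ η x = fderiv ℝ (fun t' => S.ell t' θ η x) t (unitVec i) :=
  partialD_one_zero_apply (fun t' θ' => S.ell t' θ' η x) t θ (unitVec i)

theorem ellTT_eq_fderiv (i j : Fin d) (t θ : Vec d) (η : B) (x : 𝒳) :
    S.ellTT i j t θ η x =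
      fderiv ℝ (fderiv ℝ (fun t' => S.ell t' θ η x)) t (unitVec i) (unitVec j) :=
  partialD_two_zero_apply (fun t' θ' => S.ell t' θ' η x) t θ (unitVec i) (unitVec j)

theorem ellTθ_eq_fderiv (i j : Fin d) (t θ : Vec d) (η : B) (x : 𝒳) :
    S.ellTθ i j t θ η x =
      fderiv ℝ (fun θ' => fderiv ℝ (fun t' => S.ell t' θ' η x) t) θ (unitVec j) (unitVec i) :=
  partialD_one_one_apply (fun t' θ' => S.ell t' θ' η x) t θ (unitVec i) (unitVec j)

theorem subDensity_diag (hA2 : ∀ θ ∈ S.Θ, ∀ η ∈ S.H, S.sub θ θ η = η) {θ : Vec d}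
    (hθ : θ ∈ S.Θ) (x : 𝒳) : S.subDensity x (θ, θ) = S.p θ S.η₀ x := by
  simp [subDensity, hA2 θ hθ _ S.η₀_mem]

/-- The derivatives of the log likelihood of the submodel, in terms of those of the density. -/
theorem ae_ell_derivatives (hLF : S.IsLeastFavorable) (hReg : S.IsRegularSubmodel)
    (hint : S.θ₀ ∈ interior S.Θ) (hA2 : ∀ θ ∈ S.Θ, ∀ η ∈ S.H, S.sub θ θ η = η) :
    ∀ᵐ x ∂S.P₀, ∀ i j,
      S.ellTT i j S.θ₀ S.θ₀ S.η₀ x =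
        fderiv ℝ (fderiv ℝ (S.subDensity x)) (S.θ₀, S.θ₀) (unitVec i, 0) (unitVec j, 0) /
          S.p S.θ₀ S.η₀ x -
        S.ellT j S.θ₀ S.θ₀ S.η₀ x * S.ellT i S.θ₀ S.θ₀ S.η₀ x ∧
      S.ellTθ i j S.θ₀ S.θ₀ S.η₀ x =
        fderiv ℝ (fderiv ℝ (S.subDensity x)) (S.θ₀, S.θ₀) (0, unitVec j) (unitVec i, 0) /
          S.p S.θ₀ S.η₀ x -
        S.ellT i S.θ₀ S.θ₀ S.η₀ x * (S.score j x - S.ellT j S.θ₀ S.θ₀ S.η₀ x) := by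
  have hac : S.P₀ ≪ S.dom := withDensity_absolutelyContinuous _ _
  filter_upwards [hac.ae_le (integral_fderiv_fderiv_subDensity hLF hReg hint).1,
    S.ae_pos_density] with x hQ hp i j
  have hdiag := subDensity_diag hA2 S.θ₀_mem x
  have hpos : 0 < S.subDensity x (S.θ₀, S.θ₀) := by
    rw [hdiag]
    exact_mod_cast hp
  have hT : ∀ i, S.ellT i S.θ₀ S.θ₀ S.η₀ x =
      fderiv ℝ (S.subDensity x) (S.θ₀, S.θ₀) (unitVec i, 0) / S.subDensity x (S.θ₀, S.θ₀) :=
    fun i => (ellT_eq_fderiv i _ _ _ x).trans (fderiv_log_left hQ hpos _)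
  have hscore : S.score j x =
      fderiv ℝ (S.subDensity x) (S.θ₀, S.θ₀) (unitVec j, unitVec j) /
        S.subDensity x (S.θ₀, S.θ₀) := by
    rw [← fderiv_log_diag hQ hpos, score]
    have : (fun θ => Real.log (S.p θ S.η₀ x : ℝ)) =ᶠ[𝓝 S.θ₀]
        fun θ => Real.log (S.subDensity x (θ, θ)) := by
      filter_upwards [mem_interior_iff_mem_nhds.mp hint] with θ hθ
      rw [subDensity_diag hA2 hθ]
    rw [this.fderiv_eq]
  -- The score differentiates the density along the diagonal and `ellT` along the first axis, so
  -- their difference is the derivative along the second axis.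
  have hdiff : S.score j x - S.ellT j S.θ₀ S.θ₀ S.η₀ x =
      fderiv ℝ (S.subDensity x) (S.θ₀, S.θ₀) (0, unitVec j) / S.subDensity x (S.θ₀, S.θ₀) := by
    rw [hscore, hT, ← sub_div, ← map_sub]
    simp
  constructor
  · rw [hT, hT, ← hdiag]
    exact (ellTT_eq_fderiv i j _ _ _ x).trans (fderiv_fderiv_log_left hQ hpos _ _)
  · rw [hdiff, hT, ← hdiag]
    exact (ellTθ_eq_fderiv i j _ _ _ x).trans (fderiv_right_fderiv_log_left hQ hpos _ _)

theorem memLp_ellT (hLF : S.IsLeastFavorable) (i : Fin d) :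
    MemLp (S.ellT i S.θ₀ S.θ₀ S.η₀) 2 S.P₀ :=
  (memLp_congr_ae (hLF.score_eq i)).mpr (Lp.memLp _)

/-- By least favorability `ellT` is the score minus its projection. Hence the derivative of the
submodel in `θ` alone lies in the nuisance tangent space, to which the efficient score is
orthogonal. -/
theorem score_sub_ellT_ae_eq (hLF : S.IsLeastFavorable) (j : Fin d) :
    (fun x => S.score j x - S.ellT j S.θ₀ S.θ₀ S.η₀ x) =ᵐ[S.P₀]
      S.nuisanceTangent.starProjection (S.scoreLp j) := by
  have h1 : S.scoreLp j =ᵐ[S.P₀] S.score j := by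
    rw [scoreLp, dif_pos (hLF.memLp_score j)]
    exact MemLp.coeFn_toLp _
  filter_upwards [h1, hLF.score_eq j,
    Lp.coeFn_sub (S.scoreLp j) (S.nuisanceTangent.starProjection (S.scoreLp j))] with x h1 h2 h3
  rw [h2, effScore, h3, Pi.sub_apply, h1]
  ring

/-- The second Bartlett identity: the expected second derivative of the log likelihood of the
least favorable submodel is minus the efficient information. -/
theorem integral_ellTT (hLF : S.IsLeastFavorable) (hReg : S.IsRegularSubmodel)
    (hint : S.θ₀ ∈ interior S.Θ) (hA2 : ∀ θ ∈ S.Θ, ∀ η ∈ S.H, S.sub θ θ η = η) (i j : Fin d) :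
    ∫ x, S.ellTT i j S.θ₀ S.θ₀ S.η₀ x ∂S.P₀ = -S.effInfo i j := by
  obtain ⟨h1, h2, h3⟩ := (integral_fderiv_fderiv_subDensity hLF hReg hint).2
    (unitVec j, 0) (unitVec i, 0)
  obtain ⟨h4, h5⟩ := integral_div_density h1 h3
  have h6 : Integrable (fun x => S.ellT j S.θ₀ S.θ₀ S.η₀ x * S.ellT i S.θ₀ S.θ₀ S.η₀ x) S.P₀ :=
    (memLp_ellT hLF j).integrable_mul (memLp_ellT hLF i)
  rw [integral_congr_ae ((ae_ell_derivatives hLF hReg hint hA2).mono fun x hx => (hx i j).1),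
    integral_sub h4 h6, h5, h2, zero_sub, effInfo, Matrix.of_apply]
  congr 1
  refine integral_congr_ae ?_
  filter_upwards [hLF.score_eq i, hLF.score_eq j] with x hi hj
  rw [hi, hj, mul_comm]

/-- The score of the least favorable submodel is insensitive, on average, to the nuisance
direction. -/
theorem integral_ellTθ (hLF : S.IsLeastFavorable) (hReg : S.IsRegularSubmodel)
    (hint : S.θ₀ ∈ interior S.Θ) (hA2 : ∀ θ ∈ S.Θ, ∀ η ∈ S.H, S.sub θ θ η = η) (i j : Fin d) :
    ∫ x, S.ellTθ i j S.θ₀ S.θ₀ S.η₀ x ∂S.P₀ = 0 := by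
  obtain ⟨h1, h2, h3⟩ := (integral_fderiv_fderiv_subDensity hLF hReg hint).2
    (unitVec i, 0) (0, unitVec j)
  obtain ⟨h4, h5⟩ := integral_div_density h1 h3
  have hmem := (memLp_congr_ae (score_sub_ellT_ae_eq hLF j)).mpr (Lp.memLp _)
  have h6 : Integrable (fun x => S.ellT i S.θ₀ S.θ₀ S.η₀ x *
      (S.score j x - S.ellT j S.θ₀ S.θ₀ S.η₀ x)) S.P₀ :=
    (memLp_ellT hLF i).integrable_mul hmem
  rw [integral_congr_ae ((ae_ell_derivatives hLF hReg hint hA2).mono fun x hx => (hx i j).2),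
    integral_sub h4 h6, h5, h2, zero_sub, neg_eq_zero]
  -- The second derivative of the density integrates to zero; what remains is the inner product of
  -- the efficient score with an element of the nuisance tangent space.
  have horth : inner ℝ (S.nuisanceTangent.starProjection (S.scoreLp j)) (S.effScore i) = 0 :=
    Submodule.inner_right_of_mem_orthogonal (Submodule.starProjection_apply_mem _ _)
      (Submodule.sub_starProjection_mem_orthogonal _)
  rw [L2.inner_def] at horth
  rw [← horth]
  refine integral_congr_ae ?_
  filter_upwards [hLF.score_eq i, score_sub_ellT_ae_eq hLF j] with x hi hj
  rw [hi, hj]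
  simp

end Experiment

/-! ### Taylor expansions -/

section Taylor

variable {E G : Type*} [NormedAddCommGroup E] [NormedSpace ℝ E] [NormedAddCommGroup G]
  [NormedSpace ℝ G]

/-- The mean value inequality on the segment, with `g' a` subtracted from the derivative. The factor
`1 / 2` is given up, since only the order matters. -/
theorem norm_taylor_one_le {g : E → G} {g' : E → E →L[ℝ] G} {c a b : E} {δ L : ℝ}
    (ha : a ∈ ball c δ) (hb : b ∈ ball c δ) (hL : 0 ≤ L)
    (hg : ∀ y ∈ ball c δ, HasFDerivAt g (g' y) y)
    (hlip : ∀ y ∈ ball c δ, ‖g' y - g' a‖ ≤ L * ‖y - a‖) :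
    ‖g b - g a - g' a (b - a)‖ ≤ L * ‖b - a‖ ^ 2 := by
  have hseg : segment ℝ a b ⊆ ball c δ := (convex_ball c δ).segment_subset ha hb
  have h := (convex_segment a b).norm_image_sub_le_of_norm_hasFDerivWithin_le'
    (f := g) (f' := g') (φ := g' a) (C := L * ‖b - a‖)
    (fun y hy => (hg y (hseg hy)).hasFDerivWithinAt)
    (fun y hy => (hlip y (hseg hy)).trans (by
      gcongr
      exact norm_sub_le_of_mem_segment hy))
    (left_mem_segment ℝ a b) (right_mem_segment ℝ a b)
  rwa [mul_assoc, ← sq] at h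

theorem norm_iteratedFDeriv_sub_le {f : E → G} {c a b : E} {δ L : ℝ} {k : ℕ}
    (hf : ∀ y ∈ ball c δ, ContDiffAt ℝ (k + 1 : ℕ) f y)
    (hL : ∀ y ∈ ball c δ, ‖iteratedFDeriv ℝ (k + 1) f y‖ ≤ L)
    (ha : a ∈ ball c δ) (hb : b ∈ ball c δ) :
    ‖iteratedFDeriv ℝ k f b - iteratedFDeriv ℝ k f a‖ ≤ L * ‖b - a‖ := by
  refine (convex_ball c δ).norm_image_sub_le_of_norm_fderiv_le (𝕜 := ℝ) (fun y hy => ?_)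
    (fun y hy => ?_) ha hb
  · exact (hf y hy).differentiableAt_iteratedFDeriv (by exact_mod_cast Nat.lt_succ_self k)
  · rw [norm_fderiv_iteratedFDeriv]
    exact hL y hy

theorem norm_fderiv_sub_le {f : E → G} {c a b : E} {δ L : ℝ}
    (hf : ∀ y ∈ ball c δ, ContDiffAt ℝ 2 f y)
    (hL : ∀ y ∈ ball c δ, ‖iteratedFDeriv ℝ 2 f y‖ ≤ L)
    (ha : a ∈ ball c δ) (hb : b ∈ ball c δ) :
    ‖fderiv ℝ f b - fderiv ℝ f a‖ ≤ L * ‖b - a‖ := by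
  have hL0 : 0 ≤ L := (norm_nonneg _).trans (hL a ha)
  have h := norm_iteratedFDeriv_sub_le (k := 1) (by exact_mod_cast hf) hL ha hb
  refine ContinuousLinearMap.opNorm_le_bound _ (by positivity) fun v => ?_
  have h2 := ContinuousMultilinearMap.le_opNorm
    (iteratedFDeriv ℝ 1 f b - iteratedFDeriv ℝ 1 f a) ![v]
  rw [sub_apply, iteratedFDeriv_one_apply, iteratedFDeriv_one_apply] at h2
  simp only [Matrix.cons_val_zero, Finset.univ_unique, Finset.prod_singleton,
    Fin.default_eq_zero] at h2
  exact h2.trans (by gcongr)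

theorem norm_fderiv_fderiv_apply_sub_le {f : E → G} {c a b : E} {δ L : ℝ}
    (hf : ∀ y ∈ ball c δ, ContDiffAt ℝ 3 f y)
    (hL : ∀ y ∈ ball c δ, ‖iteratedFDeriv ℝ 3 f y‖ ≤ L)
    (ha : a ∈ ball c δ) (hb : b ∈ ball c δ) :
    ‖fderiv ℝ (fderiv ℝ f) b - fderiv ℝ (fderiv ℝ f) a‖ ≤ L * ‖b - a‖ := by
  have hL0 : 0 ≤ L := (norm_nonneg _).trans (hL a ha)
  have h := norm_iteratedFDeriv_sub_le (k := 2) (by exact_mod_cast hf) hL ha hb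
  refine ContinuousLinearMap.opNorm_le_bound₂ _ (by positivity) fun v w => ?_
  have h2 := ContinuousMultilinearMap.le_opNorm
    (iteratedFDeriv ℝ 2 f b - iteratedFDeriv ℝ 2 f a) ![v, w]
  rw [sub_apply, iteratedFDeriv_two_apply, iteratedFDeriv_two_apply] at h2
  simp only [Matrix.cons_val_zero, Matrix.cons_val_one, Fin.prod_univ_two, ← mul_assoc] at h2
  exact h2.trans (by gcongr)

/-- The first order expansion of the derivative. -/
theorem norm_fderiv_taylor_le {f : E → G} {c a b : E} {δ L : ℝ}
    (hf : ∀ y ∈ ball c δ, ContDiffAt ℝ 3 f y)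
    (hL : ∀ y ∈ ball c δ, ‖iteratedFDeriv ℝ 3 f y‖ ≤ L)
    (ha : a ∈ ball c δ) (hb : b ∈ ball c δ) :
    ‖fderiv ℝ f b - fderiv ℝ f a - fderiv ℝ (fderiv ℝ f) a (b - a)‖ ≤ L * ‖b - a‖ ^ 2 :=
  norm_taylor_one_le ha hb ((norm_nonneg _).trans (hL a ha))
    (fun y hy => (((hf y hy).fderiv_right (m := 2) (by norm_num)).differentiableAt
      (by norm_num)).hasFDerivAt)
    (fun _ hy => norm_fderiv_fderiv_apply_sub_le hf hL ha hy)

/-- The second order expansion. -/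
theorem norm_taylor_two_le {f : E → G} {c a b : E} {δ L : ℝ}
    (hf : ∀ y ∈ ball c δ, ContDiffAt ℝ 3 f y)
    (hL : ∀ y ∈ ball c δ, ‖iteratedFDeriv ℝ 3 f y‖ ≤ L)
    (ha : a ∈ ball c δ) (hb : b ∈ ball c δ) :
    ‖f b - f a - fderiv ℝ f a (b - a) -
      (1 / 2 : ℝ) • fderiv ℝ (fderiv ℝ f) a (b - a) (b - a)‖ ≤ L * ‖b - a‖ ^ 3 := by
  have hL0 : 0 ≤ L := (norm_nonneg _).trans (hL a ha)
  set D := fderiv ℝ (fderiv ℝ f) a with hD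
  have hsymm : ∀ v w, D v w = D w v := fun v w =>
    (hf a ha).isSymmSndFDerivAt (by simp; norm_num) v w
  -- Symmetry of `D` merges the two terms of the product rule. The mean value inequality for `f`
  -- minus this quadratic then reduces the claim to the first order expansion of the derivative.
  have hquad : ∀ y, HasFDerivAt (fun y => (1 / 2 : ℝ) • D (y - a) (y - a)) (D (y - a)) y := by
    intro y
    have h1 : HasFDerivAt (fun y : E => y - a) (ContinuousLinearMap.id ℝ E) y :=
      (hasFDerivAt_id y).sub_const a
    have h2 := (((D.hasFDerivAt.comp y h1).clm_apply h1).const_smul (1 / 2 : ℝ))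
    refine h2.congr_fderiv ?_
    ext v
    simp only [smul_apply, add_apply,
      ContinuousLinearMap.comp_apply, ContinuousLinearMap.flip_apply,
      ContinuousLinearMap.id_apply, hsymm v, Function.comp_apply]
    rw [← two_smul ℝ, smul_smul]
    norm_num
  have hseg : segment ℝ a b ⊆ ball c δ := (convex_ball c δ).segment_subset ha hb
  have h := (convex_segment a b).norm_image_sub_le_of_norm_hasFDerivWithin_le'
    (f := fun y => f y - (1 / 2 : ℝ) • D (y - a) (y - a))
    (f' := fun y => fderiv ℝ f y - D (y - a)) (φ := fderiv ℝ f a) (C := L * ‖b - a‖ ^ 2)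
    (fun y hy => (((hf y (hseg hy)).differentiableAt (by norm_num)).hasFDerivAt.sub
      (hquad y)).hasFDerivWithinAt)
    (fun y hy => by
      have h1 := norm_fderiv_taylor_le hf hL ha (hseg hy)
      rw [sub_right_comm]
      refine h1.trans ?_
      gcongr
      exact norm_sub_le_of_mem_segment hy)
    (left_mem_segment ℝ a b) (right_mem_segment ℝ a b)
  rw [mul_assoc, ← pow_succ] at h
  refine le_trans (le_of_eq ?_) h
  congr 1
  simp only [sub_self, map_zero, smul_zero, sub_zero]
  abel

end Taylor

section Coordinates

variable {d : ℕ}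

theorem sum_smul_unitVec (v : Vec d) : ∑ i, v i • unitVec i = v := by
  ext j
  simp [unitVec, Pi.single_apply]

theorem clm_apply_eq_sum {G : Type*} [NormedAddCommGroup G] [NormedSpace ℝ G]
    (A : Vec d →L[ℝ] G) (v : Vec d) : A v = ∑ i, v i • A (unitVec i) := by
  conv_lhs => rw [← sum_smul_unitVec v]
  simp

theorem clm_apply_apply_eq_sum (A : Vec d →L[ℝ] Vec d →L[ℝ] ℝ) (v w : Vec d) :
    A v w = ∑ i, ∑ j, v i * w j * A (unitVec i) (unitVec j) := by
  rw [clm_apply_eq_sum A v, sum_apply]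
  refine Finset.sum_congr rfl fun i _ => ?_
  rw [smul_apply, clm_apply_eq_sum (A (unitVec i)) w, Finset.smul_sum]
  simp only [smul_eq_mul, mul_assoc]

theorem norm_unitVec (i : Fin d) : ‖unitVec i‖ = 1 := by simp [unitVec]

end Coordinates

/-! ### Pointwise expansions of the log likelihood of the submodel. -/

namespace Experiment

variable {d : ℕ} {𝒳 B Ω : Type*} [MeasurableSpace 𝒳] [SeminormedAddCommGroup B]
  [MeasurableSpace Ω] {S : Experiment d 𝒳 B Ω}

/-- The log likelihood of the submodel is smooth at the observation `x`, for parameters within a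
distance `δ` of the truth, and its derivatives are bounded there by `F`. -/
def IsSmoothAt (S : Experiment d 𝒳 B Ω) (δ F : ℝ) (x : 𝒳) : Prop :=
  ∀ t ∈ ball S.θ₀ δ, ∀ θ ∈ ball S.θ₀ δ, ∀ η ∈ S.H ∩ ball S.η₀ δ,
    0 < S.p t (S.sub t θ η) x ∧
    ContDiffAt ℝ 3 (fun t' => S.ell t' θ η x) t ∧
    ContDiffAt ℝ 2 (fun θ' => iteratedFDeriv ℝ 1 (fun t' => S.ell t' θ' η x) t) θ ∧
    ContDiffAt ℝ 1 (fun θ' => iteratedFDeriv ℝ 2 (fun t' => S.ell t' θ' η x) t) θ ∧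
    ∀ lm ∈ ({(0, 0), (1, 0), (2, 0), (3, 0), (1, 1), (1, 2), (2, 1)} : Finset (ℕ × ℕ)),
      ‖partialD lm.1 lm.2 (fun t' θ' => S.ell t' θ' η x) t θ‖ ≤ F

theorem IsSmoothAt.mono {δ δ' F : ℝ} {x : 𝒳} (h : S.IsSmoothAt δ F x) (hδ : δ' ≤ δ) :
    S.IsSmoothAt δ' F x := fun t ht θ hθ η hη =>
  h t (ball_subset_ball hδ ht) θ (ball_subset_ball hδ hθ) η ⟨hη.1, ball_subset_ball hδ hη.2⟩

section Pointwise

variable {δ F : ℝ} {x : 𝒳} {t t' θ : Vec d} {η : B}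

theorem IsSmoothAt.norm_iteratedFDeriv_three_le (h : S.IsSmoothAt δ F x) (ht : t ∈ ball S.θ₀ δ)
    (hθ : θ ∈ ball S.θ₀ δ) (hη : η ∈ S.H ∩ ball S.η₀ δ) :
    ‖iteratedFDeriv ℝ 3 (fun t' => S.ell t' θ η x) t‖ ≤ F := by
  have h1 := (h t ht θ hθ η hη).2.2.2.2 (3, 0) (by simp)
  rwa [partialD, norm_iteratedFDeriv_zero] at h1

theorem IsSmoothAt.ell_taylor (h : S.IsSmoothAt δ F x) (ht : t ∈ ball S.θ₀ δ)
    (ht' : t' ∈ ball S.θ₀ δ) (hθ : θ ∈ ball S.θ₀ δ) (hη : η ∈ S.H ∩ ball S.η₀ δ) :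
    |S.ell t' θ η x - S.ell t θ η x - ∑ i, (t' - t) i * S.ellT i t θ η x -
      1 / 2 * ∑ i, ∑ j, (t' - t) i * (t' - t) j * S.ellTT i j t θ η x| ≤ F * ‖t' - t‖ ^ 3 := by
  have h1 := norm_taylor_two_le (f := fun t' => S.ell t' θ η x)
    (fun y hy => (h y hy θ hθ η hη).2.1)
    (fun y hy => h.norm_iteratedFDeriv_three_le hy hθ hη) ht ht'
  rw [Real.norm_eq_abs] at h1
  refine le_trans (le_of_eq ?_) h1
  rw [clm_apply_eq_sum (fderiv ℝ (fun t' => S.ell t' θ η x) t),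
    clm_apply_apply_eq_sum (fderiv ℝ (fderiv ℝ (fun t' => S.ell t' θ η x)) t)]
  simp only [ellT_eq_fderiv, ellTT_eq_fderiv, smul_eq_mul]

theorem IsSmoothAt.ellTT_left_sub_le (h : S.IsSmoothAt δ F x) (hδ : 0 < δ) (ht : t ∈ ball S.θ₀ δ)
    (hθ : θ ∈ ball S.θ₀ δ) (hη : η ∈ S.H ∩ ball S.η₀ δ) (i j : Fin d) :
    |S.ellTT i j t θ η x - S.ellTT i j S.θ₀ θ η x| ≤ F * ‖t - S.θ₀‖ := by
  have h1 := norm_fderiv_fderiv_apply_sub_le (f := fun t' => S.ell t' θ η x)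
    (fun y hy => (h y hy θ hθ η hη).2.1)
    (fun y hy => h.norm_iteratedFDeriv_three_le hy hθ hη) (mem_ball_self hδ) ht
  have h2 := ContinuousLinearMap.le_opNorm₂ (fderiv ℝ (fderiv ℝ (fun t' => S.ell t' θ η x)) t -
    fderiv ℝ (fderiv ℝ (fun t' => S.ell t' θ η x)) S.θ₀) (unitVec i) (unitVec j)
  rw [norm_unitVec, norm_unitVec, mul_one, mul_one, Real.norm_eq_abs] at h2
  rw [ellTT_eq_fderiv, ellTT_eq_fderiv]
  exact h2.trans h1

theorem IsSmoothAt.ellTT_right_sub_le (h : S.IsSmoothAt δ F x) (hδ : 0 < δ)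
    (hθ : θ ∈ ball S.θ₀ δ) (hη : η ∈ S.H ∩ ball S.η₀ δ) (i j : Fin d) :
    |S.ellTT i j S.θ₀ θ η x - S.ellTT i j S.θ₀ S.θ₀ η x| ≤ F * ‖θ - S.θ₀‖ := by
  have h1 := norm_iteratedFDeriv_sub_le (k := 0)
    (f := fun θ' => iteratedFDeriv ℝ 2 (fun t' => S.ell t' θ' η x) S.θ₀) (c := S.θ₀) (δ := δ)
    (fun y hy => by exact_mod_cast (h _ (mem_ball_self hδ) y hy η hη).2.2.2.1)
    (fun y hy => (h _ (mem_ball_self hδ) y hy η hη).2.2.2.2 (2, 1) (by simp))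
    (mem_ball_self hδ) hθ
  have h2 := ContinuousMultilinearMap.le_opNorm (iteratedFDeriv ℝ 0
    (fun θ' => iteratedFDeriv ℝ 2 (fun t' => S.ell t' θ' η x) S.θ₀) θ - iteratedFDeriv ℝ 0
    (fun θ' => iteratedFDeriv ℝ 2 (fun t' => S.ell t' θ' η x) S.θ₀) S.θ₀) ![]
  have h3 := ContinuousMultilinearMap.le_opNorm (iteratedFDeriv ℝ 2 (fun t' => S.ell t' θ η x) S.θ₀
    - iteratedFDeriv ℝ 2 (fun t' => S.ell t' S.θ₀ η x) S.θ₀) ![unitVec i, unitVec j]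
  simp only [sub_apply, iteratedFDeriv_zero_apply, Finset.univ_eq_empty,
    Finset.prod_empty, mul_one] at h2
  simp only [sub_apply, iteratedFDeriv_two_apply, Fin.prod_univ_two,
    Matrix.cons_val_zero, Matrix.cons_val_one, norm_unitVec, mul_one, Real.norm_eq_abs] at h3
  rw [ellTT_eq_fderiv, ellTT_eq_fderiv]
  exact h3.trans (h2.trans h1)

/-- First `t` moves with `θ` fixed, at the cost of the third `t`-derivative; then `θ` moves at `t =
θ₀`, at the cost of the derivative of order `(2, 1)`. -/
theorem IsSmoothAt.ellTT_sub_le (h : S.IsSmoothAt δ F x) (hδ : 0 < δ) (ht : t ∈ ball S.θ₀ δ)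
    (hθ : θ ∈ ball S.θ₀ δ) (hη : η ∈ S.H ∩ ball S.η₀ δ) (i j : Fin d) :
    |S.ellTT i j t θ η x - S.ellTT i j S.θ₀ S.θ₀ η x| ≤ F * (‖t - S.θ₀‖ + ‖θ - S.θ₀‖) := by
  rw [mul_add]
  exact (abs_sub_le _ _ _).trans
    (add_le_add (h.ellTT_left_sub_le hδ ht hθ hη i j) (h.ellTT_right_sub_le hδ hθ hη i j))

theorem IsSmoothAt.ellT_left_taylor (h : S.IsSmoothAt δ F x) (hδ : 0 < δ) (ht : t ∈ ball S.θ₀ δ)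
    (hθ : θ ∈ ball S.θ₀ δ) (hη : η ∈ S.H ∩ ball S.η₀ δ) (i : Fin d) :
    |S.ellT i t θ η x - S.ellT i S.θ₀ θ η x - ∑ j, (t - S.θ₀) j * S.ellTT j i S.θ₀ θ η x| ≤
      F * ‖t - S.θ₀‖ ^ 2 := by
  have h1 := norm_fderiv_taylor_le (f := fun t' => S.ell t' θ η x)
    (fun y hy => (h y hy θ hθ η hη).2.1)
    (fun y hy => h.norm_iteratedFDeriv_three_le hy hθ hη) (mem_ball_self hδ) ht
  have h2 := ContinuousLinearMap.le_of_opNorm_le _ h1 (unitVec i)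
  rw [norm_unitVec, mul_one, Real.norm_eq_abs] at h2
  refine le_trans (le_of_eq ?_) h2
  rw [clm_apply_eq_sum (fderiv ℝ (fderiv ℝ (fun t' => S.ell t' θ η x)) S.θ₀)]
  simp_rw [sub_apply, sum_apply,
    smul_apply, ellT_eq_fderiv, ellTT_eq_fderiv, smul_eq_mul]

theorem IsSmoothAt.ellT_right_taylor (h : S.IsSmoothAt δ F x) (hδ : 0 < δ)
    (hθ : θ ∈ ball S.θ₀ δ) (hη : η ∈ S.H ∩ ball S.η₀ δ) (i : Fin d) :
    |S.ellT i S.θ₀ θ η x - S.ellT i S.θ₀ S.θ₀ η x -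
      ∑ j, (θ - S.θ₀) j * S.ellTθ i j S.θ₀ S.θ₀ η x| ≤ F * ‖θ - S.θ₀‖ ^ 2 := by
  set g := fun θ' => iteratedFDeriv ℝ 1 (fun t' => S.ell t' θ' η x) S.θ₀ with hg
  have hgd : ∀ y ∈ ball S.θ₀ δ, ContDiffAt ℝ 2 g y := fun y hy =>
    (h _ (mem_ball_self hδ) y hy η hη).2.2.1
  have hgb : ∀ y ∈ ball S.θ₀ δ, ‖iteratedFDeriv ℝ 2 g y‖ ≤ F := fun y hy =>
    (h _ (mem_ball_self hδ) y hy η hη).2.2.2.2 (1, 2) (by simp)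
  have h1 := norm_taylor_one_le (g := g) (g' := fderiv ℝ g) (mem_ball_self hδ) hθ
    ((norm_nonneg _).trans (hgb _ hθ))
    (fun y hy => ((hgd y hy).differentiableAt (by norm_num)).hasFDerivAt)
    (fun y hy => norm_fderiv_sub_le hgd hgb (mem_ball_self hδ) hy)
  have h2 := ContinuousMultilinearMap.le_opNorm
    (g θ - g S.θ₀ - fderiv ℝ g S.θ₀ (θ - S.θ₀)) ![unitVec i]
  simp only [Matrix.cons_val_zero, Finset.univ_unique, Finset.prod_singleton,
    Fin.default_eq_zero, norm_unitVec, mul_one, Real.norm_eq_abs] at h2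
  refine le_trans (le_of_eq ?_) (h2.trans h1)
  have h3 : ∀ j, S.ellTθ i j S.θ₀ S.θ₀ η x = fderiv ℝ g S.θ₀ (unitVec j) ![unitVec i] := fun j => by
    rw [ellTθ, partialD, iteratedFDeriv_one_apply]
    rfl
  rw [clm_apply_eq_sum (fderiv ℝ g S.θ₀)]
  simp_rw [sub_apply, sum_apply,
    smul_apply, h3, smul_eq_mul, ellT_eq_fderiv, hg,
    iteratedFDeriv_one_apply]
  rfl

/-- Expansion in `t` at fixed `θ`, then in `θ` at `t = θ₀`. The first expansion has its second
derivative at `(θ₀, θ)`; moving it to `(θ₀, θ₀)` costs products of the two increments, whence the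
factor `d + 1`. -/
theorem IsSmoothAt.ellT_taylor (h : S.IsSmoothAt δ F x) (hδ : 0 < δ) (ht : t ∈ ball S.θ₀ δ)
    (hθ : θ ∈ ball S.θ₀ δ) (hη : η ∈ S.H ∩ ball S.η₀ δ) (i : Fin d) :
    |S.ellT i t θ η x - S.ellT i S.θ₀ S.θ₀ η x -
      ∑ j, (t - S.θ₀) j * S.ellTT j i S.θ₀ S.θ₀ η x -
      ∑ j, (θ - S.θ₀) j * S.ellTθ i j S.θ₀ S.θ₀ η x| ≤
      F * ((d + 1) * (‖t - S.θ₀‖ + ‖θ - S.θ₀‖) ^ 2) := by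
  have h1 := h.ellT_left_taylor hδ ht hθ hη i
  have h2 := h.ellT_right_taylor hδ hθ hη i
  have hF : 0 ≤ F := (norm_nonneg _).trans (h.norm_iteratedFDeriv_three_le ht hθ hη)
  have h3 : |∑ j, (t - S.θ₀) j * S.ellTT j i S.θ₀ θ η x -
      ∑ j, (t - S.θ₀) j * S.ellTT j i S.θ₀ S.θ₀ η x| ≤
      d * (F * (‖t - S.θ₀‖ * ‖θ - S.θ₀‖)) := by
    rw [← Finset.sum_sub_distrib]
    refine (Finset.abs_sum_le_sum_abs _ _).trans ?_
    have : ∀ j ∈ Finset.univ, |(t - S.θ₀) j * S.ellTT j i S.θ₀ θ η x -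
        (t - S.θ₀) j * S.ellTT j i S.θ₀ S.θ₀ η x| ≤ F * (‖t - S.θ₀‖ * ‖θ - S.θ₀‖) := by
      intro j _
      rw [← mul_sub, abs_mul]
      have h4 : |(t - S.θ₀) j| ≤ ‖t - S.θ₀‖ := PiLp.norm_apply_le (t - S.θ₀) j
      calc _ ≤ ‖t - S.θ₀‖ * (F * ‖θ - S.θ₀‖) :=
            mul_le_mul h4 (h.ellTT_right_sub_le hδ hθ hη j i) (abs_nonneg _) (norm_nonneg _)
        _ = _ := by ring
    refine (Finset.sum_le_card_nsmul _ _ _ this).trans ?_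
    simp
  rw [abs_le] at h1 h2 h3 ⊢
  have h5 : F * ‖t - S.θ₀‖ ^ 2 + F * ‖θ - S.θ₀‖ ^ 2 + d * (F * (‖t - S.θ₀‖ * ‖θ - S.θ₀‖)) ≤
      F * ((d + 1) * (‖t - S.θ₀‖ + ‖θ - S.θ₀‖) ^ 2) := by
    have ha := norm_nonneg (t - S.θ₀)
    have hb := norm_nonneg (θ - S.θ₀)
    have hd : (0 : ℝ) ≤ d := Nat.cast_nonneg d
    have : 0 ≤ F * (d * (‖t - S.θ₀‖ ^ 2 + ‖t - S.θ₀‖ * ‖θ - S.θ₀‖ + ‖θ - S.θ₀‖ ^ 2) +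
        2 * (‖t - S.θ₀‖ * ‖θ - S.θ₀‖)) := by positivity
    linarith
  constructor <;> linarith [h1.1, h1.2, h2.1, h2.2, h3.1, h3.2]

end Pointwise

end Experiment

/-! ### Rates -/

/-- The rate `n^{-min(r, 1/2)}` of the remainder terms. -/
def remRate (r : ℝ) (n : ℕ) : ℝ := (n : ℝ) ^ (-(min r (1 / 2)))

section Rates

variable {r : ℝ} {n : ℕ}

theorem remRate_pos (hn : 0 < n) : 0 < remRate r n := by
  have : (0 : ℝ) < n := by exact_mod_cast hn
  exact Real.rpow_pos_of_pos this _

theorem rpow_neg_le_remRate (hn : 0 < n) : (n : ℝ) ^ (-r) ≤ remRate r n := by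
  have : (1 : ℝ) ≤ n := by exact_mod_cast hn
  exact Real.rpow_le_rpow_of_exponent_le this (neg_le_neg (min_le_left _ _))

theorem inv_sqrt_eq_rpow : (√(n : ℝ))⁻¹ = (n : ℝ) ^ (-(1 / 2) : ℝ) := by
  rw [Real.sqrt_eq_rpow, Real.rpow_neg (Nat.cast_nonneg n)]

/-- The exponent is capped at `1 / 2` so that one quantity dominates both the rate of `ηhat` and the
parametric scale `n^{-1/2}`. -/
theorem inv_sqrt_le_remRate (hn : 0 < n) : (√(n : ℝ))⁻¹ ≤ remRate r n := by
  have : (1 : ℝ) ≤ n := by exact_mod_cast hn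
  rw [inv_sqrt_eq_rpow]
  exact Real.rpow_le_rpow_of_exponent_le this (neg_le_neg (min_le_right _ _))

theorem remRate_sq (hn : 0 < n) : remRate r n ^ 2 = (n : ℝ) ^ (-(2 * min r (1 / 2))) := by
  have : (0 : ℝ) < n := by exact_mod_cast hn
  rw [remRate, sq, ← Real.rpow_add this]
  ring_nf

/-- Here `r > 1 / 4` matters: squared remainders do not exceed the parametric scale, which makes
`θhat` `√n`-consistent. -/
theorem remRate_sq_le_inv_sqrt (hr : 1 / 4 < r) (hn : 0 < n) :
    remRate r n ^ 2 ≤ (√(n : ℝ))⁻¹ := by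
  have : (1 : ℝ) ≤ n := by exact_mod_cast hn
  rw [remRate_sq hn, inv_sqrt_eq_rpow]
  refine Real.rpow_le_rpow_of_exponent_le this ?_
  have : 1 / 4 ≤ min r (1 / 2) := le_min hr.le (by norm_num)
  linarith

/-- With `inv_sqrt_mul_rateM_le`, this turns the assumed modulus of the empirical process, divided
by `√n`, into an expression quadratic in `remRate` and the distance to `θ₀`. -/
theorem inv_sqrt_mul_max_le (hn : 0 < n) :
    (√(n : ℝ))⁻¹ * max ((n : ℝ) ^ (1 / 2 - r)) 1 ≤ remRate r n := by
  have h0 : (0 : ℝ) < n := by exact_mod_cast hn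
  rw [mul_max_of_nonneg _ _ (by positivity), mul_one]
  refine max_le ?_ (inv_sqrt_le_remRate hn)
  rw [inv_sqrt_eq_rpow, ← Real.rpow_add h0]
  refine le_trans (le_of_eq ?_) (rpow_neg_le_remRate (r := r) hn)
  ring_nf

theorem inv_sqrt_mul_rateM_le (hn : 0 < n) :
    (√(n : ℝ))⁻¹ * rateM r n ≤ 2 * remRate r n ^ 2 := by
  have h0 : (0 : ℝ) < n := by exact_mod_cast hn
  have h1 : (1 : ℝ) ≤ n := by exact_mod_cast hn
  rw [rateM, mul_add, inv_sqrt_eq_rpow, ← Real.rpow_add h0, ← Real.rpow_add h0, remRate_sq hn,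
    two_mul]
  refine add_le_add (Real.rpow_le_rpow_of_exponent_le h1 ?_)
    (Real.rpow_le_rpow_of_exponent_le h1 ?_)
  · have := min_le_right r (1 / 2)
    linarith
  · have := min_le_left r (1 / 2)
    linarith

/-- This is where the rate of the conclusion arises: the error `n |h| e²` with `|h|` of order
`n^{-1/2}` is of order `√n e²`. The two summands of `rateM` correspond to `r ≥ 1 / 2` and `r ≤ 1 /
2`. -/
theorem sqrt_mul_remRate_sq_le (hn : 0 < n) : √(n : ℝ) * remRate r n ^ 2 ≤ rateM r n := by
  have h0 : (0 : ℝ) < n := by exact_mod_cast hn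
  rw [remRate_sq hn, Real.sqrt_eq_rpow, ← Real.rpow_add h0, rateM]
  rcases le_total r (1 / 2) with h | h
  · rw [min_eq_left h]
    have : (0 : ℝ) ≤ (n : ℝ) ^ (-(1 / 2) : ℝ) := Real.rpow_nonneg h0.le _
    refine le_trans (le_of_eq ?_) (le_add_of_nonneg_left this)
    ring_nf
  · rw [min_eq_right h]
    have : (0 : ℝ) ≤ (n : ℝ) ^ (-2 * r + 1 / 2) := Real.rpow_nonneg h0.le _
    refine le_trans (le_of_eq ?_) (le_add_of_nonneg_right this)
    ring_nf

theorem tendsto_remRate (hr : 1 / 4 < r) : Tendsto (remRate r) atTop (𝓝 0) := by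
  have h : 0 < min r (1 / 2) := lt_min (by linarith) (by norm_num)
  exact (tendsto_rpow_neg_atTop h).comp tendsto_natCast_atTop_atTop

theorem tendsto_sqrt_mul_remRate_sq (hr : 1 / 4 < r) :
    Tendsto (fun n : ℕ => √(n : ℝ) * remRate r n ^ 2) atTop (𝓝 0) := by
  have h : 1 / 4 < min r (1 / 2) := lt_min hr (by norm_num)
  have h1 := (tendsto_rpow_neg_atTop (y := 2 * min r (1 / 2) - 1 / 2) (by linarith)).comp
    tendsto_natCast_atTop_atTop
  refine h1.congr' ?_
  filter_upwards [eventually_gt_atTop 0] with n hn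
  have h0 : (0 : ℝ) < n := by exact_mod_cast hn
  rw [remRate_sq hn, Real.sqrt_eq_rpow, ← Real.rpow_add h0, Function.comp_apply]
  ring_nf

end Rates

/-! ### Empirical means -/

section EmpMean

variable {Ω 𝒳 : Type*} {X : ℕ → Ω → 𝒳} {n : ℕ} {ω : Ω}

theorem empMean_sub (f g : 𝒳 → ℝ) :
    empMean X n (fun x => f x - g x) ω = empMean X n f ω - empMean X n g ω := by
  simp [empMean, Finset.sum_sub_distrib, sub_div]

theorem empMean_const_mul (c : ℝ) (f : 𝒳 → ℝ) :
    empMean X n (fun x => c * f x) ω = c * empMean X n f ω := by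
  simp [empMean, ← Finset.mul_sum, mul_div_assoc]

theorem empMean_sum {ι : Type*} (s : Finset ι) (f : ι → 𝒳 → ℝ) :
    empMean X n (fun x => ∑ i ∈ s, f i x) ω = ∑ i ∈ s, empMean X n (f i) ω := by
  simp only [empMean, Finset.sum_div]
  rw [Finset.sum_comm]

theorem abs_empMean_le {f F : 𝒳 → ℝ} {c C : ℝ} (hc : 0 ≤ c)
    (h : ∀ i, |f (X i ω)| ≤ F (X i ω) * c) (hF : empMean X n F ω ≤ C) :
    |empMean X n f ω| ≤ C * c := by
  refine le_trans ?_ (mul_le_mul_of_nonneg_right hF hc)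
  rw [empMean, empMean, abs_div, Nat.abs_cast, div_mul_eq_mul_div, Finset.sum_mul]
  gcongr
  exact (Finset.abs_sum_le_sum_abs _ _).trans (Finset.sum_le_sum fun i _ => h i)

theorem empMean_eq_integral_add [MeasurableSpace 𝒳] {P : Measure 𝒳} (hn : 0 < n) (f : 𝒳 → ℝ) :
    empMean X n f ω = ∫ x, f x ∂P + (√(n : ℝ))⁻¹ * empProc X P n f ω := by
  have : √(n : ℝ) ≠ 0 := by positivity
  rw [empProc, inv_mul_cancel_left₀ this]
  ring

end EmpMean

section LinearBounds

variable {d : ℕ}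

theorem norm_le_sum_abs (v : Vec d) : ‖v‖ ≤ ∑ i, |v i| := by
  conv_lhs => rw [← sum_smul_unitVec v]
  refine (norm_sum_le _ _).trans (Finset.sum_le_sum fun i _ => ?_)
  rw [norm_smul, norm_unitVec, mul_one, Real.norm_eq_abs]

theorem abs_sum_mul_le (v : Vec d) {a : Fin d → ℝ} {c : ℝ} (ha : ∀ i, |a i| ≤ c) :
    |∑ i, v i * a i| ≤ d * (‖v‖ * c) := by
  refine (Finset.abs_sum_le_sum_abs _ _).trans ?_
  have : ∀ i ∈ Finset.univ, |v i * a i| ≤ ‖v‖ * c := fun i _ => by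
    rw [abs_mul]
    exact mul_le_mul (PiLp.norm_apply_le v i) (ha i) (abs_nonneg _) (norm_nonneg _)
  refine (Finset.sum_le_card_nsmul _ _ _ this).trans ?_
  simp

theorem abs_sum_sum_mul_le (v : Vec d) {a : Fin d → Fin d → ℝ} {c : ℝ}
    (ha : ∀ i j, |a i j| ≤ c) :
    |∑ i, ∑ j, v i * v j * a i j| ≤ d * (‖v‖ * (d * (‖v‖ * c))) := by
  have h : ∑ i, ∑ j, v i * v j * a i j = ∑ i, v i * ∑ j, v j * a i j := by
    simp only [Finset.mul_sum, mul_assoc]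
  rw [h]
  exact abs_sum_mul_le v fun i => abs_sum_mul_le v (ha i)

end LinearBounds

/-! ### Deterministic expansions on well-behaved samples. -/

namespace Experiment

variable {d : ℕ} {𝒳 B Ω : Type*} [MeasurableSpace 𝒳] [SeminormedAddCommGroup B]
  [MeasurableSpace Ω] {S : Experiment d 𝒳 B Ω}

/-- The nonrandom properties of the submodel in a neighborhood of the truth. -/
structure LocalModel (S : Experiment d 𝒳 B Ω) (δ C : ℝ) : Prop where
  pos : 0 < δ
  one_le : 1 ≤ C
  ball_subset : ball S.θ₀ δ ⊆ S.Θ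
  sub_diag : ∀ θ ∈ S.Θ, ∀ η ∈ S.H, S.sub θ θ η = η
  sub_mem : ∀ t ∈ ball S.θ₀ δ, ∀ θ ∈ ball S.θ₀ δ, ∀ η ∈ S.H ∩ ball S.η₀ δ, S.sub t θ η ∈ S.H
  integral_TT : ∀ η ∈ S.H ∩ ball S.η₀ δ, ∀ i j,
    |∫ x, S.ellTT i j S.θ₀ S.θ₀ η x ∂S.P₀ + S.effInfo i j| ≤ C * ‖η - S.η₀‖
  integral_Tθ : ∀ η ∈ S.H ∩ ball S.η₀ δ, ∀ i j,
    |∫ x, S.ellTθ i j S.θ₀ S.θ₀ η x ∂S.P₀| ≤ C * ‖η - S.η₀‖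
  noBias : ∀ η ∈ S.H ∩ ball S.η₀ δ, ∀ i,
    |∫ x, (S.ellT i S.θ₀ S.θ₀ η x - S.ellT i S.θ₀ S.θ₀ S.η₀ x) ∂S.P₀| ≤ C * ‖η - S.η₀‖ ^ 2
  norm_le : ∀ v : Vec d, ‖v‖ ≤ C * ∑ i, |∑ j, v j * S.effInfo j i|

/-- The properties of the sample which hold with high probability. -/
structure LocalBounds (S : Experiment d 𝒳 B Ω) (r : ℝ) (F : 𝒳 → ℝ) (δ C : ℝ) (n : ℕ) (ω : Ω) :
    Prop where
  good : S.IsGoodSample ω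
  smooth : ∀ i, S.IsSmoothAt δ (F (S.X i ω)) (S.X i ω)
  envelope : empMean S.X n F ω ≤ C
  score : ∀ i, |empMean S.X n (S.ellT i S.θ₀ S.θ₀ S.η₀) ω| ≤ C * (√(n : ℝ))⁻¹
  rate : ∀ θ ∈ S.Θ, dist θ S.θ₀ < δ →
    ‖S.ηhat n θ ω - S.η₀‖ ≤ C * (‖θ - S.θ₀‖ + (n : ℝ) ^ (-r))
  modulus : ∀ θ ∈ S.Θ, dist θ S.θ₀ < δ → ∀ i, |empProc S.X S.P₀ n
    (fun x => S.ellT i S.θ₀ S.θ₀ (S.ηhat n θ ω) x - S.ellT i S.θ₀ S.θ₀ S.η₀ x) ω| ≤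
      C * (rateM r n + max ((n : ℝ) ^ (1 / 2 - r)) 1 * ‖θ - S.θ₀‖)
  proc_TT : ∀ η ∈ S.H ∩ ball S.η₀ δ, ∀ i j,
    |empProc S.X S.P₀ n (S.ellTT i j S.θ₀ S.θ₀ η) ω| ≤ C
  proc_Tθ : ∀ η ∈ S.H ∩ ball S.η₀ δ, ∀ i j,
    |empProc S.X S.P₀ n (S.ellTθ i j S.θ₀ S.θ₀ η) ω| ≤ C

section Expansion

variable {r δ C : ℝ} {F : 𝒳 → ℝ} {n : ℕ} {ω : Ω} {t ψ θ : Vec d}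

theorem LocalBounds.norm_etaHat_sub_le (hB : S.LocalBounds r F δ C n ω) (hM : S.LocalModel δ C)
    (hn : 0 < n) (hψ : ψ ∈ ball S.θ₀ δ) :
    ‖S.ηhat n ψ ω - S.η₀‖ ≤ C * (‖ψ - S.θ₀‖ + remRate r n) := by
  refine (hB.rate ψ (hM.ball_subset hψ) hψ).trans ?_
  have := hM.one_le
  gcongr
  exact rpow_neg_le_remRate hn

/-- The empirical mean is the true mean plus `n^{-1/2}` times the empirical process. The process is
bounded uniformly over `η`, so the random `ηhat` may be inserted; the true mean is within `C ‖ηhat -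
η₀‖` of minus the information. -/
theorem LocalBounds.empMean_ellTT (hB : S.LocalBounds r F δ C n ω) (hM : S.LocalModel δ C)
    (hn : 0 < n) (hψ : ψ ∈ ball S.θ₀ δ) (hη : S.ηhat n ψ ω ∈ ball S.η₀ δ) (i j : Fin d) :
    |empMean S.X n (S.ellTT i j S.θ₀ S.θ₀ (S.ηhat n ψ ω)) ω + S.effInfo i j| ≤
      (C + C ^ 2) * (remRate r n + ‖ψ - S.θ₀‖) := by
  have hC := hM.one_le
  have hη' : S.ηhat n ψ ω ∈ S.H ∩ ball S.η₀ δ := ⟨S.ηhat_mem n ψ (hM.ball_subset hψ) ω, hη⟩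
  rw [empMean_eq_integral_add (P := S.P₀) hn, add_right_comm]
  refine (abs_add_le _ _).trans ?_
  have h1 := hM.integral_TT _ hη' i j
  have h2 := hB.proc_TT _ hη' i j
  have h3 := hB.norm_etaHat_sub_le hM hn hψ
  have h4 : |(√(n : ℝ))⁻¹ * empProc S.X S.P₀ n
      (S.ellTT i j S.θ₀ S.θ₀ (S.ηhat n ψ ω)) ω| ≤ remRate r n * C := by
    rw [abs_mul, abs_of_nonneg (by positivity)]
    exact mul_le_mul (inv_sqrt_le_remRate hn) h2 (abs_nonneg _) (remRate_pos hn).le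
  have h5 : C * ‖S.ηhat n ψ ω - S.η₀‖ ≤ C * (C * (‖ψ - S.θ₀‖ + remRate r n)) := by gcongr
  nlinarith [norm_nonneg (ψ - S.θ₀)]

theorem LocalBounds.empMean_ellTθ (hB : S.LocalBounds r F δ C n ω) (hM : S.LocalModel δ C)
    (hn : 0 < n) (hψ : ψ ∈ ball S.θ₀ δ) (hη : S.ηhat n ψ ω ∈ ball S.η₀ δ) (i j : Fin d) :
    |empMean S.X n (S.ellTθ i j S.θ₀ S.θ₀ (S.ηhat n ψ ω)) ω| ≤
      (C + C ^ 2) * (remRate r n + ‖ψ - S.θ₀‖) := by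
  have hC := hM.one_le
  have hη' : S.ηhat n ψ ω ∈ S.H ∩ ball S.η₀ δ := ⟨S.ηhat_mem n ψ (hM.ball_subset hψ) ω, hη⟩
  rw [empMean_eq_integral_add (P := S.P₀) hn]
  refine (abs_add_le _ _).trans ?_
  have h1 := hM.integral_Tθ _ hη' i j
  have h2 := hB.proc_Tθ _ hη' i j
  have h3 := hB.norm_etaHat_sub_le hM hn hψ
  have h4 : |(√(n : ℝ))⁻¹ * empProc S.X S.P₀ n
      (S.ellTθ i j S.θ₀ S.θ₀ (S.ηhat n ψ ω)) ω| ≤ remRate r n * C := by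
    rw [abs_mul, abs_of_nonneg (by positivity)]
    exact mul_le_mul (inv_sqrt_le_remRate hn) h2 (abs_nonneg _) (remRate_pos hn).le
  have h5 : C * ‖S.ηhat n ψ ω - S.η₀‖ ≤ C * (C * (‖ψ - S.θ₀‖ + remRate r n)) := by gcongr
  nlinarith [norm_nonneg (ψ - S.θ₀)]

/-- The error is quadratic because the bias is quadratic in `‖ηhat - η₀‖` and the empirical process
of the score increment has a small modulus. Mere boundedness of that process would leave an error of
order `n^{-1/2}`. -/
theorem LocalBounds.empMean_ellT_sub (hB : S.LocalBounds r F δ C n ω) (hM : S.LocalModel δ C)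
    (hn : 0 < n) (hψ : ψ ∈ ball S.θ₀ δ) (hη : S.ηhat n ψ ω ∈ ball S.η₀ δ) (i : Fin d) :
    |empMean S.X n (S.ellT i S.θ₀ S.θ₀ (S.ηhat n ψ ω)) ω -
      empMean S.X n (S.ellT i S.θ₀ S.θ₀ S.η₀) ω| ≤
      (2 * C + C ^ 3) * (remRate r n + ‖ψ - S.θ₀‖) ^ 2 := by
  have hC := hM.one_le
  have hη' : S.ηhat n ψ ω ∈ S.H ∩ ball S.η₀ δ := ⟨S.ηhat_mem n ψ (hM.ball_subset hψ) ω, hη⟩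
  have he := (remRate_pos (r := r) hn).le
  rw [← empMean_sub, empMean_eq_integral_add (P := S.P₀) hn]
  refine (abs_add_le _ _).trans ?_
  have h1 := hM.noBias _ hη' i
  have h2 := hB.modulus ψ (hM.ball_subset hψ) hψ i
  have h3 := hB.norm_etaHat_sub_le hM hn hψ
  have h4 : |(√(n : ℝ))⁻¹ * empProc S.X S.P₀ n (fun x => S.ellT i S.θ₀ S.θ₀ (S.ηhat n ψ ω) x -
      S.ellT i S.θ₀ S.θ₀ S.η₀ x) ω| ≤
      C * (2 * remRate r n ^ 2 + remRate r n * ‖ψ - S.θ₀‖) := by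
    rw [abs_mul, abs_of_nonneg (by positivity)]
    calc _ ≤ (√(n : ℝ))⁻¹ *
          (C * (rateM r n + max ((n : ℝ) ^ (1 / 2 - r)) 1 * ‖ψ - S.θ₀‖)) := by gcongr
      _ = C * ((√(n : ℝ))⁻¹ * rateM r n +
          (√(n : ℝ))⁻¹ * max ((n : ℝ) ^ (1 / 2 - r)) 1 * ‖ψ - S.θ₀‖) := by ring
      _ ≤ _ := by
        have h7 := inv_sqrt_mul_rateM_le (r := r) hn
        have h8 := inv_sqrt_mul_max_le (r := r) hn
        exact mul_le_mul_of_nonneg_left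
          (add_le_add h7 (mul_le_mul_of_nonneg_right h8 (norm_nonneg _))) (by linarith)
  have h5 : C * ‖S.ηhat n ψ ω - S.η₀‖ ^ 2 ≤ C * (C * (‖ψ - S.θ₀‖ + remRate r n)) ^ 2 := by gcongr
  have h6 : C * (2 * remRate r n ^ 2 + remRate r n * ‖ψ - S.θ₀‖) ≤
      C * (2 * (remRate r n + ‖ψ - S.θ₀‖) ^ 2) := by
    gcongr
    nlinarith [mul_nonneg he (norm_nonneg (ψ - S.θ₀)), sq_nonneg ‖ψ - S.θ₀‖]
  nlinarith

/-- The expansion of the empirical mean of the score of the submodel. -/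
theorem LocalBounds.empMean_ellT (hB : S.LocalBounds r F δ C n ω) (hM : S.LocalModel δ C)
    (hn : 0 < n) (ht : t ∈ ball S.θ₀ δ) (hψ : ψ ∈ ball S.θ₀ δ)
    (hη : S.ηhat n ψ ω ∈ ball S.η₀ δ) (i : Fin d) :
    |empMean S.X n (S.ellT i t ψ (S.ηhat n ψ ω)) ω -
      empMean S.X n (S.ellT i S.θ₀ S.θ₀ S.η₀) ω + ∑ j, (t - S.θ₀) j * S.effInfo j i| ≤
      (C * (d + 1) + 2 * d * (C + C ^ 2) + (2 * C + C ^ 3)) *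
        (remRate r n + ‖t - S.θ₀‖ + ‖ψ - S.θ₀‖) ^ 2 := by
  have hC := hM.one_le
  set η := S.ηhat n ψ ω with hηdef
  have hη' : η ∈ S.H ∩ ball S.η₀ δ := ⟨S.ηhat_mem n ψ (hM.ball_subset hψ) ω, hη⟩
  have hd : (0 : ℝ) ≤ d := Nat.cast_nonneg d
  have key : ∀ e a b : ℝ, 0 ≤ e → 0 ≤ a → 0 ≤ b →
      C * ((d + 1) * (a + b) ^ 2) + d * (a * ((C + C ^ 2) * (e + b))) +
        d * (b * ((C + C ^ 2) * (e + b))) + (2 * C + C ^ 3) * (e + b) ^ 2 ≤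
      (C * (d + 1) + 2 * d * (C + C ^ 2) + (2 * C + C ^ 3)) * (e + a + b) ^ 2 := by
    intro e a b he ha hb
    have k1 : C * ((d + 1) * (a + b) ^ 2) ≤ C * ((d + 1) * (e + a + b) ^ 2) := by
      gcongr
      linarith
    have k2 : d * (a * ((C + C ^ 2) * (e + b))) ≤
        d * ((e + a + b) * ((C + C ^ 2) * (e + a + b))) := by gcongr <;> linarith
    have k3 : d * (b * ((C + C ^ 2) * (e + b))) ≤
        d * ((e + a + b) * ((C + C ^ 2) * (e + a + b))) := by gcongr <;> linarith
    have k4 : (2 * C + C ^ 3) * (e + b) ^ 2 ≤ (2 * C + C ^ 3) * (e + a + b) ^ 2 := by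
      gcongr
      linarith
    linarith
  have h1 := abs_empMean_le (n := n) (f := fun x => S.ellT i t ψ η x - S.ellT i S.θ₀ S.θ₀ η x -
      ∑ j, (t - S.θ₀) j * S.ellTT j i S.θ₀ S.θ₀ η x -
      ∑ j, (ψ - S.θ₀) j * S.ellTθ i j S.θ₀ S.θ₀ η x) (F := F)
    (c := (d + 1) * (‖t - S.θ₀‖ + ‖ψ - S.θ₀‖) ^ 2) (by positivity)
    (fun k => (hB.smooth k).ellT_taylor hM.pos ht hψ hη' i) hB.envelope
  simp only [empMean_sub, empMean_sum, empMean_const_mul] at h1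
  have h2 := abs_sum_mul_le (t - S.θ₀) fun j => hB.empMean_ellTT hM hn hψ hη j i
  have h3 := abs_sum_mul_le (ψ - S.θ₀) fun j => hB.empMean_ellTθ hM hn hψ hη i j
  have h4 := hB.empMean_ellT_sub hM hn hψ hη i
  simp only [mul_add ((t - S.θ₀) _), Finset.sum_add_distrib] at h2
  rw [← hηdef] at h2 h3 h4
  have h5 := key _ _ _ (remRate_pos (r := r) hn).le (norm_nonneg (t - S.θ₀))
    (norm_nonneg (ψ - S.θ₀))
  rw [abs_le] at h1 h2 h3 h4 ⊢
  constructor <;> linarith [h1.1, h1.2, h2.1, h2.2, h3.1, h3.2, h4.1, h4.2]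

theorem LocalBounds.empMean_ellTT_near (hB : S.LocalBounds r F δ C n ω) (hM : S.LocalModel δ C)
    (hn : 0 < n) (ht : t ∈ ball S.θ₀ δ) (hψ : ψ ∈ ball S.θ₀ δ)
    (hη : S.ηhat n ψ ω ∈ ball S.η₀ δ) (i j : Fin d) :
    |empMean S.X n (S.ellTT i j t ψ (S.ηhat n ψ ω)) ω + S.effInfo i j| ≤
      (2 * C + C ^ 2) * (remRate r n + ‖t - S.θ₀‖ + ‖ψ - S.θ₀‖) := by
  have hC := hM.one_le
  have hη' : S.ηhat n ψ ω ∈ S.H ∩ ball S.η₀ δ := ⟨S.ηhat_mem n ψ (hM.ball_subset hψ) ω, hη⟩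
  have he := (remRate_pos (r := r) hn).le
  have h1 := abs_empMean_le (n := n) (f := fun x => S.ellTT i j t ψ (S.ηhat n ψ ω) x -
      S.ellTT i j S.θ₀ S.θ₀ (S.ηhat n ψ ω) x) (F := F)
    (c := ‖t - S.θ₀‖ + ‖ψ - S.θ₀‖) (by positivity)
    (fun k => (hB.smooth k).ellTT_sub_le hM.pos ht hψ hη' i j) hB.envelope
  rw [empMean_sub] at h1
  have h2 := hB.empMean_ellTT hM hn hψ hη i j
  have h3 : (2 * C + C ^ 2) * (remRate r n + ‖t - S.θ₀‖ + ‖ψ - S.θ₀‖) =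
      C * (‖t - S.θ₀‖ + ‖ψ - S.θ₀‖) + (C + C ^ 2) * (remRate r n + ‖ψ - S.θ₀‖) +
      (C * remRate r n + (C + C ^ 2) * ‖t - S.θ₀‖) := by ring
  have h4 : 0 ≤ C * remRate r n + (C + C ^ 2) * ‖t - S.θ₀‖ := by positivity
  rw [abs_le] at h1 h2 ⊢
  constructor <;> linarith [h1.1, h1.2, h2.1, h2.2]

/-- The expansion of the empirical mean of the log likelihood of the submodel. -/
theorem LocalBounds.empMean_ell (hB : S.LocalBounds r F δ C n ω) (hM : S.LocalModel δ C)
    (ht : t ∈ ball S.θ₀ δ) (hθ : θ ∈ ball S.θ₀ δ) (hψ : ψ ∈ ball S.θ₀ δ)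
    (hη : S.ηhat n ψ ω ∈ ball S.η₀ δ) :
    |empMean S.X n (S.ell θ ψ (S.ηhat n ψ ω)) ω - empMean S.X n (S.ell t ψ (S.ηhat n ψ ω)) ω -
      ∑ i, (θ - t) i * empMean S.X n (S.ellT i t ψ (S.ηhat n ψ ω)) ω -
      1 / 2 * ∑ i, ∑ j, (θ - t) i * (θ - t) j *
        empMean S.X n (S.ellTT i j t ψ (S.ηhat n ψ ω)) ω| ≤ C * ‖θ - t‖ ^ 3 := by
  have hη' : S.ηhat n ψ ω ∈ S.H ∩ ball S.η₀ δ := ⟨S.ηhat_mem n ψ (hM.ball_subset hψ) ω, hη⟩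
  have h1 := abs_empMean_le (n := n) (f := fun x => S.ell θ ψ (S.ηhat n ψ ω) x -
      S.ell t ψ (S.ηhat n ψ ω) x - ∑ i, (θ - t) i * S.ellT i t ψ (S.ηhat n ψ ω) x -
      1 / 2 * ∑ i, ∑ j, (θ - t) i * (θ - t) j * S.ellTT i j t ψ (S.ηhat n ψ ω) x) (F := F)
    (c := ‖θ - t‖ ^ 3) (by positivity)
    (fun k => (hB.smooth k).ell_taylor ht hθ hψ hη') hB.envelope
  simpa only [empMean_sub, empMean_sum, empMean_const_mul] using h1

/-- The log likelihood of the submodel is a sum over the observations. -/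
theorem LocalBounds.log_prod (hB : S.LocalBounds r F δ C n ω) (hM : S.LocalModel δ C)
    (hn : 0 < n) (ht : t ∈ ball S.θ₀ δ) (hψ : ψ ∈ ball S.θ₀ δ)
    (hη : S.ηhat n ψ ω ∈ ball S.η₀ δ) :
    0 < ∏ i ∈ Finset.range n, S.p t (S.sub t ψ (S.ηhat n ψ ω)) (S.X i ω) ∧
    Real.log (∏ i ∈ Finset.range n, S.p t (S.sub t ψ (S.ηhat n ψ ω)) (S.X i ω) : ℝ≥0) =
      n * empMean S.X n (S.ell t ψ (S.ηhat n ψ ω)) ω := by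
  have hη' : S.ηhat n ψ ω ∈ S.H ∩ ball S.η₀ δ := ⟨S.ηhat_mem n ψ (hM.ball_subset hψ) ω, hη⟩
  have hpos : ∀ i, 0 < S.p t (S.sub t ψ (S.ηhat n ψ ω)) (S.X i ω) := fun i =>
    (hB.smooth i t ht ψ hψ _ hη').1
  refine ⟨Finset.prod_pos fun i _ => hpos i, ?_⟩
  have hn' : (n : ℝ) ≠ 0 := by positivity
  rw [NNReal.coe_prod, Real.log_prod fun i _ => by exact_mod_cast (hpos i).ne', empMean,
    mul_div_cancel₀ _ hn']
  rfl

/-- The profile likelihood is bounded below by the likelihood of the submodels. -/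
theorem LocalBounds.le_log_plHat (hB : S.LocalBounds r F δ C n ω) (hM : S.LocalModel δ C)
    (hn : 0 < n) (ht : t ∈ ball S.θ₀ δ) (hψ : ψ ∈ ball S.θ₀ δ)
    (hη : S.ηhat n ψ ω ∈ ball S.η₀ δ) :
    0 < S.plHat n ω t ∧
      n * empMean S.X n (S.ell t ψ (S.ηhat n ψ ω)) ω ≤ Real.log (S.plHat n ω t) := by
  have hη' : S.ηhat n ψ ω ∈ S.H ∩ ball S.η₀ δ := ⟨S.ηhat_mem n ψ (hM.ball_subset hψ) ω, hη⟩
  obtain ⟨h1, h2⟩ := hB.log_prod hM hn ht hψ hη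
  have h3 := hB.good.eta_max n t (hM.ball_subset ht) _ (hM.sub_mem t ht ψ hψ _ hη')
  refine ⟨h1.trans_le h3, ?_⟩
  rw [← h2]
  exact Real.log_le_log (by exact_mod_cast h1) (by exact_mod_cast h3)

/-- At `t = ψ` the submodel passes through `(ψ, ηhat_ψ)`, so the lower bound of `le_log_plHat` is
attained. -/
theorem LocalBounds.log_plHat_eq (hB : S.LocalBounds r F δ C n ω) (hM : S.LocalModel δ C)
    (hn : 0 < n) (hψ : ψ ∈ ball S.θ₀ δ) (hη : S.ηhat n ψ ω ∈ ball S.η₀ δ) :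
    Real.log (S.plHat n ω ψ) = n * empMean S.X n (S.ell ψ ψ (S.ηhat n ψ ω)) ω := by
  have hΘ := hM.ball_subset hψ
  rw [← (hB.log_prod hM hn hψ hψ hη).2, hM.sub_diag ψ hΘ _ (S.ηhat_mem n ψ hΘ ω)]
  rfl

/-- The efficient score equation. -/
theorem LocalBounds.score_equation (hB : S.LocalBounds r F δ C n ω) (hM : S.LocalModel δ C)
    (hn : 0 < n) (hθ : S.θhat n ω ∈ ball S.θ₀ δ)
    (hη : S.ηhat n (S.θhat n ω) ω ∈ ball S.η₀ δ) (i : Fin d) :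
    empMean S.X n (S.ellT i (S.θhat n ω) (S.θhat n ω) (S.ηhat n (S.θhat n ω) ω)) ω = 0 := by
  set θ := S.θhat n ω with hθdef
  have hη' : S.ηhat n θ ω ∈ S.H ∩ ball S.η₀ δ := ⟨S.ηhat_mem n θ (hM.ball_subset hθ) ω, hη⟩
  -- The submodel through `(θhat, ηhat_θhat)` stays below the profile likelihood, touches it at
  -- `θhat`, and the profile likelihood is maximal there.
  have hmax : IsLocalMax
      (fun t => ∑ k ∈ Finset.range n, S.ell t θ (S.ηhat n θ ω) (S.X k ω)) θ := by
    have hn' : (n : ℝ) ≠ 0 := by positivity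
    have hsum : ∀ t, ∑ k ∈ Finset.range n, S.ell t θ (S.ηhat n θ ω) (S.X k ω) =
        n * empMean S.X n (S.ell t θ (S.ηhat n θ ω)) ω := fun t => by
      rw [empMean, mul_div_cancel₀ _ hn']
    filter_upwards [isOpen_ball.mem_nhds hθ] with t ht
    rw [hsum, hsum, ← hB.log_plHat_eq hM hn hθ hη]
    obtain ⟨h1, h2⟩ := hB.le_log_plHat hM hn ht hθ hη
    refine h2.trans (Real.log_le_log (by exact_mod_cast h1) ?_)
    exact_mod_cast hB.good.theta_max n t (hM.ball_subset ht)
  have hder : HasFDerivAt (fun t => ∑ k ∈ Finset.range n, S.ell t θ (S.ηhat n θ ω) (S.X k ω))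
      (∑ k ∈ Finset.range n, fderiv ℝ (fun t => S.ell t θ (S.ηhat n θ ω) (S.X k ω)) θ) θ :=
    HasFDerivAt.fun_sum fun k _ =>
      ((hB.smooth k θ hθ θ hθ _ hη').2.1.differentiableAt (by norm_num)).hasFDerivAt
  have h0 := hmax.hasFDerivAt_eq_zero hder
  have h1 := congrArg (fun A : Vec d →L[ℝ] ℝ => A (unitVec i)) h0
  simp only [sum_apply, zero_apply] at h1
  rw [empMean]
  simp_rw [ellT_eq_fderiv, h1, zero_div]

end Expansion

end Experiment

/-! ### Root-`n` consistency and the quadratic expansion of the profile likelihood. -/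

namespace Experiment

variable {d : ℕ} {𝒳 B Ω : Type*} [MeasurableSpace 𝒳] [SeminormedAddCommGroup B]
  [MeasurableSpace Ω] {S : Experiment d 𝒳 B Ω}

section Expansion

variable {r δ C : ℝ} {F : 𝒳 → ℝ} {n : ℕ} {ω : Ω} {ψ θ : Vec d}

/-- The radius `δ / (4 * C)` makes the rate bound for `ηhat` at most `δ / 2`, so that all local
expansions apply at `ηhat_ψ`. -/
theorem LocalBounds.etaHat_mem_ball (hB : S.LocalBounds r F δ C n ω) (hM : S.LocalModel δ C)
    (hn : 0 < n) (hψ : ‖ψ - S.θ₀‖ < δ / (4 * C)) (he : remRate r n < δ / (4 * C)) :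
    ψ ∈ ball S.θ₀ δ ∧ S.ηhat n ψ ω ∈ ball S.η₀ δ := by
  have hC := hM.one_le
  have hδ := hM.pos
  have h0 : ψ ∈ ball S.θ₀ δ := by
    rw [mem_ball, dist_eq_norm]
    refine hψ.trans_le (div_le_self hδ.le (by linarith))
  refine ⟨h0, ?_⟩
  rw [mem_ball, dist_eq_norm]
  refine (hB.norm_etaHat_sub_le hM hn h0).trans_lt ?_
  calc C * (‖ψ - S.θ₀‖ + remRate r n) ≤ C * (δ / (4 * C) + δ / (4 * C)) := by gcongr
    _ = δ / 2 := by field_simp; norm_num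
    _ < δ := by linarith

/-- The maximum likelihood estimator is `√n`-consistent, with a linear expansion. -/
theorem LocalBounds.thetaHat_bound (hr : 1 / 4 < r) (hM : S.LocalModel δ C) {C₁ : ℝ}
    (hC₁ : C₁ = C * (d + 1) + 2 * d * (C + C ^ 2) + (2 * C + C ^ 3))
    (hB : S.LocalBounds r F δ C n ω) (hn : 0 < n) (he : remRate r n < δ / (4 * C))
    (hθ : ‖S.θhat n ω - S.θ₀‖ < δ / (4 * C))
    (hθ' : ‖S.θhat n ω - S.θ₀‖ < 1 / (16 * (C * d * C₁ + 1))) :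
    ‖S.θhat n ω - S.θ₀‖ ≤ 2 * (C ^ 2 * d + 2 * (C * d * C₁)) * (√(n : ℝ))⁻¹ ∧
    ∀ i, |empMean S.X n (S.ellT i S.θ₀ S.θ₀ S.η₀) ω -
      ∑ j, (S.θhat n ω - S.θ₀) j * S.effInfo j i| ≤
        C₁ * (remRate r n + 2 * ‖S.θhat n ω - S.θ₀‖) ^ 2 := by
  have hC := hM.one_le
  have hd : (0 : ℝ) ≤ d := Nat.cast_nonneg d
  have hC₁0 : 0 ≤ C₁ := by rw [hC₁]; positivity
  obtain ⟨hmem, hη⟩ := hB.etaHat_mem_ball hM hn hθ he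
  have hlin : ∀ i, |empMean S.X n (S.ellT i S.θ₀ S.θ₀ S.η₀) ω -
      ∑ j, (S.θhat n ω - S.θ₀) j * S.effInfo j i| ≤
        C₁ * (remRate r n + 2 * ‖S.θhat n ω - S.θ₀‖) ^ 2 := by
    intro i
    -- Taken at `t = ψ = θhat`, where the mean score is zero.
    have h1 := hB.empMean_ellT hM hn hmem hmem hη i
    rw [hB.score_equation hM hn hmem hη i, ← hC₁, add_assoc, ← two_mul, zero_sub] at h1
    rwa [← abs_neg, neg_sub, sub_eq_neg_add]
  refine ⟨?_, hlin⟩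
  have hs : remRate r n ^ 2 ≤ (√(n : ℝ))⁻¹ := remRate_sq_le_inv_sqrt hr hn
  generalize ha_def : ‖S.θhat n ω - S.θ₀‖ = a at *
  generalize he_def : remRate r n = e at *
  generalize hs_def : (√(n : ℝ))⁻¹ = s at *
  have ha : 0 ≤ a := ha_def ▸ norm_nonneg _
  have hs0 : 0 ≤ s := (sq_nonneg e).trans hs
  have h1 : ∀ i ∈ Finset.univ, |∑ j, (S.θhat n ω - S.θ₀) j * S.effInfo j i| ≤
      C * s + C₁ * (2 * s + 8 * a ^ 2) := by
    intro i _
    have h2 := hB.score i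
    rw [hs_def] at h2
    have h4 : (e + 2 * a) ^ 2 ≤ 2 * s + 8 * a ^ 2 := by nlinarith [sq_nonneg (e - 2 * a)]
    have h5 := (hlin i).trans (mul_le_mul_of_nonneg_left h4 hC₁0)
    rw [abs_le] at h2 h5 ⊢
    constructor <;> linarith [h2.1, h2.2, h5.1, h5.2]
  have h2 := hM.norm_le (S.θhat n ω - S.θ₀)
  rw [ha_def] at h2
  have h3 : a ≤ C * (d * (C * s + C₁ * (2 * s + 8 * a ^ 2))) := by
    refine h2.trans (mul_le_mul_of_nonneg_left ?_ (by linarith))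
    refine (Finset.sum_le_card_nsmul _ _ _ h1).trans ?_
    rw [Finset.card_univ, Fintype.card_fin, nsmul_eq_mul]
  have hD : 0 ≤ C * d * C₁ := by positivity
  generalize hD_def : C * d * C₁ = D at *
  -- The preliminary smallness of `a` allows the quadratic term `8 * D * a * a` to be absorbed into
  -- the left side as `a / 2`; this produces the factor `2` in the bound.
  have h4 : 8 * D * a ≤ 1 / 2 := by
    rw [lt_div_iff₀ (by positivity)] at hθ'
    nlinarith
  have h5 : C * (d * (C * s + C₁ * (2 * s + 8 * a ^ 2))) =
      C ^ 2 * d * s + 2 * D * s + 8 * D * a * a := by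
    rw [← hD_def]
    ring
  nlinarith [mul_le_mul_of_nonneg_right h4 ha]

/-- The quadratic expansion of the log likelihoods of the submodels at the maximum likelihood
estimator. -/
theorem LocalBounds.empMean_ell_thetaHat (hM : S.LocalModel δ C) {C₁ C₂ : ℝ}
    (hC₁ : C₁ = C * (d + 1) + 2 * d * (C + C ^ 2) + (2 * C + C ^ 3)) (hC₂ : 0 ≤ C₂)
    (hB : S.LocalBounds r F δ C n ω) (hn : 0 < n)
    (hθh : S.θhat n ω ∈ ball S.θ₀ δ) (hθ : θ ∈ ball S.θ₀ δ) (hψ : ψ ∈ ball S.θ₀ δ)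
    (hη : S.ηhat n ψ ω ∈ ball S.η₀ δ)
    (hbound : ‖S.θhat n ω - S.θ₀‖ ≤ C₂ * remRate r n)
    (hlin : ∀ i, |empMean S.X n (S.ellT i S.θ₀ S.θ₀ S.η₀) ω -
      ∑ j, (S.θhat n ω - S.θ₀) j * S.effInfo j i| ≤
        C₁ * (remRate r n + 2 * ‖S.θhat n ω - S.θ₀‖) ^ 2)
    (hψθ : ‖ψ - S.θhat n ω‖ ≤ ‖θ - S.θhat n ω‖) :
    |empMean S.X n (S.ell θ ψ (S.ηhat n ψ ω)) ω -
      empMean S.X n (S.ell (S.θhat n ω) ψ (S.ηhat n ψ ω)) ω +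
      1 / 2 * ∑ i, ∑ j, (θ - S.θhat n ω) i * (θ - S.θhat n ω) j * S.effInfo i j| ≤
    (2 * d * C₁ * (1 + 2 * C₂) ^ 2 + d ^ 2 * (2 * C + C ^ 2) * (1 + 2 * C₂) + C) *
      (‖θ - S.θhat n ω‖ * (remRate r n + ‖θ - S.θhat n ω‖) ^ 2) := by
  have hC := hM.one_le
  have hd : (0 : ℝ) ≤ d := Nat.cast_nonneg d
  have hC₁0 : 0 ≤ C₁ := by rw [hC₁]; positivity
  have he := (remRate_pos (r := r) hn).le
  have hh := norm_nonneg (θ - S.θhat n ω)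
  have hT0 := fun i => hB.empMean_ellT hM hn hθh hψ hη i
  have hTT0 := fun i j => hB.empMean_ellTT_near hM hn hθh hψ hη i j
  have hell := hB.empMean_ell hM hθh hθ hψ hη
  rw [← hC₁] at hT0
  have hψ0 : ‖ψ - S.θ₀‖ ≤ ‖θ - S.θhat n ω‖ + C₂ * remRate r n := by
    calc ‖ψ - S.θ₀‖ = ‖(ψ - S.θhat n ω) + (S.θhat n ω - S.θ₀)‖ := by congr 1; abel
      _ ≤ ‖ψ - S.θhat n ω‖ + ‖S.θhat n ω - S.θ₀‖ := norm_add_le _ _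
      _ ≤ _ := add_le_add hψθ hbound
  have hm : remRate r n + ‖S.θhat n ω - S.θ₀‖ + ‖ψ - S.θ₀‖ ≤
      (1 + 2 * C₂) * (remRate r n + ‖θ - S.θhat n ω‖) := by
    nlinarith [mul_nonneg hC₂ hh]
  have hm' : remRate r n + 2 * ‖S.θhat n ω - S.θ₀‖ ≤
      (1 + 2 * C₂) * (remRate r n + ‖θ - S.θhat n ω‖) := by
    nlinarith [mul_nonneg hC₂ hh]
  -- Both expansions contain the same mean efficient score and the same linear term in `θhat - θ₀`.
  -- These cancel and only second order errors remain.
  have hT : ∀ i, |empMean S.X n (S.ellT i (S.θhat n ω) ψ (S.ηhat n ψ ω)) ω| ≤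
      2 * C₁ * ((1 + 2 * C₂) * (remRate r n + ‖θ - S.θhat n ω‖)) ^ 2 := by
    intro i
    have h1 := (hT0 i).trans (mul_le_mul_of_nonneg_left
      (pow_le_pow_left₀ (by positivity) hm 2) hC₁0)
    have h2 := (hlin i).trans (mul_le_mul_of_nonneg_left
      (pow_le_pow_left₀ (by positivity) hm' 2) hC₁0)
    rw [abs_le] at h1 h2 ⊢
    constructor <;> linarith [h1.1, h1.2, h2.1, h2.2]
  have hTT : ∀ i j, |empMean S.X n (S.ellTT i j (S.θhat n ω) ψ (S.ηhat n ψ ω)) ω +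
      S.effInfo i j| ≤ (2 * C + C ^ 2) * ((1 + 2 * C₂) * (remRate r n + ‖θ - S.θhat n ω‖)) :=
    fun i j => (hTT0 i j).trans (mul_le_mul_of_nonneg_left hm (by positivity))
  have h1 := abs_sum_mul_le (θ - S.θhat n ω) hT
  have h2 := abs_sum_sum_mul_le (θ - S.θhat n ω) hTT
  simp only [mul_add ((θ - S.θhat n ω) _ * (θ - S.θhat n ω) _), Finset.sum_add_distrib] at h2
  have key : ∀ e h : ℝ, 0 ≤ e → 0 ≤ h →
      d * (h * (2 * C₁ * ((1 + 2 * C₂) * (e + h)) ^ 2)) +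
        1 / 2 * (d * (h * (d * (h * ((2 * C + C ^ 2) * ((1 + 2 * C₂) * (e + h))))))) +
        C * h ^ 3 ≤
      (2 * d * C₁ * (1 + 2 * C₂) ^ 2 + d ^ 2 * (2 * C + C ^ 2) * (1 + 2 * C₂) + C) *
        (h * (e + h) ^ 2) := by
    intro e h he hh
    have k1 : d * (h * (d * (h * ((2 * C + C ^ 2) * ((1 + 2 * C₂) * (e + h)))))) ≤
        d * ((e + h) * (d * (h * ((2 * C + C ^ 2) * ((1 + 2 * C₂) * (e + h)))))) := by
      gcongr
      linarith
    have k2 : C * (h * h ^ 2) ≤ C * (h * (e + h) ^ 2) := by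
      gcongr
      linarith
    have k3 : 0 ≤ d * (h * (d * (h * ((2 * C + C ^ 2) * ((1 + 2 * C₂) * (e + h)))))) := by
      positivity
    linarith
  have h3 := key _ _ he hh
  rw [abs_le] at h1 h2 hell ⊢
  constructor <;> linarith [h1.1, h1.2, h2.1, h2.2, hell.1, hell.2]

/-- The local quadratic expansion of the profile likelihood at the maximum likelihood estimator. -/
theorem LocalModel.exists_expansion (hr : 1 / 4 < r) (hM : S.LocalModel δ C) (F : 𝒳 → ℝ) :
    ∃ K δ' e₀ : ℝ, 0 < K ∧ 0 < δ' ∧ δ' ≤ δ ∧ 0 < e₀ ∧ ∀ n : ℕ, 0 < n → remRate r n < e₀ →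
      ∀ ω, S.LocalBounds r F δ C n ω → ‖S.θhat n ω - S.θ₀‖ < δ' →
        ‖S.θhat n ω - S.θ₀‖ ≤ K * (√(n : ℝ))⁻¹ ∧
        ∀ θ ∈ ball S.θ₀ δ', 0 < S.plHat n ω θ ∧
          |Real.log (S.plHat n ω θ) - Real.log (S.plHat n ω (S.θhat n ω)) +
            n / 2 * ∑ i, ∑ j, (θ - S.θhat n ω) i * (θ - S.θhat n ω) j * S.effInfo i j| ≤
          K * (n * (‖θ - S.θhat n ω‖ * (remRate r n + ‖θ - S.θhat n ω‖) ^ 2)) := by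
  have hC := hM.one_le
  have hδ := hM.pos
  have hd : (0 : ℝ) ≤ d := Nat.cast_nonneg d
  obtain ⟨C₁, hC₁⟩ : ∃ C₁ : ℝ, C₁ = C * (d + 1) + 2 * d * (C + C ^ 2) + (2 * C + C ^ 3) := ⟨_, rfl⟩
  have hC₁0 : 0 ≤ C₁ := by rw [hC₁]; positivity
  obtain ⟨C₂, hC₂⟩ : ∃ C₂ : ℝ, C₂ = 2 * (C ^ 2 * d + 2 * (C * d * C₁)) := ⟨_, rfl⟩
  have hC₂0 : 0 ≤ C₂ := by rw [hC₂]; positivity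
  obtain ⟨C₃, hC₃⟩ : ∃ C₃ : ℝ, C₃ = 2 * d * C₁ * (1 + 2 * C₂) ^ 2 +
    d ^ 2 * (2 * C + C ^ 2) * (1 + 2 * C₂) + C := ⟨_, rfl⟩
  have hC₃0 : 0 < C₃ := by rw [hC₃]; positivity
  refine ⟨C₂ + C₃, min (δ / (4 * C)) (1 / (16 * (C * d * C₁ + 1))), δ / (4 * C), by positivity,
    by positivity, (min_le_left _ _).trans (div_le_self hδ.le (by linarith)), by positivity,
    fun n hn he ω hB hθh => ?_⟩
  obtain ⟨hbound, hlin⟩ := hB.thetaHat_bound hr hM hC₁ hn he (hθh.trans_le (min_le_left _ _))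
    (hθh.trans_le (min_le_right _ _))
  rw [← hC₂] at hbound
  have hbound' : ‖S.θhat n ω - S.θ₀‖ ≤ C₂ * remRate r n :=
    hbound.trans (mul_le_mul_of_nonneg_left (inv_sqrt_le_remRate hn) hC₂0)
  obtain ⟨hθhm, hηh⟩ := hB.etaHat_mem_ball hM hn (hθh.trans_le (min_le_left _ _)) he
  refine ⟨hbound.trans (mul_le_mul_of_nonneg_right (by linarith) (by positivity)),
    fun θ hθ => ?_⟩
  rw [mem_ball, dist_eq_norm] at hθ
  obtain ⟨hθm, hη⟩ := hB.etaHat_mem_ball hM hn (hθ.trans_le (min_le_left _ _)) he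
  -- The sandwich: the submodel through `θhat`, evaluated at `θ`, gives the lower bound; the
  -- submodel through `θ`, evaluated at `θhat`, gives the upper bound.
  obtain ⟨hpos, hlow⟩ := hB.le_log_plHat hM hn hθm hθhm hηh
  obtain ⟨-, hup⟩ := hB.le_log_plHat hM hn hθhm hθm hη
  have heq := hB.log_plHat_eq hM hn hθm hη
  have heqh := hB.log_plHat_eq hM hn hθhm hηh
  refine ⟨hpos, ?_⟩
  have h1 := hB.empMean_ell_thetaHat hM hC₁ hC₂0 hn hθhm hθm hθhm hηh hbound' hlin
    (by simp)
  have h2 := hB.empMean_ell_thetaHat hM hC₁ hC₂0 hn hθhm hθm hθm hη hbound' hlin le_rfl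
  rw [← hC₃] at h1 h2
  have hn0 : (0 : ℝ) < n := by exact_mod_cast hn
  have hmono : C₃ * (‖θ - S.θhat n ω‖ * (remRate r n + ‖θ - S.θhat n ω‖) ^ 2) ≤
      (C₂ + C₃) * (‖θ - S.θhat n ω‖ * (remRate r n + ‖θ - S.θhat n ω‖) ^ 2) :=
    mul_le_mul_of_nonneg_right (by linarith) (by positivity)
  rw [abs_le] at h1 h2 ⊢
  have h1' := mul_le_mul_of_nonneg_left (h1.1.trans' (neg_le_neg hmono)) hn0.le
  have h2' := mul_le_mul_of_nonneg_left (h2.2.trans hmono) hn0.le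
  constructor <;> nlinarith

end Expansion

end Experiment

namespace Experiment

variable {d : ℕ} {𝒳 B Ω : Type*} [MeasurableSpace 𝒳] [SeminormedAddCommGroup B]
  [MeasurableSpace Ω] {S : Experiment d 𝒳 B Ω}

/-! ### The standardization -/

theorem sqrtInfo_mul_self (hI : S.effInfo.PosDef) : S.sqrtInfo * S.sqrtInfo = S.effInfo :=
  CFC.sqrt_mul_sqrt_self S.effInfo hI.posSemidef.nonneg

theorem isUnit_det_sqrtInfo (hI : S.effInfo.PosDef) : IsUnit S.sqrtInfo.det := by
  refine isUnit_iff_ne_zero.mpr fun h0 => hI.det_pos.ne' ?_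
  rw [← sqrtInfo_mul_self hI, Matrix.det_mul, h0, zero_mul]

theorem transpose_sqrtInfo : S.sqrtInfo.transpose = S.sqrtInfo := by
  have h : S.sqrtInfo.PosSemidef := Matrix.nonneg_iff_posSemidef.mp (CFC.sqrt_nonneg _)
  have := h.isHermitian
  rwa [Matrix.IsHermitian, Matrix.conjTranspose_eq_transpose_of_trivial] at this

theorem norm_sq_sqrtInfo (hI : S.effInfo.PosDef) (v : Vec d) :
    ‖Matrix.toEuclideanLin S.sqrtInfo v‖ ^ 2 = ∑ i, ∑ j, v i * v j * S.effInfo i j := by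
  have h1 : ‖Matrix.toEuclideanLin S.sqrtInfo v‖ ^ 2 =
      (S.sqrtInfo.mulVec v.ofLp) ⬝ᵥ (S.sqrtInfo.mulVec v.ofLp) := by
    rw [EuclideanSpace.real_norm_sq_eq]
    simp [dotProduct, sq, Matrix.toLpLin_apply]
  rw [h1, Matrix.dotProduct_mulVec, ← Matrix.mulVec_transpose, Matrix.mulVec_mulVec,
    transpose_sqrtInfo, sqrtInfo_mul_self hI]
  simp only [dotProduct, Matrix.mulVec, Finset.sum_mul]
  rw [Finset.sum_comm]
  refine Finset.sum_congr rfl fun i _ => Finset.sum_congr rfl fun j _ => ?_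
  have : S.effInfo j i = S.effInfo i j := by
    have h2 := hI.isHermitian.apply i j
    simpa using h2
  rw [this]
  ring

theorem sqrtInfo_inv_apply (hI : S.effInfo.PosDef) (v : Vec d) :
    Matrix.toEuclideanLin S.sqrtInfo (Matrix.toEuclideanLin S.sqrtInfo⁻¹ v) = v := by
  simp [Matrix.toLpLin_apply, Matrix.mulVec_mulVec,
    Matrix.mul_nonsing_inv _ (isUnit_det_sqrtInfo hI)]

theorem exists_norm_sqrtInfo_inv_le :
    ∃ κ : ℝ, 1 ≤ κ ∧ ∀ v, ‖Matrix.toEuclideanLin S.sqrtInfo⁻¹ v‖ ≤ κ * ‖v‖ := by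
  set A := LinearMap.toContinuousLinearMap (Matrix.toEuclideanLin S.sqrtInfo⁻¹) with hA
  exact ⟨max 1 ‖A‖, le_max_left _ _, fun v =>
    (A.le_opNorm v).trans (mul_le_mul_of_nonneg_right (le_max_right _ _) (norm_nonneg _))⟩

/-- The efficient information is bounded below. -/
theorem exists_norm_le_effInfo (hI : S.effInfo.PosDef) :
    ∃ C : ℝ, 0 ≤ C ∧ ∀ v : Vec d, ‖v‖ ≤ C * ∑ i, |∑ j, v j * S.effInfo j i| := by
  set A := LinearMap.toContinuousLinearMap (Matrix.toEuclideanLin S.effInfo⁻¹) with hA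
  refine ⟨‖A‖, norm_nonneg _, fun v => ?_⟩
  have hU : IsUnit S.effInfo.det := isUnit_iff_ne_zero.mpr hI.det_pos.ne'
  have h1 : A (Matrix.toEuclideanLin S.effInfo v) = v := by
    simp [hA, Matrix.toLpLin_apply, Matrix.mulVec_mulVec, Matrix.nonsing_inv_mul _ hU]
  have h2 : ∀ i, (Matrix.toEuclideanLin S.effInfo v) i = ∑ j, v j * S.effInfo j i := fun i => by
    simp only [Matrix.toLpLin_apply, Matrix.mulVec, dotProduct]
    refine Finset.sum_congr rfl fun j _ => ?_
    have h2 := hI.isHermitian.apply i j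
    simp only [star_trivial] at h2
    rw [h2, mul_comm]
  conv_lhs => rw [← h1]
  refine (A.le_opNorm _).trans (mul_le_mul_of_nonneg_left ?_ (norm_nonneg _))
  refine (norm_le_sum_abs _).trans (le_of_eq ?_)
  simp only [h2]

/-- The Jacobian of the standardization. -/
def jacobian (S : Experiment d 𝒳 B Ω) (n : ℕ) : ℝ := |√(n : ℝ) ^ d * S.sqrtInfo.det|

theorem jacobian_pos (hI : S.effInfo.PosDef) {n : ℕ} (hn : 0 < n) : 0 < S.jacobian n := by
  have h1 : √(n : ℝ) ≠ 0 := by positivity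
  exact abs_pos.mpr (mul_ne_zero (pow_ne_zero _ h1) (isUnit_det_sqrtInfo hI).ne_zero)

theorem measurable_unstandardize (n : ℕ) (ω : Ω) : Measurable (S.unstandardize n ω) := by
  have hc := LinearMap.continuous_of_finiteDimensional (Matrix.toEuclideanLin S.sqrtInfo⁻¹)
  unfold unstandardize
  exact Continuous.measurable (by fun_prop)

theorem map_unstandardize (hI : S.effInfo.PosDef) {n : ℕ} (hn : 0 < n) (ω : Ω) :
    (volume : Measure (Vec d)).map (S.unstandardize n ω) =
      ENNReal.ofReal (S.jacobian n) • volume := by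
  have hn0 : √(n : ℝ) ≠ 0 := by positivity
  have hc : S.unstandardize n ω = (fun θ => S.θhat n ω + θ) ∘
      (⇑((√(n : ℝ))⁻¹ • Matrix.toEuclideanLin S.sqrtInfo⁻¹)) := by
    ext1 θ
    simp [unstandardize]
  have hd : LinearMap.det ((√(n : ℝ))⁻¹ • Matrix.toEuclideanLin S.sqrtInfo⁻¹) =
      (√(n : ℝ) ^ d * S.sqrtInfo.det)⁻¹ := by
    rw [LinearMap.det_smul]
    simp [Matrix.toEuclideanLin_eq_toLin_orthonormal, Matrix.det_nonsing_inv, mul_comm]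
  have hmL : Measurable (⇑((√(n : ℝ))⁻¹ • Matrix.toEuclideanLin S.sqrtInfo⁻¹)) :=
    (LinearMap.continuous_of_finiteDimensional _).measurable
  have hne : √(n : ℝ) ^ d * S.sqrtInfo.det ≠ 0 :=
    mul_ne_zero (pow_ne_zero _ hn0) (isUnit_det_sqrtInfo hI).ne_zero
  rw [hc, ← Measure.map_map (by fun_prop) hmL,
    Measure.map_linearMap_addHaar_eq_smul_addHaar volume (by rw [hd]; exact inv_ne_zero hne), hd,
    Measure.map_smul, (measurePreserving_add_left volume (S.θhat n ω)).map_eq, inv_inv]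
  rfl

theorem measurableEmbedding_unstandardize (hI : S.effInfo.PosDef) {n : ℕ} (hn : 0 < n) (ω : Ω) :
    MeasurableEmbedding (S.unstandardize n ω) := by
  have hn0 : √(n : ℝ) ≠ 0 := by positivity
  refine (measurable_unstandardize n ω).measurableEmbedding fun u v huv => ?_
  have h1 : Matrix.toEuclideanLin S.sqrtInfo⁻¹ u = Matrix.toEuclideanLin S.sqrtInfo⁻¹ v := by
    have := add_left_cancel huv
    exact smul_right_injective _ (inv_ne_zero hn0) this
  rw [← sqrtInfo_inv_apply hI u, h1, sqrtInfo_inv_apply hI v]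

theorem lintegral_comp_unstandardize (hI : S.effInfo.PosDef) {n : ℕ} (hn : 0 < n) (ω : Ω)
    (w : Vec d → ℝ≥0∞) :
    ∫⁻ u, w (S.unstandardize n ω u) = ENNReal.ofReal (S.jacobian n) * ∫⁻ θ, w θ := by
  rw [← (measurableEmbedding_unstandardize hI hn ω).lintegral_map, map_unstandardize hI hn,
    lintegral_smul_measure, smul_eq_mul]

theorem integrable_comp_unstandardize (hI : S.effInfo.PosDef) {n : ℕ} (hn : 0 < n) (ω : Ω)
    {g : Vec d → ℝ} (hg : Integrable g) :
    Integrable (fun u => g (S.unstandardize n ω u)) ∧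
      ∫ u, g (S.unstandardize n ω u) = S.jacobian n * ∫ θ, g θ := by
  have hemb := measurableEmbedding_unstandardize hI hn ω
  constructor
  · refine (hemb.integrable_map_iff (μ := volume) (g := g)).mp ?_
    rw [map_unstandardize hI hn]
    exact hg.smul_measure ENNReal.ofReal_ne_top
  · rw [← hemb.integral_map, map_unstandardize hI hn, integral_smul_measure,
      ENNReal.toReal_ofReal (jacobian_pos hI hn).le, smul_eq_mul]

theorem aestronglyMeasurable_comp_unstandardize (hI : S.effInfo.PosDef) {n : ℕ} (hn : 0 < n)
    (ω : Ω) {g : Vec d → ℝ} (hg : AEStronglyMeasurable g volume) :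
    AEStronglyMeasurable (fun u => g (S.unstandardize n ω u)) volume := by
  refine AEStronglyMeasurable.comp_measurable ?_ (measurable_unstandardize n ω)
  rw [map_unstandardize hI hn]
  exact hg.smul_measure _

/-- The posterior weight relative to the maximal profile likelihood. -/
def relWeight (S : Experiment d 𝒳 B Ω) (ρ : Vec d → ℝ) (n : ℕ) (ω : Ω) : Vec d → ℝ :=
  S.Θ.indicator fun θ => ρ θ * ((S.plHat n ω θ : ℝ) / S.plHat n ω (S.θhat n ω))

theorem relWeight_nonneg {ρ : Vec d → ℝ} (hρ : S.IsPrior ρ) (n : ℕ) (ω : Ω) (θ : Vec d) :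
    0 ≤ S.relWeight ρ n ω θ :=
  indicator_nonneg (fun θ hθ => mul_nonneg (hρ.nonneg θ hθ) (by positivity)) θ

theorem IsGoodSample.postWeight_eq {ρ : Vec d → ℝ} (hρ : S.IsPrior ρ) {ω : Ω}
    (h : S.IsGoodSample ω) (n : ℕ) (θ : Vec d) :
    S.postWeight ρ n ω θ =
      (S.plHat n ω (S.θhat n ω) : ℝ≥0∞) * ENNReal.ofReal (S.relWeight ρ n ω θ) := by
  by_cases hθ : θ ∈ S.Θ
  · rw [postWeight, relWeight, indicator_of_mem hθ, indicator_of_mem hθ, h.profLik_eq n hθ,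
      ENNReal.ofReal_mul (hρ.nonneg θ hθ), mul_left_comm]
    congr 1
    have hp := h.pos n
    rw [← ENNReal.ofReal_coe_nnreal (p := S.plHat n ω (S.θhat n ω)),
      ← ENNReal.ofReal_mul (by positivity), mul_div_cancel₀ _ (by positivity),
      ENNReal.ofReal_coe_nnreal]
  · rw [postWeight, relWeight, indicator_of_notMem hθ, indicator_of_notMem hθ]
    simp

/-- The posterior profile density is a normalized version of the relative weight. -/
theorem IsGoodSample.postDensity_eq {ρ : Vec d → ℝ} (hρ : S.IsPrior ρ) (hI : S.effInfo.PosDef)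
    {ω : Ω} (h : S.IsGoodSample ω) {n : ℕ} (hn : 0 < n)
    (hm : AEStronglyMeasurable (S.relWeight ρ n ω) volume) (ξ : Vec d) :
    S.postDensity ρ n ω ξ = S.relWeight ρ n ω (S.unstandardize n ω ξ) /
      ∫ u, S.relWeight ρ n ω (S.unstandardize n ω u) := by
  have hJ := jacobian_pos hI hn
  have hp : (0 : ℝ) < S.plHat n ω (S.θhat n ω) := by exact_mod_cast h.pos n
  have h1 := lintegral_comp_unstandardize hI hn ω (S.postWeight ρ n ω)
  have h2 : ∫ u, S.relWeight ρ n ω (S.unstandardize n ω u) =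
      (∫⁻ u, ENNReal.ofReal (S.relWeight ρ n ω (S.unstandardize n ω u))).toReal :=
    integral_eq_lintegral_of_nonneg_ae (ae_of_all _ fun u => relWeight_nonneg hρ n ω _)
      (aestronglyMeasurable_comp_unstandardize hI hn ω hm)
  simp_rw [h.postWeight_eq hρ n] at h1
  rw [lintegral_const_mul' _ _ ENNReal.coe_ne_top] at h1
  have h3 := congrArg ENNReal.toReal h1
  rw [ENNReal.toReal_mul, ENNReal.toReal_mul, ← h2, ENNReal.toReal_ofReal hJ.le,
    ENNReal.coe_toReal] at h3
  rw [postDensity, stdPostDensity, ENNReal.toReal_mul, ENNReal.toReal_mul, ENNReal.toReal_inv,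
    abs_inv, ENNReal.toReal_ofReal (by positivity)]
  simp_rw [h.postWeight_eq hρ n]
  rw [ENNReal.toReal_mul, ENNReal.toReal_ofReal (relWeight_nonneg hρ n ω _), ENNReal.coe_toReal]
  change _ * ((S.jacobian n)⁻¹ * _) = _
  set I := (∫⁻ θ, (S.plHat n ω (S.θhat n ω) : ℝ≥0∞) *
    ENNReal.ofReal (S.relWeight ρ n ω θ)).toReal with hIdef
  have h4 : ∫ u, S.relWeight ρ n ω (S.unstandardize n ω u) =
      S.jacobian n * I / S.plHat n ω (S.θhat n ω) := by
    rw [eq_div_iff hp.ne', mul_comm, h3]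
  rw [h4]
  -- This covers both a zero and an infinite normalizing integral, since `toReal` sends `∞` to `0`;
  -- both sides then vanish by convention.
  by_cases hI0 : I = 0
  · simp [hI0]
  · field_simp

theorem aestronglyMeasurable_relWeight {ρ : Vec d → ℝ} (hρ : S.IsPrior ρ) (hΘ : IsCompact S.Θ)
    {ω : Ω} (h : S.IsGoodSample ω) (n : ℕ)
    (hm : AEMeasurable (S.profLik n ω) (volume.restrict S.Θ)) :
    AEStronglyMeasurable (S.relWeight ρ n ω) volume := by
  have hΘm : MeasurableSet S.Θ := hΘ.isClosed.measurableSet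
  rw [relWeight, aestronglyMeasurable_indicator_iff hΘm]
  -- A non-integrable function has Bochner integral zero, so total mass one already contains
  -- integrability and measurability of the prior.
  have hρi : IntegrableOn ρ S.Θ := by
    by_contra hni
    have h1 := hρ.integral_eq_one
    rw [integral_undef hni] at h1
    exact zero_ne_one h1
  refine hρi.1.mul ?_
  have h1 : AEMeasurable (fun θ => (S.profLik n ω θ).toReal / S.plHat n ω (S.θhat n ω))
      (volume.restrict S.Θ) := hm.ennreal_toReal.div_const _
  refine h1.aestronglyMeasurable.congr ?_
  filter_upwards [ae_restrict_mem hΘm] with θ hθ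
  rw [h.profLik_eq n hθ, ENNReal.coe_toReal]

end Experiment

/-! ### Bounds for perturbed normal densities -/

theorem abs_exp_sub_one_le_mul_exp (z : ℝ) : |Real.exp z - 1| ≤ |z| * Real.exp |z| := by
  rcases le_total 0 z with hz | hz
  · rw [abs_of_nonneg hz, abs_of_nonneg (by linarith [Real.one_le_exp hz])]
    have h1 := Real.add_one_le_exp (-z)
    have h2 : Real.exp z * Real.exp (-z) = 1 := by rw [← Real.exp_add]; simp
    nlinarith [Real.exp_pos z]
  · rw [abs_of_nonpos hz, abs_of_nonpos (by linarith [Real.exp_le_one_iff.mpr hz])]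
    have h1 := Real.add_one_le_exp z
    have h2 := Real.one_le_exp (neg_nonneg.mpr hz)
    nlinarith

/-- The first bound on `D` supplies the small factor `A`; the second keeps `exp |D|` from destroying
the Gaussian decay. Completing the square in `-x²/4 + (c + 3)x ≤ (c + 3)²` gives the constant. -/
theorem exp_perturbation_le {x D A c : ℝ} (hx : 0 ≤ x) (hA : 0 ≤ A)
    (h1 : |D| ≤ A * (x * (1 + x) ^ 2)) (h2 : |D| ≤ c * x + x ^ 2 / 8) :
    |Real.exp (-x ^ 2 / 2 + D) - Real.exp (-x ^ 2 / 2)| ≤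
      A * Real.exp ((c + 3) ^ 2) * Real.exp (-x ^ 2 / 8) := by
  have h3 : Real.exp (-x ^ 2 / 2 + D) - Real.exp (-x ^ 2 / 2) =
      Real.exp (-x ^ 2 / 2) * (Real.exp D - 1) := by rw [Real.exp_add]; ring
  rw [h3, abs_mul, abs_of_pos (Real.exp_pos _)]
  have hx1 : 1 + x ≤ Real.exp x := by linarith [Real.add_one_le_exp x]
  have h4 : x * (1 + x) ^ 2 ≤ Real.exp (3 * x) := by
    calc x * (1 + x) ^ 2 ≤ Real.exp x * Real.exp x ^ 2 := by
          gcongr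
          linarith
      _ = Real.exp (3 * x) := by
          rw [← pow_succ', ← Real.exp_nat_mul]
          norm_num
  calc Real.exp (-x ^ 2 / 2) * |Real.exp D - 1|
      ≤ Real.exp (-x ^ 2 / 2) * (|D| * Real.exp |D|) := by
        gcongr
        exact abs_exp_sub_one_le_mul_exp D
    _ ≤ Real.exp (-x ^ 2 / 2) * (A * Real.exp (3 * x) * Real.exp (c * x + x ^ 2 / 8)) := by
        gcongr
        exact h1.trans (by gcongr)
    _ = A * Real.exp (-x ^ 2 / 2 + (3 * x + (c * x + x ^ 2 / 8))) := by
        rw [Real.exp_add (-x ^ 2 / 2), Real.exp_add (3 * x)]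
        ring
    _ ≤ A * Real.exp ((c + 3) ^ 2 + -x ^ 2 / 8) := by
        refine mul_le_mul_of_nonneg_left (Real.exp_le_exp.mpr ?_) hA
        nlinarith [sq_nonneg (x / 2 - (c + 3))]
    _ = _ := by rw [Real.exp_add, mul_assoc]

theorem one_add_mul_exp_le {x : ℝ} :
    (1 + x) * Real.exp (-x ^ 2 / 2) ≤ Real.exp 1 * Real.exp (-x ^ 2 / 8) := by
  calc (1 + x) * Real.exp (-x ^ 2 / 2) ≤ Real.exp x * Real.exp (-x ^ 2 / 2) := by
        gcongr
        linarith [Real.add_one_le_exp x]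
    _ = Real.exp (x + -x ^ 2 / 2) := (Real.exp_add _ _).symm
    _ ≤ _ := by
        rw [← Real.exp_add]
        refine Real.exp_le_exp.mpr ?_
        nlinarith [sq_nonneg (x / 2 - 1)]

theorem integrable_gaussian {d : ℕ} {b : ℝ} (hb : 0 < b) :
    Integrable (fun u : Vec d => Real.exp (-‖u‖ ^ 2 / b)) := by
  have h := GaussianFourier.integrable_cexp_neg_mul_sq_norm_add (V := Vec d)
    (b := ((1 / b : ℝ) : ℂ)) (by simpa using hb) 0 0
  refine h.re.congr (ae_of_all _ fun u => ?_)
  simp only [zero_mul, add_zero]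
  rw [show (-((1 / b : ℝ) : ℂ) * (‖u‖ : ℂ) ^ 2) = ((-‖u‖ ^ 2 / b : ℝ) : ℂ) by push_cast; ring,
    ← Complex.ofReal_exp, RCLike.re_to_complex, Complex.ofReal_re]

theorem integral_gaussian_eq {d : ℕ} :
    ∫ u : Vec d, Real.exp (-‖u‖ ^ 2 / 2) = (2 * Real.pi) ^ ((d : ℝ) / 2) := by
  have h := GaussianFourier.integral_rexp_neg_mul_sq_norm (V := Vec d) (b := 1 / 2) (by norm_num)
  rw [finrank_euclideanSpace_fin] at h
  rw [show Real.pi / (1 / 2) = 2 * Real.pi by ring] at h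
  rw [← h]
  congr 1 with u
  ring_nf

/-- The last hypothesis keeps the perturbed denominator above `D₀ / 2`. -/
theorem abs_div_sub_div_le {a a₀ D D₀ A A' μ : ℝ} (ha₀ : 0 ≤ a₀) (hD₀ : 0 < D₀)
    (ha : |a - a₀| ≤ A * μ) (hD : |D - D₀| ≤ A' * μ) (hμ : A' * μ ≤ D₀ / 2) :
    |a / D - a₀ / D₀| ≤ (2 * A / D₀ + 2 * a₀ * A' / D₀ ^ 2) * μ := by
  have hD' : D₀ / 2 ≤ D := by linarith [(abs_le.mp hD).1]
  have hDpos : 0 < D := by linarith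
  have h1 : a / D - a₀ / D₀ = (a - a₀) / D - a₀ * (D - D₀) / (D * D₀) := by
    field_simp
    ring
  rw [h1]
  refine (abs_sub _ _).trans ?_
  rw [abs_div, abs_div, abs_mul, abs_of_pos hDpos, abs_of_nonneg ha₀,
    abs_of_pos (mul_pos hDpos hD₀)]
  have h2 : |a - a₀| / D ≤ A * μ / (D₀ / 2) := by
    have := (abs_nonneg _).trans ha
    gcongr
  have h3 : a₀ * |D - D₀| / (D * D₀) ≤ a₀ * (A' * μ) / (D₀ / 2 * D₀) := by
    have := (abs_nonneg _).trans hD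
    gcongr
  refine (add_le_add h2 h3).trans (le_of_eq ?_)
  field_simp

theorem tendsto_inv_sqrt : Tendsto (fun n : ℕ => (√(n : ℝ))⁻¹) atTop (𝓝 0) :=
  tendsto_inv_atTop_zero.comp (Real.tendsto_sqrt_atTop.comp tendsto_natCast_atTop_atTop)

theorem tendsto_rateM {r : ℝ} (hr : 1 / 4 < r) : Tendsto (rateM r) atTop (𝓝 0) := by
  have h1 := (tendsto_rpow_neg_atTop (y := 1 / 2) (by norm_num)).comp tendsto_natCast_atTop_atTop
  have h2 := (tendsto_rpow_neg_atTop (y := 2 * r - 1 / 2) (by linarith)).comp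
    tendsto_natCast_atTop_atTop
  have h3 := h1.add h2
  rw [add_zero] at h3
  refine h3.congr fun n => ?_
  simp only [Function.comp_apply, rateM]
  ring_nf

theorem inv_sqrt_le_rateM {r : ℝ} {n : ℕ} : (√(n : ℝ))⁻¹ ≤ rateM r n := by
  rw [rateM, inv_sqrt_eq_rpow]
  exact le_add_of_nonneg_right (Real.rpow_nonneg (Nat.cast_nonneg n) _)

/-! ### The posterior weight near the truth and far from it. -/

namespace Experiment

variable {d : ℕ} {𝒳 B Ω : Type*} [MeasurableSpace 𝒳] [SeminormedAddCommGroup B]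
  [MeasurableSpace Ω] {S : Experiment d 𝒳 B Ω}

/-- In standardized coordinates the prior has total mass equal to the Jacobian, of order `n^{d/2}`;
the exponential smallness of the far likelihood absorbs it. -/
theorem eventually_exp_neg_mul_jacobian_le (c : ℝ) (hc : 0 < c) :
    ∀ᶠ n : ℕ in atTop, Real.exp (-(n * c)) * S.jacobian n ≤ (√(n : ℝ))⁻¹ := by
  have h1 : Tendsto (fun n : ℕ => (c * n) ^ (d + 1) * Real.exp (-(c * n))) atTop (𝓝 0) :=
    (Real.tendsto_pow_mul_exp_neg_atTop_nhds_zero (d + 1)).comp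
      (tendsto_natCast_atTop_atTop.const_mul_atTop hc)
  have h2 := h1.const_mul (|S.sqrtInfo.det| / c ^ (d + 1))
  rw [mul_zero] at h2
  filter_upwards [h2.eventually_le_const (by norm_num : (0 : ℝ) < 1), eventually_gt_atTop 0]
    with n hn hn0
  have hn1 : (1 : ℝ) ≤ n := by exact_mod_cast hn0
  have hs : 0 < √(n : ℝ) := by positivity
  have hsn : √(n : ℝ) ≤ n := by
    rw [Real.sqrt_le_left (by positivity)]
    nlinarith
  rw [← one_div, le_div_iff₀ hs]
  refine le_trans ?_ hn
  have h3 : S.jacobian n * √(n : ℝ) ≤ (n : ℝ) ^ (d + 1) * |S.sqrtInfo.det| := by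
    rw [jacobian, abs_mul, abs_of_nonneg (by positivity : 0 ≤ √(n : ℝ) ^ d), mul_right_comm,
      ← pow_succ]
    gcongr
  rw [mul_assoc]
  calc _ ≤ Real.exp (-(n * c)) * ((n : ℝ) ^ (d + 1) * |S.sqrtInfo.det|) := by gcongr
    _ = _ := by
      rw [mul_pow, mul_comm c (n : ℝ)]
      field_simp

theorem IsGoodSample.plHat_le_of_profDelta_le {ω : Ω} (h : S.IsGoodSample ω) {n : ℕ} (hn : 0 < n)
    {θ : Vec d} (hθ : θ ∈ S.Θ) {c : ℝ} (hc : S.profDelta n ω θ ≤ ((-c : ℝ) : EReal)) :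
    (S.plHat n ω θ : ℝ) / S.plHat n ω (S.θhat n ω) ≤ Real.exp (-(n * c)) := by
  have hp := h.pos n
  rcases eq_or_ne (S.plHat n ω θ) 0 with h0 | h0
  · rw [h0, NNReal.coe_zero, zero_div]
    positivity
  have hlog : ∀ a : ℝ≥0, a ≠ 0 → ENNReal.log (a : ℝ≥0∞) = ((Real.log a : ℝ) : EReal) := by
    intro a ha
    rw [ENNReal.log_pos_real (by simpa using ha) ENNReal.coe_ne_top, ENNReal.coe_toReal]
  rw [profDelta, h.profLik_eq n hθ, h.profLik_eq n (S.θhat_mem n ω), hlog _ h0, hlog _ hp.ne',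
    ← EReal.coe_sub, ← EReal.coe_mul, EReal.coe_le_coe_iff] at hc
  have hn0 : (0 : ℝ) < n := by exact_mod_cast hn
  have hpos : (0 : ℝ) < S.plHat n ω θ := by exact_mod_cast pos_iff_ne_zero.mpr h0
  have hpos' : (0 : ℝ) < S.plHat n ω (S.θhat n ω) := by exact_mod_cast hp
  rw [← Real.log_le_iff_le_exp (div_pos hpos hpos'), Real.log_div hpos.ne' hpos'.ne']
  rw [inv_mul_le_iff₀ hn0] at hc
  linarith

theorem IsPrior.exists_lipschitz {ρ : Vec d → ℝ} (hρ : S.IsPrior ρ) :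
    ∃ R δ : ℝ, 0 ≤ R ∧ 0 < δ ∧ ∀ θ ∈ ball S.θ₀ δ, |ρ θ - ρ S.θ₀| ≤ R * ‖θ - S.θ₀‖ := by
  obtain ⟨R, t, ht, hR⟩ := ContDiffAt.exists_lipschitzOnWith hρ.smooth
  obtain ⟨δ, hδ, hball⟩ := Metric.mem_nhds_iff.mp ht
  refine ⟨R, δ, R.2, hδ, fun θ hθ => ?_⟩
  have h1 := hR.dist_le_mul θ (hball hθ) S.θ₀ (hball (mem_ball_self hδ))
  rwa [Real.dist_eq, dist_eq_norm] at h1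

theorem unstandardize_sub_thetaHat (n : ℕ) (ω : Ω) (u : Vec d) :
    S.unstandardize n ω u - S.θhat n ω =
      (√(n : ℝ))⁻¹ • Matrix.toEuclideanLin S.sqrtInfo⁻¹ u := by
  simp [unstandardize]

theorem information_unstandardize (hI : S.effInfo.PosDef) {n : ℕ} (hn : 0 < n) (ω : Ω)
    (u : Vec d) :
    n / 2 * ∑ i, ∑ j, (S.unstandardize n ω u - S.θhat n ω) i *
      (S.unstandardize n ω u - S.θhat n ω) j * S.effInfo i j = ‖u‖ ^ 2 / 2 := by
  have hn0 : (0 : ℝ) < n := by exact_mod_cast hn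
  rw [← norm_sq_sqrtInfo hI, unstandardize_sub_thetaHat, map_smul, sqrtInfo_inv_apply hI,
    norm_smul, mul_pow, Real.norm_eq_abs, sq_abs, inv_pow, Real.sq_sqrt hn0.le]
  field_simp

section Posterior

variable {r K δ κ : ℝ} {ρ : Vec d → ℝ} {n : ℕ} {ω : Ω}

theorem norm_unstandardize_sub_le (hκ : ∀ v, ‖Matrix.toEuclideanLin S.sqrtInfo⁻¹ v‖ ≤ κ * ‖v‖)
    (u : Vec d) : ‖S.unstandardize n ω u - S.θhat n ω‖ ≤ (√(n : ℝ))⁻¹ * (κ * ‖u‖) := by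
  rw [unstandardize_sub_thetaHat, norm_smul, Real.norm_eq_abs, abs_of_nonneg (by positivity)]
  exact mul_le_mul_of_nonneg_left (hκ u) (by positivity)

theorem norm_unstandardize_sub_truth_le
    (hκ : ∀ v, ‖Matrix.toEuclideanLin S.sqrtInfo⁻¹ v‖ ≤ κ * ‖v‖) (hK : 0 ≤ K) (hκ0 : 0 ≤ κ)
    (hθh : ‖S.θhat n ω - S.θ₀‖ ≤ K * (√(n : ℝ))⁻¹) (u : Vec d) :
    ‖S.unstandardize n ω u - S.θ₀‖ ≤ (K + κ) * (√(n : ℝ))⁻¹ * (1 + ‖u‖) := by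
  have h1 := norm_unstandardize_sub_le (n := n) (ω := ω) hκ u
  have h2 : ‖S.unstandardize n ω u - S.θ₀‖ ≤
      ‖S.unstandardize n ω u - S.θhat n ω‖ + ‖S.θhat n ω - S.θ₀‖ := by
    refine le_trans (le_of_eq ?_) (norm_add_le _ _)
    congr 1
    abel
  have hs : 0 ≤ (√(n : ℝ))⁻¹ := by positivity
  have h3 : 0 ≤ K * (√(n : ℝ))⁻¹ * ‖u‖ + κ * (√(n : ℝ))⁻¹ := by positivity
  linarith

/-- Near the truth, the likelihood ratio is close to a normal density. -/
theorem plHat_ratio_near (hI : S.effInfo.PosDef) (hn : 0 < n)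
    (hκ1 : 1 ≤ κ) (hκ : ∀ v, ‖Matrix.toEuclideanLin S.sqrtInfo⁻¹ v‖ ≤ κ * ‖v‖)
    (hK : 0 < K) (hδ : δ ≤ 1 / (32 * K * κ ^ 2)) (hm1 : √(n : ℝ) * remRate r n ^ 2 ≤ 1)
    (hθh : ‖S.θhat n ω - S.θ₀‖ < δ) (hpos : 0 < S.plHat n ω (S.θhat n ω))
    (hexp : ∀ θ ∈ ball S.θ₀ δ, 0 < S.plHat n ω θ ∧
      |Real.log (S.plHat n ω θ) - Real.log (S.plHat n ω (S.θhat n ω)) +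
        n / 2 * ∑ i, ∑ j, (θ - S.θhat n ω) i * (θ - S.θhat n ω) j * S.effInfo i j| ≤
      K * (n * (‖θ - S.θhat n ω‖ * (remRate r n + ‖θ - S.θhat n ω‖) ^ 2)))
    (u : Vec d) (hu : S.unstandardize n ω u ∈ ball S.θ₀ δ) :
    |(S.plHat n ω (S.unstandardize n ω u) : ℝ) / S.plHat n ω (S.θhat n ω) -
        Real.exp (-‖u‖ ^ 2 / 2)| ≤
      K * κ ^ 3 * (√(n : ℝ) * remRate r n ^ 2) * Real.exp ((2 * K * κ + 3) ^ 2) *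
        Real.exp (-‖u‖ ^ 2 / 8) := by
  obtain ⟨hpu, hexpu⟩ := hexp _ hu
  rw [information_unstandardize hI hn] at hexpu
  have hn0 : (0 : ℝ) < n := by exact_mod_cast hn
  have hpu' : (0 : ℝ) < S.plHat n ω (S.unstandardize n ω u) := by exact_mod_cast hpu
  have hpos' : (0 : ℝ) < S.plHat n ω (S.θhat n ω) := by exact_mod_cast hpos
  have hratio : (S.plHat n ω (S.unstandardize n ω u) : ℝ) / S.plHat n ω (S.θhat n ω) =
      Real.exp (-‖u‖ ^ 2 / 2 + (Real.log (S.plHat n ω (S.unstandardize n ω u)) -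
        Real.log (S.plHat n ω (S.θhat n ω)) + ‖u‖ ^ 2 / 2)) := by
    rw [show -‖u‖ ^ 2 / 2 + (Real.log (S.plHat n ω (S.unstandardize n ω u)) -
        Real.log (S.plHat n ω (S.θhat n ω)) + ‖u‖ ^ 2 / 2) =
      Real.log (S.plHat n ω (S.unstandardize n ω u)) - Real.log (S.plHat n ω (S.θhat n ω)) by ring,
      Real.exp_sub, Real.exp_log hpu', Real.exp_log hpos']
  have hh := norm_unstandardize_sub_le (n := n) (ω := ω) hκ u
  have hhδ : ‖S.unstandardize n ω u - S.θhat n ω‖ ≤ 2 * δ := by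
    have h2 : ‖S.unstandardize n ω u - S.θhat n ω‖ ≤
        ‖S.unstandardize n ω u - S.θ₀‖ + ‖S.θhat n ω - S.θ₀‖ := by
      refine le_trans (le_of_eq ?_) (norm_sub_le _ _)
      congr 1
      abel
    rw [mem_ball, dist_eq_norm] at hu
    linarith
  have hse := inv_sqrt_le_remRate (r := r) hn
  have he := (remRate_pos (r := r) hn).le
  have hs0 : 0 < √(n : ℝ) := by positivity
  have hns : (n : ℝ) * (√(n : ℝ))⁻¹ = √(n : ℝ) := by
    rw [mul_inv_eq_iff_eq_mul₀ hs0.ne', Real.mul_self_sqrt hn0.le]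
  have hx := norm_nonneg u
  have hh0 := norm_nonneg (S.unstandardize n ω u - S.θhat n ω)
  have hsi : 0 ≤ (√(n : ℝ))⁻¹ := by positivity
  have hnh : n * ‖S.unstandardize n ω u - S.θhat n ω‖ ≤ √(n : ℝ) * (κ * ‖u‖) := by
    calc _ ≤ n * ((√(n : ℝ))⁻¹ * (κ * ‖u‖)) := by gcongr
      _ = _ := by rw [← mul_assoc, hns]
  rw [hratio]
  generalize ‖S.unstandardize n ω u - S.θhat n ω‖ = h at *
  generalize remRate r n = e at *
  -- Here `A = K κ³ √n e²` and `c = 2Kκ`. The radius condition `δ ≤ 1 / (32Kκ²)` is what brings the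
  -- quadratic part of the second bound down to `‖u‖² / 8`.
  refine exp_perturbation_le hx (by positivity) (hexpu.trans ?_) (hexpu.trans ?_)
  · have h1 : e + h ≤ κ * e * (1 + ‖u‖) := by
      have h2 : (√(n : ℝ))⁻¹ * (κ * ‖u‖) ≤ e * (κ * ‖u‖) := by gcongr
      nlinarith
    calc K * (n * (h * (e + h) ^ 2)) = K * ((n * h) * (e + h) ^ 2) := by ring
      _ ≤ K * ((√(n : ℝ) * (κ * ‖u‖)) * (κ * e * (1 + ‖u‖)) ^ 2) := by gcongr
      _ = _ := by ring
  · have h1 : n * h * e ^ 2 ≤ κ * ‖u‖ := by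
      calc n * h * e ^ 2 ≤ √(n : ℝ) * (κ * ‖u‖) * e ^ 2 := by gcongr
        _ = (√(n : ℝ) * e ^ 2) * (κ * ‖u‖) := by ring
        _ ≤ 1 * (κ * ‖u‖) := by gcongr
        _ = _ := one_mul _
    have h2 : n * h * h ^ 2 ≤ (κ * ‖u‖) ^ 2 * (2 * δ) := by
      calc n * h * h ^ 2 = (n * h) * h * h := by ring
        _ ≤ (√(n : ℝ) * (κ * ‖u‖)) * ((√(n : ℝ))⁻¹ * (κ * ‖u‖)) * (2 * δ) := by gcongr
        _ = (√(n : ℝ) * (√(n : ℝ))⁻¹) * (κ * ‖u‖) ^ 2 * (2 * δ) := by ring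
        _ = _ := by rw [mul_inv_cancel₀ hs0.ne', one_mul]
    have h3 : K * κ ^ 2 * δ ≤ 1 / 32 := by
      rw [le_div_iff₀ (by positivity)] at hδ
      linarith
    have h4 : (e + h) ^ 2 ≤ 2 * e ^ 2 + 2 * h ^ 2 := by nlinarith [sq_nonneg (e - h)]
    calc K * (n * (h * (e + h) ^ 2)) ≤ K * (n * (h * (2 * e ^ 2 + 2 * h ^ 2))) := by gcongr
      _ = 2 * K * (n * h * e ^ 2) + 2 * K * (n * h * h ^ 2) := by ring
      _ ≤ 2 * K * (κ * ‖u‖) + 2 * K * ((κ * ‖u‖) ^ 2 * (2 * δ)) := by gcongr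
      _ = 2 * K * κ * ‖u‖ + 4 * (K * κ ^ 2 * δ) * ‖u‖ ^ 2 := by ring
      _ ≤ 2 * K * κ * ‖u‖ + 4 * (1 / 32) * ‖u‖ ^ 2 := by gcongr
      _ = _ := by ring

/-- Near the truth, the relative weight is close to a multiple of a normal density. -/
theorem relWeight_near (hI : S.effInfo.PosDef) (hn : 0 < n) (hρ0 : 0 < ρ S.θ₀)
    (hκ1 : 1 ≤ κ) (hκ : ∀ v, ‖Matrix.toEuclideanLin S.sqrtInfo⁻¹ v‖ ≤ κ * ‖v‖)
    (hK : 0 < K) (hδ : δ ≤ 1 / (32 * K * κ ^ 2)) (hδ1 : δ ≤ 1) (hball : ball S.θ₀ δ ⊆ S.Θ)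
    (hm1 : √(n : ℝ) * remRate r n ^ 2 ≤ 1) {R : ℝ} (hR : 0 ≤ R)
    (hρR : ∀ θ ∈ ball S.θ₀ δ, |ρ θ - ρ S.θ₀| ≤ R * ‖θ - S.θ₀‖)
    (hθh : ‖S.θhat n ω - S.θ₀‖ < δ) (hθh' : ‖S.θhat n ω - S.θ₀‖ ≤ K * (√(n : ℝ))⁻¹)
    (hpos : 0 < S.plHat n ω (S.θhat n ω))
    (hexp : ∀ θ ∈ ball S.θ₀ δ, 0 < S.plHat n ω θ ∧
      |Real.log (S.plHat n ω θ) - Real.log (S.plHat n ω (S.θhat n ω)) +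
        n / 2 * ∑ i, ∑ j, (θ - S.θhat n ω) i * (θ - S.θhat n ω) j * S.effInfo i j| ≤
      K * (n * (‖θ - S.θhat n ω‖ * (remRate r n + ‖θ - S.θhat n ω‖) ^ 2)))
    (u : Vec d) (hu : S.unstandardize n ω u ∈ ball S.θ₀ δ) :
    |S.relWeight ρ n ω (S.unstandardize n ω u) - ρ S.θ₀ * Real.exp (-‖u‖ ^ 2 / 2)| ≤
      ((ρ S.θ₀ + R) * (K * κ ^ 3 * Real.exp ((2 * K * κ + 3) ^ 2)) +
        R * (K + κ) * Real.exp 1) * rateM r n * Real.exp (-‖u‖ ^ 2 / 8) := by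
  have h1 := plHat_ratio_near hI hn hκ1 hκ hK hδ hm1 hθh hpos hexp u hu
  have h2 := hρR _ hu
  have h3 := norm_unstandardize_sub_truth_le hκ hK.le (by linarith) hθh' u
  have hm := sqrt_mul_remRate_sq_le (r := r) hn
  have hs := inv_sqrt_le_rateM (r := r) (n := n)
  have hg := one_add_mul_exp_le (x := ‖u‖)
  have hx := norm_nonneg u
  rw [relWeight, indicator_of_mem (hball hu)]
  have hle1 : ‖S.unstandardize n ω u - S.θ₀‖ ≤ 1 := by
    rw [mem_ball, dist_eq_norm] at hu
    linarith
  generalize (S.plHat n ω (S.unstandardize n ω u) : ℝ) / S.plHat n ω (S.θhat n ω) = q at *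
  generalize ρ (S.unstandardize n ω u) = ρu at *
  have hsplit : ρu * q - ρ S.θ₀ * Real.exp (-‖u‖ ^ 2 / 2) =
      ρu * (q - Real.exp (-‖u‖ ^ 2 / 2)) + (ρu - ρ S.θ₀) * Real.exp (-‖u‖ ^ 2 / 2) := by ring
  have hρu : |ρu| ≤ ρ S.θ₀ + R := by
    have h4 : R * ‖S.unstandardize n ω u - S.θ₀‖ ≤ R * 1 := by gcongr
    have h5 := abs_le.mp (h2.trans h4)
    rw [abs_le]
    constructor <;> linarith [h5.1, h5.2]
  have hμ : 0 ≤ rateM r n := le_trans (by positivity) hs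
  rw [hsplit]
  refine (abs_add_le _ _).trans ?_
  rw [abs_mul, abs_mul, abs_of_pos (Real.exp_pos (-‖u‖ ^ 2 / 2)), add_mul, add_mul]
  refine add_le_add ?_ ?_
  · calc |ρu| * |q - Real.exp (-‖u‖ ^ 2 / 2)| ≤ (ρ S.θ₀ + R) *
          (K * κ ^ 3 * (√(n : ℝ) * remRate r n ^ 2) * Real.exp ((2 * K * κ + 3) ^ 2) *
            Real.exp (-‖u‖ ^ 2 / 8)) := by gcongr
      _ ≤ (ρ S.θ₀ + R) * (K * κ ^ 3 * rateM r n * Real.exp ((2 * K * κ + 3) ^ 2) *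
            Real.exp (-‖u‖ ^ 2 / 8)) := by gcongr
      _ = _ := by ring
  · calc |ρu - ρ S.θ₀| * Real.exp (-‖u‖ ^ 2 / 2)
        ≤ R * ((K + κ) * (√(n : ℝ))⁻¹ * (1 + ‖u‖)) * Real.exp (-‖u‖ ^ 2 / 2) := by
          gcongr
          exact h2.trans (by gcongr)
      _ = R * (K + κ) * (√(n : ℝ))⁻¹ * ((1 + ‖u‖) * Real.exp (-‖u‖ ^ 2 / 2)) := by ring
      _ ≤ R * (K + κ) * rateM r n * (Real.exp 1 * Real.exp (-‖u‖ ^ 2 / 8)) := by gcongr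
      _ = _ := by ring

/-- Away from the truth, the relative weight is exponentially small. -/
theorem relWeight_far (hρ : S.IsPrior ρ) (hn : 0 < n) (hgood : S.IsGoodSample ω)
    (hκ1 : 1 ≤ κ) (hκ : ∀ v, ‖Matrix.toEuclideanLin S.sqrtInfo⁻¹ v‖ ≤ κ * ‖v‖)
    (hδ : 0 < δ) {c : ℝ}
    (hc : ∀ θ ∈ S.Θ, δ ≤ dist θ S.θ₀ → S.profDelta n ω θ ≤ ((-c : ℝ) : EReal))
    (hθh : ‖S.θhat n ω - S.θ₀‖ ≤ δ / 2)
    (u : Vec d) (hu : S.unstandardize n ω u ∉ ball S.θ₀ δ) :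
    |S.relWeight ρ n ω (S.unstandardize n ω u) - ρ S.θ₀ * Real.exp (-‖u‖ ^ 2 / 2)| ≤
      ρ S.θ₀ * (2 * κ / δ) * Real.exp 1 * rateM r n * Real.exp (-‖u‖ ^ 2 / 8) +
      Real.exp (-(n * c)) * S.Θ.indicator ρ (S.unstandardize n ω u) := by
  have hρ0 := hρ.pos
  have hw : S.relWeight ρ n ω (S.unstandardize n ω u) ≤
      Real.exp (-(n * c)) * S.Θ.indicator ρ (S.unstandardize n ω u) := by
    by_cases hΘ : S.unstandardize n ω u ∈ S.Θ
    · rw [relWeight, indicator_of_mem hΘ, indicator_of_mem hΘ, mul_comm]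
      refine mul_le_mul_of_nonneg_right ?_ (hρ.nonneg _ hΘ)
      exact hgood.plHat_le_of_profDelta_le hn hΘ (hc _ hΘ (not_lt.mp hu))
    · rw [relWeight, indicator_of_notMem hΘ, indicator_of_notMem hΘ, mul_zero]
  -- Far from the truth `‖u‖` is at least a multiple of `√n`. This factor therefore turns the
  -- Gaussian tail into a term of order `n^{-1/2}`, without any tail estimate.
  have hx1 : 1 ≤ 2 * κ / δ * (√(n : ℝ))⁻¹ * (1 + ‖u‖) := by
    have h1 := norm_unstandardize_sub_le (n := n) (ω := ω) hκ u
    have h2 : ‖S.unstandardize n ω u - S.θ₀‖ ≤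
        ‖S.unstandardize n ω u - S.θhat n ω‖ + ‖S.θhat n ω - S.θ₀‖ := by
      refine le_trans (le_of_eq ?_) (norm_add_le _ _)
      congr 1
      abel
    have h3 : δ ≤ ‖S.unstandardize n ω u - S.θ₀‖ := by
      rw [← dist_eq_norm]
      exact not_lt.mp hu
    have h4 : δ / 2 ≤ (√(n : ℝ))⁻¹ * (κ * ‖u‖) := by linarith
    have h5 : 2 * κ / δ * (√(n : ℝ))⁻¹ * (1 + ‖u‖) =
        2 / δ * ((√(n : ℝ))⁻¹ * (κ * ‖u‖)) + 2 * κ / δ * (√(n : ℝ))⁻¹ := by ring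
    have h6 : 1 ≤ 2 / δ * ((√(n : ℝ))⁻¹ * (κ * ‖u‖)) := by
      calc 1 = 2 / δ * (δ / 2) := by field_simp
        _ ≤ _ := by gcongr
    have h7 : 0 ≤ 2 * κ / δ * (√(n : ℝ))⁻¹ := by positivity
    linarith
  have hgauss : ρ S.θ₀ * Real.exp (-‖u‖ ^ 2 / 2) ≤
      ρ S.θ₀ * (2 * κ / δ) * Real.exp 1 * rateM r n * Real.exp (-‖u‖ ^ 2 / 8) := by
    have hg := one_add_mul_exp_le (x := ‖u‖)
    have hs := inv_sqrt_le_rateM (r := r) (n := n)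
    have hμ : 0 ≤ rateM r n := le_trans (by positivity) hs
    calc ρ S.θ₀ * Real.exp (-‖u‖ ^ 2 / 2)
        ≤ ρ S.θ₀ * (2 * κ / δ * (√(n : ℝ))⁻¹ * (1 + ‖u‖) * Real.exp (-‖u‖ ^ 2 / 2)) := by
          gcongr
          exact le_mul_of_one_le_left (Real.exp_pos _).le hx1
      _ = ρ S.θ₀ * (2 * κ / δ) * (√(n : ℝ))⁻¹ * ((1 + ‖u‖) * Real.exp (-‖u‖ ^ 2 / 2)) := by ring
      _ ≤ ρ S.θ₀ * (2 * κ / δ) * rateM r n * (Real.exp 1 * Real.exp (-‖u‖ ^ 2 / 8)) := by gcongr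
      _ = _ := by ring
  have h0 := relWeight_nonneg hρ n ω (S.unstandardize n ω u)
  have h1 : 0 ≤ ρ S.θ₀ * Real.exp (-‖u‖ ^ 2 / 2) := by positivity
  rw [abs_le]
  constructor <;> linarith

end Posterior

end Experiment

/-! ### The normalizing constant and the normal approximation. -/

namespace Experiment

variable {d : ℕ} {𝒳 B Ω : Type*} [MeasurableSpace 𝒳] [SeminormedAddCommGroup B]
  [MeasurableSpace Ω] {S : Experiment d 𝒳 B Ω}

/-- The normalizing constant of the posterior profile density. -/
theorem abs_integral_relWeight_sub_le {ρ : Vec d → ℝ} (hρ : S.IsPrior ρ) (hΘ : IsCompact S.Θ)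
    (hI : S.effInfo.PosDef) {n : ℕ} (hn : 0 < n) {ω : Ω}
    (hm : AEStronglyMeasurable (S.relWeight ρ n ω) volume) {a E : ℝ}
    (h : ∀ u, |S.relWeight ρ n ω (S.unstandardize n ω u) - ρ S.θ₀ * Real.exp (-‖u‖ ^ 2 / 2)| ≤
      a * Real.exp (-‖u‖ ^ 2 / 8) + E * S.Θ.indicator ρ (S.unstandardize n ω u)) :
    |(∫ u, S.relWeight ρ n ω (S.unstandardize n ω u)) -
        ρ S.θ₀ * (2 * Real.pi) ^ ((d : ℝ) / 2)| ≤
      a * (∫ u : Vec d, Real.exp (-‖u‖ ^ 2 / 8)) + E * S.jacobian n := by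
  have hΘm : MeasurableSet S.Θ := hΘ.isClosed.measurableSet
  have hρi : Integrable (S.Θ.indicator ρ) := by
    rw [integrable_indicator_iff hΘm]
    by_contra hni
    have h1 := hρ.integral_eq_one
    rw [integral_undef hni] at h1
    exact zero_ne_one h1
  obtain ⟨h1, h2⟩ := integrable_comp_unstandardize hI hn ω hρi
  rw [integral_indicator hΘm, hρ.integral_eq_one, mul_one] at h2
  have hg2 : Integrable (fun u : Vec d => ρ S.θ₀ * Real.exp (-‖u‖ ^ 2 / 2)) :=
    (integrable_gaussian (by norm_num)).const_mul _
  have hg8 : Integrable (fun u : Vec d => a * Real.exp (-‖u‖ ^ 2 / 8)) :=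
    (integrable_gaussian (by norm_num)).const_mul _
  have hE := h1.const_mul E
  have hw := aestronglyMeasurable_comp_unstandardize hI hn ω hm
  have hdiff : Integrable (fun u => S.relWeight ρ n ω (S.unstandardize n ω u) -
      ρ S.θ₀ * Real.exp (-‖u‖ ^ 2 / 2)) :=
    (hg8.add hE).mono' (hw.sub hg2.1) (ae_of_all _ h)
  have hwi : Integrable (fun u => S.relWeight ρ n ω (S.unstandardize n ω u)) := by
    refine (hdiff.add hg2).congr (ae_of_all _ fun u => ?_)
    simp
  rw [← integral_gaussian_eq, ← integral_const_mul, ← integral_sub hwi hg2, ← h2,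
    ← integral_const_mul, ← integral_const_mul, ← integral_add hg8 hE, ← Real.norm_eq_abs]
  exact norm_integral_le_of_norm_le (hg8.add hE) (ae_of_all _ h)

/-- The posterior profile density is close to the normal density for well-behaved samples. -/
theorem LocalModel.exists_posterior_bound {r δ C : ℝ} (hr : 1 / 4 < r) (hM : S.LocalModel δ C)
    (F : 𝒳 → ℝ) (hΘ : IsCompact S.Θ) (hI : S.effInfo.PosDef) {ρ : Vec d → ℝ} (hρ : S.IsPrior ρ) :
    ∃ δ₁ : ℝ, 0 < δ₁ ∧ ∀ c : ℝ, 0 < c → ∀ ξ : Vec d, ∃ A : ℝ, 0 < A ∧ ∀ᶠ n in atTop, ∀ ω,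
      S.LocalBounds r F δ C n ω →
      (∀ θ ∈ S.Θ, δ₁ ≤ dist θ S.θ₀ → S.profDelta n ω θ ≤ ((-c : ℝ) : EReal)) →
      AEMeasurable (S.profLik n ω) (volume.restrict S.Θ) →
      |S.postDensity ρ n ω ξ - stdNormalDensity d ξ| ≤ A * rateM r n := by
  obtain ⟨K, δ', e₀, hK, hδ', hδ'δ, he₀, hexp⟩ := hM.exists_expansion hr F
  obtain ⟨κ, hκ1, hκ⟩ := S.exists_norm_sqrtInfo_inv_le
  obtain ⟨R, δρ, hR, hδρ, hρR⟩ := hρ.exists_lipschitz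
  have hρ0 := hρ.pos
  obtain ⟨δ₁, hδ₁, h1, h2, h3, h4⟩ : ∃ δ₁ : ℝ, 0 < δ₁ ∧ δ₁ ≤ δ' ∧ δ₁ ≤ δρ ∧ δ₁ ≤ 1 ∧
      δ₁ ≤ 1 / (32 * K * κ ^ 2) := by
    refine ⟨min (min δ' δρ) (min 1 (1 / (32 * K * κ ^ 2))), ?_, ?_, ?_, ?_, ?_⟩
    · positivity
    · exact (min_le_left _ _).trans (min_le_left _ _)
    · exact (min_le_left _ _).trans (min_le_right _ _)
    · exact (min_le_right _ _).trans (min_le_left _ _)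
    · exact (min_le_right _ _).trans (min_le_right _ _)
  -- The radius is fixed before `c`, because identifiability yields `c` only for a given radius.
  refine ⟨δ₁, hδ₁, fun c hc ξ => ?_⟩
  obtain ⟨A₁, hA₁⟩ : ∃ A₁ : ℝ, A₁ = (ρ S.θ₀ + R) * (K * κ ^ 3 * Real.exp ((2 * K * κ + 3) ^ 2)) +
      R * (K + κ) * Real.exp 1 := ⟨_, rfl⟩
  obtain ⟨A₂, hA₂⟩ : ∃ A₂ : ℝ, A₂ = ρ S.θ₀ * (2 * κ / δ₁) * Real.exp 1 := ⟨_, rfl⟩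
  obtain ⟨J, hJ⟩ : ∃ J : ℝ, J = ∫ u : Vec d, Real.exp (-‖u‖ ^ 2 / 8) := ⟨_, rfl⟩
  obtain ⟨D₀, hD₀⟩ : ∃ D₀ : ℝ, D₀ = ρ S.θ₀ * (2 * Real.pi) ^ ((d : ℝ) / 2) := ⟨_, rfl⟩
  have hA₁0 : 0 < A₁ := by rw [hA₁]; positivity
  have hA₂0 : 0 < A₂ := by rw [hA₂]; positivity
  have hJ0 : 0 ≤ J := by rw [hJ]; exact integral_nonneg fun u => (Real.exp_pos _).le
  have hD₀0 : 0 < D₀ := by rw [hD₀]; positivity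
  have hA' : 0 < (A₁ + A₂) * J + 1 := by positivity
  refine ⟨2 * A₁ / D₀ + 2 * (ρ S.θ₀ * Real.exp (-‖ξ‖ ^ 2 / 2)) * ((A₁ + A₂) * J + 1) / D₀ ^ 2,
    by positivity, ?_⟩
  have hlim1 : ∀ᶠ n in atTop, ((A₁ + A₂) * J + 1) * rateM r n ≤ D₀ / 2 := by
    have := (tendsto_rateM hr).const_mul ((A₁ + A₂) * J + 1)
    rw [mul_zero] at this
    exact this.eventually_le_const (by positivity)
  have hlim2 : ∀ᶠ n : ℕ in atTop, (K + κ) * (√(n : ℝ))⁻¹ * (1 + ‖ξ‖) < δ₁ := by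
    have := (tendsto_inv_sqrt.const_mul (K + κ)).mul_const (1 + ‖ξ‖)
    rw [mul_zero, zero_mul] at this
    exact this.eventually_lt_const hδ₁
  have hlim3 : ∀ᶠ n : ℕ in atTop, K * (√(n : ℝ))⁻¹ ≤ δ₁ / 2 := by
    have := tendsto_inv_sqrt.const_mul K
    rw [mul_zero] at this
    exact this.eventually_le_const (by positivity)
  filter_upwards [hlim1, hlim2, hlim3, eventually_gt_atTop 0,
    (tendsto_remRate hr).eventually_lt_const he₀,
    (tendsto_sqrt_mul_remRate_sq hr).eventually_le_const (by norm_num : (0 : ℝ) < 1),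
    S.eventually_exp_neg_mul_jacobian_le c hc] with n hn1 hn2 hn3 hn he hm1 hjac ω hB hfar hmeas
  have hgood := hB.good
  -- Outside the ball `Δ_n ≤ -c < 0`, whereas `Δ_n` is zero at `θhat`.
  have hθh : ‖S.θhat n ω - S.θ₀‖ < δ₁ := by
    by_contra hge
    have h5 := hfar _ (S.θhat_mem n ω) (by rw [dist_eq_norm]; exact not_lt.mp hge)
    rw [hgood.profDelta_thetaHat, ← EReal.coe_zero, EReal.coe_le_coe_iff] at h5
    linarith
  obtain ⟨hθh', hexpn⟩ := hexp n hn he ω hB (hθh.trans_le h1)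
  have hμ : 0 ≤ rateM r n := le_trans (by positivity) inv_sqrt_le_rateM
  have hexpn' := fun θ hθ => hexpn θ (ball_subset_ball h1 hθ)
  have hball : ball S.θ₀ δ₁ ⊆ S.Θ :=
    (ball_subset_ball (h1.trans hδ'δ)).trans hM.ball_subset
  have hnear := fun u hu => relWeight_near (u := u) hI hn hρ0 hκ1 hκ hK h4 h3 hball hm1 hR
    (fun θ hθ => hρR θ (ball_subset_ball h2 hθ)) hθh hθh' (hgood.pos n) hexpn' hu
  rw [← hA₁] at hnear
  have hwm := aestronglyMeasurable_relWeight hρ hΘ hgood n hmeas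
  have hΘρ : ∀ θ, 0 ≤ S.Θ.indicator ρ θ := indicator_nonneg hρ.nonneg
  have hall : ∀ u, |S.relWeight ρ n ω (S.unstandardize n ω u) -
      ρ S.θ₀ * Real.exp (-‖u‖ ^ 2 / 2)| ≤
      ((A₁ + A₂) * rateM r n) * Real.exp (-‖u‖ ^ 2 / 8) +
        Real.exp (-(n * c)) * S.Θ.indicator ρ (S.unstandardize n ω u) := by
    intro u
    by_cases hu : S.unstandardize n ω u ∈ ball S.θ₀ δ₁
    · refine (hnear u hu).trans ?_
      have h6 := mul_nonneg (Real.exp_pos (-(n * c))).le (hΘρ (S.unstandardize n ω u))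
      have h7 : 0 ≤ A₂ * rateM r n * Real.exp (-‖u‖ ^ 2 / 8) := by positivity
      linarith
    · have h5 := relWeight_far (r := r) hρ hn hgood hκ1 hκ hδ₁ hfar (hθh'.trans hn3) u hu
      rw [← hA₂] at h5
      refine h5.trans ?_
      have h7 : 0 ≤ A₁ * rateM r n * Real.exp (-‖u‖ ^ 2 / 8) := by positivity
      linarith
  have hint := abs_integral_relWeight_sub_le hρ hΘ hI hn hwm hall
  rw [← hJ, ← hD₀] at hint
  have hint' : |(∫ u, S.relWeight ρ n ω (S.unstandardize n ω u)) - D₀| ≤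
      ((A₁ + A₂) * J + 1) * rateM r n := by
    refine hint.trans ?_
    have h8 := hjac.trans (inv_sqrt_le_rateM (r := r) (n := n))
    linarith
  have hξ : S.unstandardize n ω ξ ∈ ball S.θ₀ δ₁ := by
    rw [mem_ball, dist_eq_norm]
    exact (norm_unstandardize_sub_truth_le hκ hK.le (by linarith) hθh' ξ).trans_lt hn2
  have hnum : |S.relWeight ρ n ω (S.unstandardize n ω ξ) -
      ρ S.θ₀ * Real.exp (-‖ξ‖ ^ 2 / 2)| ≤ A₁ * rateM r n := by
    refine (hnear ξ hξ).trans ?_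
    refine mul_le_of_le_one_right (by positivity) (Real.exp_le_one_iff.mpr ?_)
    have := sq_nonneg ‖ξ‖
    linarith
  have hstd : stdNormalDensity d ξ = ρ S.θ₀ * Real.exp (-‖ξ‖ ^ 2 / 2) / D₀ := by
    rw [stdNormalDensity, hD₀, neg_div, Real.rpow_neg (by positivity), mul_div_mul_left _ _ hρ0.ne',
      div_eq_mul_inv (Real.exp _), mul_comm]
  rw [hgood.postDensity_eq hρ hI hn hwm, hstd]
  exact abs_div_sub_div_le (by positivity) hD₀0 hnum hint' hn1

end Experiment

/-! ### Events of high probability -/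

section HighProbability

variable {Ω : Type*} [MeasurableSpace Ω] {Pr : Measure Ω}

/-- The events `A C n` have asymptotic probability as close to one as desired, for all large
constants `C`. -/
def HighProb (Pr : Measure Ω) (A : ℝ → ℕ → Ω → Prop) : Prop :=
  ∀ ε : ℝ≥0∞, 0 < ε → ∃ C₀ : ℝ, ∀ C, C₀ ≤ C → ∀ᶠ n in atTop, Pr {ω | ¬ A C n ω} ≤ ε

theorem HighProb.of_ae {A : ℝ → ℕ → Ω → Prop} {C₀ : ℝ}
    (h : ∀ C, C₀ ≤ C → ∀ n, ∀ᵐ ω ∂Pr, A C n ω) : HighProb Pr A := fun ε _ =>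
  ⟨C₀, fun C hC => Eventually.of_forall fun n => by
    have h1 : Pr {ω | ¬ A C n ω} = 0 := h C hC n
    rw [h1]
    exact zero_le⟩

theorem HighProb.of_monotone {A : ℝ → ℕ → Ω → Prop}
    (hA : ∀ C C', C ≤ C' → ∀ n ω, A C n ω → A C' n ω)
    (h : ∀ ε : ℝ≥0∞, 0 < ε → ∃ C, ∀ᶠ n in atTop, Pr {ω | ¬ A C n ω} ≤ ε) : HighProb Pr A := by
  intro ε hε
  obtain ⟨C, hC⟩ := h ε hε
  refine ⟨C, fun C' hC' => hC.mono fun n hn => le_trans (measure_mono fun ω hω => ?_) hn⟩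
  exact fun h' => hω (hA C C' hC' n ω h')

theorem HighProb.mono {A A' : ℝ → ℕ → Ω → Prop} (hA : HighProb Pr A) {C₁ : ℝ}
    (h : ∀ C, C₁ ≤ C → ∀ n ω, A C n ω → A' C n ω) : HighProb Pr A' := by
  intro ε hε
  obtain ⟨C₀, hC₀⟩ := hA ε hε
  refine ⟨max C₀ C₁, fun C hC => (hC₀ C ((le_max_left _ _).trans hC)).mono fun n hn =>
    le_trans (measure_mono fun ω hω => ?_) hn⟩
  exact fun h' => hω (h C ((le_max_right _ _).trans hC) n ω h')

/-- Quantifying over all large `C` in `HighProb` lets two families be combined at a common constant,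
even when they are not monotone in `C`. -/
theorem HighProb.and {A A' : ℝ → ℕ → Ω → Prop} (hA : HighProb Pr A) (hA' : HighProb Pr A') :
    HighProb Pr (fun C n ω => A C n ω ∧ A' C n ω) := by
  intro ε hε
  obtain ⟨C₀, hC₀⟩ := hA (ε / 2) (ENNReal.half_pos hε.ne')
  obtain ⟨C₁, hC₁⟩ := hA' (ε / 2) (ENNReal.half_pos hε.ne')
  refine ⟨max C₀ C₁, fun C hC => ?_⟩
  filter_upwards [hC₀ C ((le_max_left _ _).trans hC), hC₁ C ((le_max_right _ _).trans hC)]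
    with n h1 h2
  refine le_trans ?_ ((add_le_add h1 h2).trans (ENNReal.add_halves ε).le)
  refine le_trans (measure_mono fun ω hω => ?_) (measure_union_le _ _)
  exact not_and_or.mp hω

theorem HighProb.forall_finset {ι : Type*} {A : ι → ℝ → ℕ → Ω → Prop} (s : Finset ι)
    (hA : ∀ i, HighProb Pr (A i)) : HighProb Pr (fun C n ω => ∀ i ∈ s, A i C n ω) := by
  classical
  induction s using Finset.induction_on with
  | empty => exact HighProb.of_ae (C₀ := 0) (by simp)
  | insert i s _ ih =>
    refine ((hA i).and ih).mono (C₁ := 0) fun C _ n ω h => ?_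
    simpa using h

theorem HighProb.forall_fintype {ι : Type*} [Fintype ι] {A : ι → ℝ → ℕ → Ω → Prop}
    (hA : ∀ i, HighProb Pr (A i)) : HighProb Pr (fun C n ω => ∀ i, A i C n ω) :=
  (HighProb.forall_finset Finset.univ hA).mono (C₁ := 0) fun _ _ _ _ h i =>
    h i (Finset.mem_univ i)

end HighProbability

theorem rateM_nonneg (r : ℝ) (n : ℕ) : 0 ≤ rateM r n :=
  add_nonneg (Real.rpow_nonneg (Nat.cast_nonneg n) _) (Real.rpow_nonneg (Nat.cast_nonneg n) _)

/-! ### From the stochastic assumptions to events of high probability. -/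

namespace Experiment

variable {d : ℕ} {𝒳 B Ω : Type*} [MeasurableSpace 𝒳] [SeminormedAddCommGroup B]
  [MeasurableSpace Ω] {S : Experiment d 𝒳 B Ω}

/-- A stochastic order along all consistent sequences of parameters holds uniformly in a
neighborhood of the true parameter. -/
theorem highProb_of_isBigOP {Y Z : ℕ → Ω → Vec d → ℝ} (hZ : ∀ n ω θ, 0 ≤ Z n ω θ)
    (h : ∀ θt : ℕ → Ω → Vec d, S.IsConsistent θt →
      IsBigOP S.prob (fun n ω => Y n ω (θt n ω)) (fun n ω => Z n ω (θt n ω))) :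
    HighProb S.prob (fun C n ω => ∀ θ ∈ S.Θ, dist θ S.θ₀ < 1 / (max C 0 + 1) →
      |Y n ω θ| ≤ C * Z n ω θ) := by
  refine HighProb.of_monotone (fun C C' hC n ω hA θ hθ hd => ?_) fun ε hε => ?_
  -- As `C` grows the bound weakens and the radius `1 / (max C 0 + 1)` shrinks, so the property is
  -- monotone.
  · refine (hA θ hθ (hd.trans_le ?_)).trans (mul_le_mul_of_nonneg_right hC (hZ n ω θ))
    have := le_max_right C 0
    gcongr
  · obtain ⟨k, hk⟩ := exists_uniform_of_consistent S.prob S.Θ S.θ₀_mem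
      (fun k n ω θ => k * Z n ω θ < |Y n ω θ|)
      (fun k l hkl n ω θ hl => lt_of_le_of_lt
        (mul_le_mul_of_nonneg_right (by exact_mod_cast hkl) (hZ n ω θ)) hl)
      (fun θt hmem hcons ε hε => by
        obtain ⟨C, -, hC⟩ := h θt ⟨hmem, hcons⟩ ε hε
        obtain ⟨k, hk⟩ := exists_nat_ge C
        refine ⟨k, hC.mono fun n hn => le_trans (measure_mono fun ω hω => ?_) hn⟩
        exact lt_of_le_of_lt (mul_le_mul_of_nonneg_right hk (hZ n ω _)) hω) ε hε
    refine ⟨k, hk.mono fun n hn => le_trans (measure_mono fun ω hω => ?_) hn⟩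
    rw [max_eq_left (Nat.cast_nonneg k)] at hω
    have hω' : ¬ ∀ θ ∈ S.Θ, dist θ S.θ₀ < 1 / ((k : ℝ) + 1) → |Y n ω θ| ≤ k * Z n ω θ := hω
    push Not at hω'
    exact hω'

theorem highProb_donsker {𝓕 : Set (𝒳 → ℝ)} (h : IsDonsker S.prob S.X S.P₀ 𝓕) :
    HighProb S.prob (fun C n ω => ∀ f ∈ 𝓕, |empProc S.X S.P₀ n f ω| ≤ C) := by
  refine HighProb.of_monotone (fun C C' hC n ω hA f hf => (hA f hf).trans hC) fun ε hε => ?_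
  obtain ⟨C, hC⟩ := h.exists_bound ε hε
  refine ⟨C, hC.mono fun n hn => le_trans (measure_mono fun ω hω => ?_) hn⟩
  have hω' : ¬ ∀ f ∈ 𝓕, |empProc S.X S.P₀ n f ω| ≤ C := hω
  push Not at hω'
  exact hω'

theorem highProb_envelope {F : 𝒳 → ℝ} (hF : Integrable F S.P₀) :
    HighProb S.prob (fun C n ω => empMean S.X n F ω ≤ C) := by
  refine HighProb.of_monotone (fun C C' hC n ω hA => hA.trans hC) fun ε hε => ?_
  obtain ⟨C, hC⟩ := exists_bound_empMean S.measurable_X S.law_X hF ε hε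
  exact ⟨C, Eventually.of_forall fun n => by simpa only [not_le] using hC n⟩

/-- The quadratic bias bound at `η = η₀` is zero. -/
theorem integral_ellT_eq_zero {r : ℝ} (hB2 : S.NuisanceSmooth r) (i : Fin d) :
    ∫ x, S.ellT i S.θ₀ S.θ₀ S.η₀ x ∂S.P₀ = 0 := by
  obtain ⟨C, δ, hδ, h⟩ := hB2.noBias
  have h1 := h S.η₀ ⟨S.η₀_mem, mem_ball_self hδ⟩ i
  simpa using h1

theorem highProb_score {r : ℝ} (hLF : S.IsLeastFavorable) (hB2 : S.NuisanceSmooth r) (i : Fin d) :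
    HighProb S.prob (fun C n ω =>
      |empMean S.X n (S.ellT i S.θ₀ S.θ₀ S.η₀) ω| ≤ C * (√(n : ℝ))⁻¹) := by
  have := S.isProb
  refine HighProb.of_monotone (fun C C' hC n ω hA => hA.trans
    (mul_le_mul_of_nonneg_right hC (by positivity))) fun ε hε => ?_
  obtain ⟨C, hC⟩ := exists_bound_empMean_of_integral_eq_zero S.measurable_X S.law_X S.indep
    (memLp_ellT hLF i) (integral_ellT_eq_zero hB2 i) ε hε
  refine ⟨C, (eventually_gt_atTop 0).mono fun n hn => ?_⟩
  simpa only [not_le] using hC n hn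

/-- The properties of the model near the truth. -/
theorem exists_localModel {r : ℝ} (hLF : S.IsLeastFavorable) (hReg : S.IsRegularSubmodel)
    (hint : S.θ₀ ∈ interior S.Θ) (hA2 : ∀ θ ∈ S.Θ, ∀ η ∈ S.H, S.sub θ θ η = η)
    (hI : S.effInfo.PosDef) (hB2 : S.NuisanceSmooth r) :
    ∃ δ₀ C₀ : ℝ, 0 < δ₀ ∧ ∀ δ C, 0 < δ → δ ≤ δ₀ → C₀ ≤ C → S.LocalModel δ C := by
  obtain ⟨δ₁, hδ₁, hball⟩ := Metric.isOpen_iff.mp isOpen_interior _ hint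
  obtain ⟨δ₂, hδ₂, hsub⟩ := hLF.sub_mem
  obtain ⟨C₃, δ₃, hδ₃, hTT⟩ := hB2.lipTT
  obtain ⟨C₄, δ₄, hδ₄, hTθ⟩ := hB2.lipTθ
  obtain ⟨C₅, δ₅, hδ₅, hbias⟩ := hB2.noBias
  obtain ⟨C₆, -, hinfo⟩ := exists_norm_le_effInfo hI
  refine ⟨min (min δ₁ δ₂) (min δ₃ (min δ₄ δ₅)),
    max (max 1 C₃) (max C₄ (max C₅ C₆)), by positivity, fun δ C hδ hδle hC => ?_⟩
  simp only [le_min_iff, max_le_iff] at hδle hC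
  obtain ⟨⟨h1, h2⟩, h3, h4, h5⟩ := hδle
  obtain ⟨⟨k1, k3⟩, k4, k5, k6⟩ := hC
  refine ⟨hδ, k1, (ball_subset_ball h1).trans (hball.trans interior_subset), hA2,
    fun t ht θ hθ η hη => hsub t (ball_subset_ball h2 ht) θ (ball_subset_ball h2 hθ) η
      ⟨hη.1, ball_subset_ball h2 hη.2⟩, fun η hη i j => ?_, fun η hη i j => ?_,
    fun η hη i => ?_, fun v => ?_⟩
  · have := hTT η ⟨hη.1, ball_subset_ball h3 hη.2⟩ i j
    rw [integral_ellTT hLF hReg hint hA2, sub_neg_eq_add] at this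
    exact this.trans (by gcongr)
  · have := hTθ η ⟨hη.1, ball_subset_ball h4 hη.2⟩ i j
    rw [integral_ellTθ hLF hReg hint hA2, sub_zero] at this
    exact this.trans (by gcongr)
  · have h6 := hbias η ⟨hη.1, ball_subset_ball h5 hη.2⟩ i
    have h7 : Integrable (S.ellT i S.θ₀ S.θ₀ S.η₀) S.P₀ := by
      have : IsProbabilityMeasure S.P₀ := ⟨by
        rw [P₀, withDensity_apply _ MeasurableSet.univ, Measure.restrict_univ]
        exact S.lintegral_p _ S.θ₀_mem _ S.η₀_mem⟩
      exact (memLp_ellT hLF i).integrable (by norm_num)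
    by_cases h8 : Integrable (S.ellT i S.θ₀ S.θ₀ η) S.P₀
    · rw [integral_sub h8 h7, integral_ellT_eq_zero hB2, sub_zero]
      exact h6.trans (by gcongr)
    -- If the score at `η` is not integrable, neither is its difference from the integrable score at
    -- `η₀`, and the integral is `0` by convention.
    · rw [integral_undef fun h9 => h8 ((h9.add h7).congr (ae_of_all _ fun x => by simp)), abs_zero]
      have : 0 ≤ C := by linarith
      positivity
  · refine (hinfo v).trans (mul_le_mul_of_nonneg_right k6 ?_)
    exact Finset.sum_nonneg fun i _ => abs_nonneg _

/-- Samples are well behaved with high probability. -/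
theorem highProb_localBounds {r δB δD δ₁ : ℝ} {F : 𝒳 → ℝ} (hLF : S.IsLeastFavorable)
    (hRate : S.NuisanceRate r) (hB2 : S.NuisanceSmooth r) (hF : Integrable F S.P₀)
    (hsmooth : ∀ᵐ x ∂S.P₀, S.IsSmoothAt δB (F x) x)
    (hDonsker : ∀ i j : Fin d, IsDonsker S.prob S.X S.P₀ (S.localClass (S.ellTT i j) δD) ∧
      IsDonsker S.prob S.X S.P₀ (S.localClass (S.ellTθ i j) δD)) (hδD : 0 < δD)
    (hδ₁B : δ₁ ≤ δB) (hδ₁D : δ₁ ≤ δD) :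
    HighProb S.prob (fun C n ω =>
      S.LocalBounds r F (min δ₁ (1 / (max C 0 + 1))) C n ω) := by
  have h1 : HighProb S.prob (fun _ _ ω =>
      S.IsGoodSample ω ∧ ∀ i, S.IsSmoothAt δB (F (S.X i ω)) (S.X i ω)) :=
    HighProb.of_ae (C₀ := 0) fun _ _ _ => S.ae_isGoodSample.and (S.ae_forall_sample hsmooth)
  have h2 := highProb_envelope hF
  have h3 := HighProb.forall_fintype fun i => highProb_score hLF hB2 i
  have h4 := highProb_of_isBigOP (S := S) (Y := fun n ω θ => ‖S.ηhat n θ ω - S.η₀‖)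
    (Z := fun n _ θ => ‖θ - S.θ₀‖ + (n : ℝ) ^ (-r))
    (fun n ω θ => add_nonneg (norm_nonneg _) (Real.rpow_nonneg (Nat.cast_nonneg n) _)) hRate
  have h5 := HighProb.forall_fintype fun i => highProb_of_isBigOP (S := S)
    (Y := fun n ω θ => empProc S.X S.P₀ n (fun x => S.ellT i S.θ₀ S.θ₀ (S.ηhat n θ ω) x -
      S.ellT i S.θ₀ S.θ₀ S.η₀ x) ω)
    (Z := fun n _ θ => rateM r n + max ((n : ℝ) ^ (1 / 2 - r)) 1 * ‖θ - S.θ₀‖)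
    (fun n ω θ => add_nonneg (rateM_nonneg r n)
      (mul_nonneg (zero_le_one.trans (le_max_right _ _)) (norm_nonneg _)))
    (fun θt hθt => hB2.modulus θt hθt i)
  have h6 := HighProb.forall_fintype fun i => HighProb.forall_fintype fun j =>
    highProb_donsker (hDonsker i j).1
  have h7 := HighProb.forall_fintype fun i => HighProb.forall_fintype fun j =>
    highProb_donsker (hDonsker i j).2
  refine (h1.and (h2.and (h3.and (h4.and (h5.and (h6.and h7)))))).mono (C₁ := 0)
    fun C _ n ω h => ?_
  obtain ⟨⟨a1, a1'⟩, a2, a3, a4, a5, a6, a7⟩ := h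
  have hclass : ∀ η ∈ S.H ∩ ball S.η₀ (min δ₁ (1 / (max C 0 + 1))),
      ∀ g : Vec d → Vec d → B → 𝒳 → ℝ,
      g S.θ₀ S.θ₀ η ∈ S.localClass g δD := fun η hη g =>
    ⟨S.θ₀, mem_ball_self hδD, S.θ₀, mem_ball_self hδD, η,
      ⟨hη.1, ball_subset_ball ((min_le_left _ _).trans hδ₁D) hη.2⟩, rfl⟩
  exact
    { good := a1
      smooth := fun i => (a1' i).mono ((min_le_left _ _).trans hδ₁B)
      envelope := a2
      score := a3
      rate := fun θ hθ hd => by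
        have := a4 θ hθ (hd.trans_le (min_le_right _ _))
        rwa [abs_of_nonneg (norm_nonneg _)] at this
      modulus := fun θ hθ hd i => a5 i θ hθ (hd.trans_le (min_le_right _ _))
      proc_TT := fun η hη i j => a6 i j _ (hclass η hη _)
      proc_Tθ := fun η hη i j => a7 i j _ (hclass η hη _) }

end Experiment

end ProfileSampler

end

/-! ### Assembly of the constants. -/

theorem corollary1 {d : ℕ} {𝒳 B Ω : Type*} [MeasurableSpace 𝒳] [SeminormedAddCommGroup B]
    [MeasurableSpace Ω] (S : ProfileSampler.Experiment d 𝒳 B Ω) (r : ℝ) (ρ : ProfileSampler.Vec d → ℝ)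
    (hr : 1 / 4 < r)
    (hLF : S.IsLeastFavorable)
    (hReg : S.IsRegularSubmodel)
    (hRate : S.NuisanceRate r)
    (hA1 : IsCompact S.Θ ∧ S.θ₀ ∈ interior S.Θ)
    (hA2 : ∀ θ ∈ S.Θ, ∀ η ∈ S.H, S.sub θ θ η = η)
    (hA3 : S.effInfo.PosDef)
    (hB1 : S.SmoothEnvelope)
    (hB2 : S.NuisanceSmooth r)
    (hC1 : S.EmpiricalClasses)
    (hId : S.Identifiable)
    (hPrior : S.IsPrior ρ)
    (hMeas : ∀ᵐ ω ∂S.prob, ∀ n, AEMeasurable (S.profLik n ω) (volume.restrict S.Θ)) :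
    ∀ ξ : ProfileSampler.Vec d,
      ProfileSampler.IsBigOP S.prob
        (fun n ω => S.postDensity ρ n ω ξ - ProfileSampler.stdNormalDensity d ξ)
        (fun n _ => ProfileSampler.rateM r n) := by
  intro ξ ε hε
  obtain ⟨δM, CM, hδM, hM⟩ :=
    ProfileSampler.Experiment.exists_localModel hLF hReg hA1.2 hA2 hA3 hB2
  obtain ⟨δB, hδB, F, hF, hsmooth⟩ := hB1
  obtain ⟨δD, hδD, hDonsker⟩ := hC1
  have hδ₁ : 0 < min δM (min δB δD) := by positivity
  obtain ⟨C₀, hC₀⟩ := ProfileSampler.Experiment.highProb_localBounds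
    (δ₁ := min δM (min δB δD)) hLF hRate hB2 hF hsmooth
    (fun i j => ⟨(hDonsker i j i).1, (hDonsker i j i).2.1⟩) hδD
    ((min_le_right _ _).trans (min_le_left _ _)) ((min_le_right _ _).trans (min_le_right _ _))
    (ε / 2) (ENNReal.half_pos hε.ne')
  -- The constants are chosen in the order `C`, `δ`, `δ'`, `c`, `A`: the radius shrinks with `C`,
  -- identifiability turns `δ'` into `c`, and `A` depends on `ε` through all of them. The two
  -- exceptional events get `ε / 2` each.
  set C := max C₀ CM
  set δ := min (min δM (min δB δD)) (1 / (max C 0 + 1))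
  have hδ : 0 < δ := lt_min hδ₁ (by positivity)
  obtain ⟨δ', hδ', hpost⟩ := (hM δ C hδ ((min_le_left _ _).trans (min_le_left _ _))
    (le_max_right _ _)).exists_posterior_bound hr F hA1.1 hA3 hPrior
  obtain ⟨c, hc, hfar⟩ := hId.exists_uniform hδ' (ε / 2) (ENNReal.half_pos hε.ne')
  obtain ⟨A, hA, hbound⟩ := hpost c hc ξ
  refine ⟨A, hA, ?_⟩
  filter_upwards [hC₀ C (le_max_left _ _), hfar, hbound] with n h1 h2 h3
  refine le_trans ?_ ((add_le_add h1 h2).trans (ENNReal.add_halves ε).le)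
  refine le_trans (measure_mono_ae ?_) (measure_union_le _ _)
  -- Measurability of the profile likelihood fails only on a null set, so it costs no probability.
  filter_upwards [hMeas] with ω hω hlt
  by_contra hcon
  have hcon' := not_or.mp hcon
  refine (h3 ω (not_not.mp hcon'.1) (fun θ hθ hd => ?_) (hω n)).not_gt hlt
  exact not_lt.mp fun h => hcon'.2 ⟨θ, hθ, hd, h⟩
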